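/- Let $(M,\Omega)$ be a closed connected symplectic manifold, and let $\mathrm{Ham}(M,\Omega)$ be its group of Hamiltonian diffeomorphisms, i.e. time-one maps of flows of smooth time-dependent Hamiltonians, where $\operatorname{sgrad}F$ is defined by $\Omega(\operatorname{sgrad}F,\cdot)=-dF$. Put $S^1=\mathbb R/\mathbb Z$. A smooth loop $h\colon S^1\to \mathrm{Ham}(M,\Omega)$ is a family of elements $h(t)\in\mathrm{Ham}(M,\Omega)$ such that $(t,x)\mapsto h(t)x$ is smooth; $\pi_1(\mathrm{Ham}(M,\Omega))$ is the (abelian) group of smooth loops based at the identity up to smooth based homotopy in $\mathrm{Ham}(M,\Omega)$. A free smooth loop represents $\gamma\in\pi_1(\mathrm{Ham}(M,\Omega))$ if it is freely smoothly homotopic to a based loop of class $\gamma$. For $\gamma\in\pi_1(\mathrm{Ham}(M,\Omega))$ let $$\nu(\gamma)=\inf\int_0^1\bigl(\max_M F_t-\min_M F_t\bigr)\,dt,$$ where the infimum is over all smooth loops $\{f_t\}$ based at the identity that represent $\gamma$, and $F_t$ is the Hamiltonian generating $\{f_t\}$, $\frac{d}{dt}f_t x=\operatorname{sgrad}F_t(f_t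 x)$. A self-map $T$ of a compact space is called strictly ergodic if it has exactly one invariant Borel probability measure, and this measure is positive on nonempty open sets. A smooth free loop $h\colon S^1\to\mathrm{Ham}(M,\Omega)$ is called strictly ergodic if for some irrational $\alpha$ the skew product $$T_{h,\alpha}\colon M\times S^1\to M\times S^1,\qquad T_{h,\alpha}(y,t)=(h(t)y,\,t+\alpha),$$ is strictly ergodic. **Theorem.** If $\gamma\in\pi_1(\mathrm{Ham}(M,\Omega))$ is represented by a smooth strictly ergodic loop, then its asymptotic Hofer norm vanishes: the limit $\lim_{k\to+\infty}\nu(k\gamma)/k$ exists and equals $0$. -/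

import Mathlib

open Set Filter Topology MeasureTheory
open scoped Manifold ContDiff

noncomputable section

/-! ### Symplectic forms on a manifold modelled on a vector space -/

section Symplectic

variable (E : Type*) [NormedAddCommGroup E] [NormedSpace ℝ E]
  (M : Type*) [TopologicalSpace M] [ChartedSpace E M]

/-- The expression of a field of alternating bilinear forms in the chart at `x₀`: its pullback under
the inverse of the chart. It is meaningful on the (open) target of the chart. -/
def chartForm {E : Type*} [NormedAddCommGroup E] [NormedSpace ℝ E]
    {M : Type*} [TopologicalSpace M] [ChartedSpace E M]
    (η : ∀ x : M, TangentSpace 𝓘(ℝ, E) x [⋀^Fin 2]→L[ℝ] ℝ) (x₀ : M) (y : E) :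
    E [⋀^Fin 2]→L[ℝ] ℝ :=
  (η ((extChartAt 𝓘(ℝ, E) x₀).symm y)).compContinuousLinearMap
    (mfderiv 𝓘(ℝ, E) 𝓘(ℝ, E) (extChartAt 𝓘(ℝ, E) x₀).symm y)

/-- A symplectic form: a smooth closed nondegenerate differential 2-form. -/
structure SymplecticForm where
  /-- the alternating bilinear form on each tangent space -/
  form : ∀ x : M, TangentSpace 𝓘(ℝ, E) x [⋀^Fin 2]→L[ℝ] ℝ
  smooth : ∀ x₀ : M, ContDiffOn ℝ ∞ (chartForm form x₀) (extChartAt 𝓘(ℝ, E) x₀).target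
  closed : ∀ x₀ : M, ∀ y ∈ (extChartAt 𝓘(ℝ, E) x₀).target, extDeriv (chartForm form x₀) y = 0
  nondegenerate : ∀ (x : M) (v : TangentSpace 𝓘(ℝ, E) x),
    (∀ w : TangentSpace 𝓘(ℝ, E) x, form x ![v, w] = 0) → v = 0

end Symplectic

variable {E : Type*} [NormedAddCommGroup E] [NormedSpace ℝ E]
  {M : Type*} [TopologicalSpace M] [ChartedSpace E M]

/-! ### Diffeomorphisms and smooth families of bijections

The bijections of `M` form the group `Equiv.Perm M`, whose product is composition. -/

/-- A diffeomorphism: a smooth bijection with smooth inverse. -/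
def IsDiffeo (E : Type*) [NormedAddCommGroup E] [NormedSpace ℝ E]
    {M : Type*} [TopologicalSpace M] [ChartedSpace E M] (φ : Equiv.Perm M) : Prop :=
  ContMDiff 𝓘(ℝ, E) 𝓘(ℝ, E) ∞ (fun x => φ x) ∧ ContMDiff 𝓘(ℝ, E) 𝓘(ℝ, E) ∞ (fun x => φ.symm x)

/-- A family `f p` of bijections of `M` with parameter `p` in a normed space is smooth if
`(p, x) ↦ f p x` is smooth. -/
def SmoothFamily (E : Type*) [NormedAddCommGroup E] [NormedSpace ℝ E]
    {M : Type*} [TopologicalSpace M] [ChartedSpace E M]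
    {P : Type*} [NormedAddCommGroup P] [NormedSpace ℝ P] (f : P → Equiv.Perm M) : Prop :=
  ContMDiff (𝓘(ℝ, P).prod 𝓘(ℝ, E)) 𝓘(ℝ, E) ∞ (fun q : P × M => f q.1 q.2)

/-! ### Hamiltonian diffeomorphisms -/

/-- `IsSgradAt Ω F x ξ`: the tangent vector `ξ` is the symplectic gradient of the function `F`
at `x`, that is `Ω (ξ, ·) = - dF` at `x`. -/
def IsSgradAt (Ω : SymplecticForm E M) (F : M → ℝ) (x : M) (ξ : TangentSpace 𝓘(ℝ, E) x) : Prop :=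
  ∀ v : TangentSpace 𝓘(ℝ, E) x, Ω.form x ![ξ, v] = - mfderiv 𝓘(ℝ, E) 𝓘(ℝ, ℝ) F x v

/-- The velocity at time `t` of the trajectory `s ↦ f s x`. -/
def velocity (E : Type*) [NormedAddCommGroup E] [NormedSpace ℝ E]
    {M : Type*} [TopologicalSpace M] [ChartedSpace E M]
    (f : ℝ → Equiv.Perm M) (t : ℝ) (x : M) : TangentSpace 𝓘(ℝ, E) (f t x) :=
  mfderiv 𝓘(ℝ, ℝ) 𝓘(ℝ, E) (fun s => f s x) t (1 : ℝ)

/-- The smooth time-dependent Hamiltonian `F` generates the path `f`: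
`d/dt (f t x) = sgrad F_t (f t x)`. On a closed connected manifold `F t` is determined by `f` up to
an additive constant depending on `t`. Requiring `F t` to have mean zero would single out one
representative; as adding constants affects neither `sgrad F_t` nor `max F_t - min F_t`, the group
`Ham` and the length below are the same with and without that requirement. -/
def GeneratesPath (Ω : SymplecticForm E M) (F : ℝ → M → ℝ) (f : ℝ → Equiv.Perm M) : Prop :=
  ContMDiff (𝓘(ℝ, ℝ).prod 𝓘(ℝ, E)) 𝓘(ℝ, ℝ) ∞ (fun q : ℝ × M => F q.1 q.2) ∧
    ∀ (t : ℝ) (x : M), IsSgradAt Ω (F t) (f t x) (velocity E f t x)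

/-- `φ` is a Hamiltonian diffeomorphism: the time-one map of the flow of some smooth time-dependent
Hamiltonian. -/
def IsHamDiffeo (Ω : SymplecticForm E M) (φ : Equiv.Perm M) : Prop :=
  ∃ (f : ℝ → Equiv.Perm M) (F : ℝ → M → ℝ), SmoothFamily E f ∧ (∀ t, IsDiffeo E (f t)) ∧
    f 0 = 1 ∧ f 1 = φ ∧ GeneratesPath Ω F f

/-! ### The Hamiltonian diffeomorphisms form a group -/

theorem IsHamDiffeo.isDiffeo {Ω : SymplecticForm E M} {φ : Equiv.Perm M} (h : IsHamDiffeo Ω φ) :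
    IsDiffeo E φ := by
  obtain ⟨f, F, -, hd, -, rfl, -⟩ := h
  exact hd 1

theorem IsDiffeo.one : IsDiffeo E (1 : Equiv.Perm M) := ⟨contMDiff_id, contMDiff_id⟩

theorem IsDiffeo.mul {φ ψ : Equiv.Perm M} (hφ : IsDiffeo E φ) (hψ : IsDiffeo E ψ) :
    IsDiffeo E (φ * ψ) :=
  ⟨hφ.1.comp hψ.1, hψ.2.comp hφ.2⟩

theorem IsDiffeo.inv {φ : Equiv.Perm M} (hφ : IsDiffeo E φ) : IsDiffeo E φ⁻¹ := ⟨hφ.2, hφ.1⟩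

section Families

variable {P : Type*} [NormedAddCommGroup P] [NormedSpace ℝ P]
  {Q : Type*} [NormedAddCommGroup Q] [NormedSpace ℝ Q]

theorem SmoothFamily.const {φ : Equiv.Perm M} (hφ : IsDiffeo E φ) :
    SmoothFamily E (fun _ : P => φ) :=
  hφ.1.comp contMDiff_snd

theorem SmoothFamily.mul {f g : P → Equiv.Perm M} (hf : SmoothFamily E f) (hg : SmoothFamily E g) :
    SmoothFamily E (f * g) :=
  ContMDiff.comp (I' := 𝓘(ℝ, P).prod 𝓘(ℝ, E)) hf (contMDiff_fst.prodMk hg)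

theorem SmoothFamily.reparam {f : P → Equiv.Perm M} (hf : SmoothFamily E f) {b : Q → P}
    (hb : ContDiff ℝ ∞ b) : SmoothFamily E (fun q => f (b q)) :=
  ContMDiff.comp (I' := 𝓘(ℝ, P).prod 𝓘(ℝ, E)) hf
    ((hb.contMDiff.comp contMDiff_fst).prodMk contMDiff_snd)

end Families

theorem GeneratesPath.mul_right {Ω : SymplecticForm E M} {F : ℝ → M → ℝ} {f : ℝ → Equiv.Perm M}
    (h : GeneratesPath Ω F f) (φ : Equiv.Perm M) : GeneratesPath Ω F (fun t => f t * φ) :=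
  ⟨h.1, fun t x => h.2 t (φ x)⟩

theorem GeneratesPath.reparam {Ω : SymplecticForm E M} {F : ℝ → M → ℝ} {f : ℝ → Equiv.Perm M}
    (h : GeneratesPath Ω F f) (hf : SmoothFamily E f) {b : ℝ → ℝ} (hb : ContDiff ℝ ∞ b) :
    GeneratesPath Ω (fun t x => deriv b t * F (b t) x) (fun t => f (b t)) := by
  refine ⟨?_, fun t x v => ?_⟩
  · have hb' : ContDiff ℝ ∞ (deriv b) := ((contDiff_infty_iff_deriv (𝕜 := ℝ)).1 hb).2
    have h1 : ContMDiff (𝓘(ℝ, ℝ).prod 𝓘(ℝ, E)) 𝓘(ℝ, ℝ) ∞ (fun q : ℝ × M => deriv b q.1) :=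
      hb'.contMDiff.comp contMDiff_fst
    have h2 : ContMDiff (𝓘(ℝ, ℝ).prod 𝓘(ℝ, E)) 𝓘(ℝ, ℝ) ∞ (fun q : ℝ × M => F (b q.1) q.2) :=
      ContMDiff.comp (I' := 𝓘(ℝ, ℝ).prod 𝓘(ℝ, E)) h.1
        ((hb.contMDiff.comp contMDiff_fst).prodMk contMDiff_snd)
    exact h1.mul h2
  · have hvel : velocity E (fun t => f (b t)) t x = deriv b t • velocity E f (b t) x := by
      have hfx : MDifferentiableAt 𝓘(ℝ, ℝ) 𝓘(ℝ, E) (fun s => f s x) (b t) :=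
        (ContMDiff.comp (I' := 𝓘(ℝ, ℝ).prod 𝓘(ℝ, E)) hf
          (contMDiff_id.prodMk contMDiff_const)).mdifferentiableAt (by simp)
      have hbt : DifferentiableAt ℝ b t := hb.differentiable (by simp) t
      have hc := mfderiv_comp (I := 𝓘(ℝ, ℝ)) (I' := 𝓘(ℝ, ℝ)) (I'' := 𝓘(ℝ, E)) t hfx
        hbt.mdifferentiableAt
      have h1 : velocity E (fun t => f (b t)) t x =
          (mfderiv 𝓘(ℝ, ℝ) 𝓘(ℝ, E) (fun s => f s x) (b t))
            (mfderiv 𝓘(ℝ, ℝ) 𝓘(ℝ, ℝ) b t (1 : ℝ)) := congrArg (fun L => L (1 : ℝ)) hc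
      rw [h1, mfderiv_eq_fderiv]
      have h2 : fderiv ℝ b t (1 : ℝ) = deriv b t • (1 : ℝ) := by simp
      exact (congrArg _ h2).trans (map_smul (mfderiv 𝓘(ℝ, ℝ) 𝓘(ℝ, E) (fun s => f s x) (b t)) _ _)
    have hF : mfderiv 𝓘(ℝ, E) 𝓘(ℝ, ℝ) (fun x => deriv b t * F (b t) x) (f (b t) x) =
        deriv b t • mfderiv 𝓘(ℝ, E) 𝓘(ℝ, ℝ) (F (b t)) (f (b t) x) := by
      have hFd : MDifferentiableAt 𝓘(ℝ, E) 𝓘(ℝ, ℝ) (F (b t)) (f (b t) x) :=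
        (ContMDiff.comp (I' := 𝓘(ℝ, ℝ).prod 𝓘(ℝ, E)) h.1
          (contMDiff_const.prodMk contMDiff_id)).mdifferentiableAt (by simp)
      exact const_smul_mfderiv hFd (deriv b t)
    have key := h.2 (b t) x v
    rw [hvel]
    have hlin : Ω.form (f (b t) x) ![deriv b t • velocity E f (b t) x, v] =
        deriv b t * Ω.form (f (b t) x) ![velocity E f (b t) x, v] := by
      have hu : ∀ w : TangentSpace 𝓘(ℝ, E) (f (b t) x),
          Function.update ![velocity E f (b t) x, v] 0 w = ![w, v] := by
        intro w
        funext i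
        fin_cases i <;> simp
      have := (Ω.form (f (b t) x)).toMultilinearMap.map_update_smul ![velocity E f (b t) x, v] 0
        (deriv b t) (velocity E f (b t) x)
      rw [hu, hu] at this
      exact this
    refine hlin.trans ?_
    rw [key, hF]
    exact mul_neg _ _

theorem IsSgradAt.congr {Ω : SymplecticForm E M} {F : M → ℝ} {x y : M} {ξ : TangentSpace 𝓘(ℝ, E) x}
    {ζ : TangentSpace 𝓘(ℝ, E) y} (h : IsSgradAt Ω F x ξ) (hxy : x = y)
    (hv : (show E from ξ) = (show E from ζ)) : IsSgradAt Ω F y ζ := by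
  subst hxy
  have : ξ = ζ := hv
  rwa [← this]

theorem velocity_congr {f g : ℝ → Equiv.Perm M} {t : ℝ} (hfg : f =ᶠ[𝓝 t] g) (x : M) :
    (show E from velocity E f t x) = (show E from velocity E g t x) := by
  have hev : (fun s => f s x) =ᶠ[𝓝 t] fun s => g s x := hfg.fun_comp (fun φ => φ x)
  exact congrArg (fun L : ℝ →L[ℝ] E => L (1 : ℝ)) hev.mfderiv_eq

theorem IsHamDiffeo.one (Ω : SymplecticForm E M) : IsHamDiffeo Ω 1 := by
  refine ⟨fun _ => 1, fun _ _ => 0, SmoothFamily.const IsDiffeo.one, fun _ => IsDiffeo.one, rfl, rfl,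
    contMDiff_const, fun t x v => ?_⟩
  have h1 : velocity E (fun _ : ℝ => (1 : Equiv.Perm M)) t x = 0 := by
    have : mfderiv 𝓘(ℝ, ℝ) 𝓘(ℝ, E) (fun _ : ℝ => x) t = 0 := mfderiv_const
    exact congrArg (fun L : ℝ →L[ℝ] E => L (1 : ℝ)) this
  have h2 : mfderiv 𝓘(ℝ, E) 𝓘(ℝ, ℝ) (fun _ : M => (0 : ℝ)) x = 0 := mfderiv_const
  rw [h1]
  refine ((Ω.form x).toMultilinearMap.map_coord_zero (m := ![0, v]) 0 rfl).trans ?_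
  have h3 : mfderiv 𝓘(ℝ, E) 𝓘(ℝ, ℝ) (fun _ : M => (0 : ℝ)) x v = 0 :=
    congrArg (fun L : E →L[ℝ] ℝ => L v) h2
  exact (neg_eq_zero.2 h3).symm

theorem IsHamDiffeo.inv {Ω : SymplecticForm E M} {φ : Equiv.Perm M} (h : IsHamDiffeo Ω φ) :
    IsHamDiffeo Ω φ⁻¹ := by
  obtain ⟨f, F, hf, hd, h0, rfl, hF⟩ := h
  have hb : ContDiff ℝ ∞ (fun t : ℝ => 1 - t) := contDiff_const.sub contDiff_id
  refine ⟨fun t => f (1 - t) * (f 1)⁻¹, _, (hf.reparam hb).mul (.const (hd 1).inv),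
    fun t => (hd _).mul (hd 1).inv, by simp, by simp [h0], (hF.reparam hf hb).mul_right _⟩

theorem IsHamDiffeo.mul {Ω : SymplecticForm E M} {φ ψ : Equiv.Perm M} (hφ : IsHamDiffeo Ω φ)
    (hψ : IsHamDiffeo Ω ψ) : IsHamDiffeo Ω (φ * ψ) := by
  obtain ⟨f, F, hf, hfd, hf0, rfl, hF⟩ := hφ
  obtain ⟨g, G, hg, hgd, hg0, rfl, hG⟩ := hψ
  -- first run `g` during `[0, 1/3]`, then `f` during `[2/3, 1]`
  set b : ℝ → ℝ := fun t => Real.smoothTransition (3 * t) with hb_def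
  set c : ℝ → ℝ := fun t => Real.smoothTransition (3 * t - 2) with hc_def
  have hb : ContDiff ℝ ∞ b := Real.smoothTransition.contDiff.comp (contDiff_const.mul contDiff_id)
  have hc : ContDiff ℝ ∞ c := Real.smoothTransition.contDiff.comp
    ((contDiff_const.mul contDiff_id).sub contDiff_const)
  have hb1 : ∀ t : ℝ, 1 / 3 < t → b =ᶠ[𝓝 t] fun _ => 1 := fun t ht => by
    filter_upwards [lt_mem_nhds ht] with s hs
    exact Real.smoothTransition.one_of_one_le (by linarith)
  have hc0 : ∀ t : ℝ, t < 2 / 3 → c =ᶠ[𝓝 t] fun _ => 0 := fun t ht => by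
    filter_upwards [gt_mem_nhds ht] with s hs
    exact Real.smoothTransition.zero_of_nonpos (by linarith)
  have hG' := hG.reparam hg hb
  have hF' := (hF.reparam hf hc).mul_right (g 1)
  refine ⟨fun t => f (c t) * g (b t), fun t x => deriv c t * F (c t) x + deriv b t * G (b t) x,
    (hf.reparam hc).mul (hg.reparam hb), fun t => (hfd _).mul (hgd _), ?_, ?_,
    hF'.1.add hG'.1, fun t x => ?_⟩
  · simp [hb_def, hc_def, hf0, hg0, Real.smoothTransition.zero_of_nonpos]
  · have h1 : b 1 = 1 := (hb1 1 (by norm_num)).self_of_nhds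
    have h2 : c 1 = 1 := by
      simp only [hc_def]
      exact Real.smoothTransition.one_of_one_le (by norm_num)
    simp [h1, h2]
  · rcases lt_or_ge t (2 / 3) with ht | ht
    · have hev : (fun t => g (b t)) =ᶠ[𝓝 t] fun t => f (c t) * g (b t) := by
        filter_upwards [hc0 t ht] with s hs
        simp [hs, hf0]
      have hd : deriv c t = 0 := by rw [(hc0 t ht).deriv_eq]; simp
      have := (hG'.2 t x).congr (congrArg (fun φ : Equiv.Perm M => φ x) hev.self_of_nhds)
        (velocity_congr hev x)
      simpa [hd] using this
    · have ht' : 1 / 3 < t := by linarith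
      have hev : (fun t => f (c t) * g 1) =ᶠ[𝓝 t] fun t => f (c t) * g (b t) := by
        filter_upwards [hb1 t ht'] with s hs
        simp [hs]
      have hd : deriv b t = 0 := by rw [(hb1 t ht').deriv_eq]; simp
      have := (hF'.2 t x).congr (congrArg (fun φ : Equiv.Perm M => φ x) hev.self_of_nhds)
        (velocity_congr hev x)
      simpa [hd] using this

/-- The group `Ham (M, Ω)` of Hamiltonian diffeomorphisms. -/
def Ham (Ω : SymplecticForm E M) : Subgroup (Equiv.Perm M) where
  carrier := {φ | IsHamDiffeo Ω φ}
  mul_mem' := IsHamDiffeo.mul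
  one_mem' := IsHamDiffeo.one Ω
  inv_mem' := IsHamDiffeo.inv

/-! ### The inverse of a smooth family is smooth -/

/-- A smooth family of diffeomorphisms has a smooth family of inverses
(inverse function theorem). -/
theorem SmoothFamily.inv [CompleteSpace E] [IsManifold 𝓘(ℝ, E) ∞ M]
    {P : Type*} [NormedAddCommGroup P] [NormedSpace ℝ P] [CompleteSpace P]
    {f : P → Equiv.Perm M} (hf : SmoothFamily E f) (hd : ∀ p, IsDiffeo E (f p)) :
    SmoothFamily E f⁻¹ := by
  rintro ⟨p₀, y₀⟩
  -- normalise the family to be the identity at `p₀`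
  set g : P → Equiv.Perm M := fun p => (f p₀)⁻¹ * f p with hg_def
  have hg : SmoothFamily E g := (SmoothFamily.const (hd p₀).inv).mul hf
  have hg0 : g p₀ = 1 := by simp [hg_def]
  set x₀ : M := (f p₀)⁻¹ y₀ with hx₀
  suffices hs : ContMDiffAt (𝓘(ℝ, P).prod 𝓘(ℝ, E)) 𝓘(ℝ, E) ∞
      (fun q : P × M => (g q.1)⁻¹ q.2) (p₀, x₀) by
    have h1 : ContMDiff (𝓘(ℝ, P).prod 𝓘(ℝ, E)) (𝓘(ℝ, P).prod 𝓘(ℝ, E)) ∞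
        (fun q : P × M => (q.1, (f p₀)⁻¹ q.2)) :=
      contMDiff_fst.prodMk ((hd p₀).inv.1.comp contMDiff_snd)
    have h2 := ContMDiffAt.comp (I' := 𝓘(ℝ, P).prod 𝓘(ℝ, E)) (p₀, y₀) hs h1.contMDiffAt
    convert h2 using 1
    funext q
    simp [hg_def]
  set c := extChartAt 𝓘(ℝ, E) x₀ with hc
  have hx₀s : x₀ ∈ c.source := mem_extChartAt_source x₀
  have htn : c.target ∈ 𝓝 (c x₀) := extChartAt_target_mem_nhds x₀
  have hc1 : ContMDiffAt 𝓘(ℝ, E) 𝓘(ℝ, E) ∞ c x₀ := contMDiffAt_extChartAt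
  have hc2 : ContMDiffAt 𝓘(ℝ, E) 𝓘(ℝ, E) ∞ c.symm (c x₀) :=
    (contMDiffOn_extChartAt_symm x₀).contMDiffAt htn
  have hcx : c.symm (c x₀) = x₀ := c.left_inv hx₀s
  set u : P × E → M := fun q => g q.1 (c.symm q.2) with hu_def
  have hux : u (p₀, c x₀) = x₀ := by simp [hu_def, hg0, hcx]
  have hu : ContMDiffAt 𝓘(ℝ, P × E) 𝓘(ℝ, E) ∞ u (p₀, c x₀) := by
    have h1 : ContMDiffAt 𝓘(ℝ, P × E) 𝓘(ℝ, P) ∞ (Prod.fst : P × E → P) (p₀, c x₀) :=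
      contDiff_fst.contMDiff.contMDiffAt
    have h2 : ContMDiffAt 𝓘(ℝ, P × E) 𝓘(ℝ, E) ∞ (Prod.snd : P × E → E) (p₀, c x₀) :=
      contDiff_snd.contMDiff.contMDiffAt
    have h3 : ContMDiffAt 𝓘(ℝ, P × E) 𝓘(ℝ, E) ∞ (fun q : P × E => c.symm q.2) (p₀, c x₀) :=
      ContMDiffAt.comp (I' := 𝓘(ℝ, E)) (p₀, c x₀) hc2 h2
    exact ContMDiffAt.comp (I' := 𝓘(ℝ, P).prod 𝓘(ℝ, E)) (g := fun q : P × M => g q.1 q.2)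
      (f := fun q : P × E => (q.1, c.symm q.2)) (p₀, c x₀) hg.contMDiffAt (h1.prodMk h3)
  set G₂ : P × E → E := fun q => c (u q) with hG₂
  have hG₂s : ContDiffAt ℝ ∞ G₂ (p₀, c x₀) := by
    apply ContMDiffAt.contDiffAt
    refine ContMDiffAt.comp (I' := 𝓘(ℝ, E)) (p₀, c x₀) ?_ hu
    rw [hux]
    exact hc1
  set G : P × E → P × E := fun q => (q.1, G₂ q) with hG
  have hGs : ContDiffAt ℝ ∞ G (p₀, c x₀) := contDiffAt_fst.prodMk hG₂s
  have hGx : G (p₀, c x₀) = (p₀, c x₀) := by simp [hG, hG₂, hux]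
  set A : P × E →L[ℝ] E := fderiv ℝ G₂ (p₀, c x₀) with hA
  have hG₂d : HasFDerivAt G₂ A (p₀, c x₀) := (hG₂s.differentiableAt (by simp)).hasFDerivAt
  have hAr : ∀ w : E, A (0, w) = w := by
    have h1 : HasFDerivAt (fun v : E => G₂ (p₀, v)) (A.comp (ContinuousLinearMap.inr ℝ P E))
        (c x₀) := hG₂d.comp (c x₀) (hasFDerivAt_prodMk_right p₀ (c x₀))
    have h2 : (fun v : E => G₂ (p₀, v)) =ᶠ[𝓝 (c x₀)] id := by
      filter_upwards [htn] with v hv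
      simp [hG₂, hu_def, hg0, c.right_inv hv]
    have h3 := (h1.congr_of_eventuallyEq h2.symm).unique (hasFDerivAt_id (c x₀))
    intro w
    have := congrArg (fun L : E →L[ℝ] E => L w) h3
    simpa using this
  have hAdd : ∀ (a : P) (w : E), A (a, w) = A (a, 0) + w := fun a w => by
    conv_rhs => rw [← hAr w]
    rw [← map_add]
    simp
  let e : (P × E) ≃L[ℝ] (P × E) := ContinuousLinearEquiv.equivOfInverse
    ((ContinuousLinearMap.fst ℝ P E).prod A)
    ((ContinuousLinearMap.fst ℝ P E).prod (ContinuousLinearMap.snd ℝ P E -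
      A.comp ((ContinuousLinearMap.inl ℝ P E).comp (ContinuousLinearMap.fst ℝ P E))))
    (fun q => by
      rcases q with ⟨a, w⟩
      simp [hAdd a w])
    (fun q => by
      rcases q with ⟨a, w⟩
      simp [hAdd a (w - A (a, 0))])
  have hGd : HasFDerivAt G (e : P × E →L[ℝ] P × E) (p₀, c x₀) := hasFDerivAt_fst.prodMk hG₂d
  set L := hGs.localInverse hGd (by simp) with hL
  have hLs : ContDiffAt ℝ ∞ L (p₀, c x₀) := by
    have := hGs.to_localInverse hGd (by simp)
    rwa [hGx] at this
  have hLx : L (p₀, c x₀) = (p₀, c x₀) := by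
    have := hGs.localInverse_apply_image hGd (by simp)
    rwa [hGx] at this
  have hLr : ∀ᶠ q in 𝓝 (p₀, c x₀), G (L q) = q := by
    have := (hGs.hasStrictFDerivAt' hGd (by simp)).eventually_right_inverse
    rwa [hGx] at this
  -- the candidate for the inverse family
  have hV : ContMDiffAt (𝓘(ℝ, P).prod 𝓘(ℝ, E)) 𝓘(ℝ, P × E) ∞
      (fun q : P × M => (q.1, c q.2)) (p₀, x₀) := by
    have h2 : ContMDiffAt (𝓘(ℝ, P).prod 𝓘(ℝ, E)) 𝓘(ℝ, E) ∞ (fun q : P × M => c q.2) (p₀, x₀) :=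
      ContMDiffAt.comp (I' := 𝓘(ℝ, E)) (p₀, x₀) hc1 contMDiffAt_snd
    exact contMDiffAt_fst.prodMk_space h2
  have hLV : ContMDiffAt (𝓘(ℝ, P).prod 𝓘(ℝ, E)) 𝓘(ℝ, P × E) ∞
      (fun q : P × M => L (q.1, c q.2)) (p₀, x₀) :=
    ContMDiffAt.comp (I' := 𝓘(ℝ, P × E)) (p₀, x₀) hLs.contMDiffAt hV
  have hcand : ContMDiffAt (𝓘(ℝ, P).prod 𝓘(ℝ, E)) 𝓘(ℝ, E) ∞
      (fun q : P × M => c.symm (L (q.1, c q.2)).2) (p₀, x₀) := by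
    have h1 : ContMDiffAt (𝓘(ℝ, P).prod 𝓘(ℝ, E)) 𝓘(ℝ, E) ∞
        (fun q : P × M => (L (q.1, c q.2)).2) (p₀, x₀) :=
      ContMDiffAt.comp (I' := 𝓘(ℝ, P × E)) (p₀, x₀) contDiff_snd.contMDiff.contMDiffAt hLV
    refine ContMDiffAt.comp (I' := 𝓘(ℝ, E)) (p₀, x₀) ?_ h1
    simpa [hLx] using hc2
  refine hcand.congr_of_eventuallyEq ?_
  have hsrc : ∀ᶠ q : P × M in 𝓝 (p₀, x₀), q.2 ∈ c.source :=
    continuousAt_snd.eventually (extChartAt_source_mem_nhds x₀)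
  have hLr' : ∀ᶠ q : P × M in 𝓝 (p₀, x₀), G (L (q.1, c q.2)) = (q.1, c q.2) :=
    hV.continuousAt.eventually hLr
  have husrc : ∀ᶠ q : P × M in 𝓝 (p₀, x₀), u (L (q.1, c q.2)) ∈ c.source := by
    have h1 : ∀ᶠ r in 𝓝 (L (p₀, c x₀)), u r ∈ c.source := by
      rw [hLx]
      apply hu.continuousAt.eventually
      rw [hux]
      exact extChartAt_source_mem_nhds x₀
    exact hLV.continuousAt.eventually h1
  filter_upwards [hsrc, hLr', husrc] with q h1 h2 h3
  have h4 : (L (q.1, c q.2)).1 = q.1 := congrArg Prod.fst h2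
  have h5 : c (u (L (q.1, c q.2))) = c q.2 := congrArg Prod.snd h2
  have h6 : u (L (q.1, c q.2)) = q.2 := c.injOn h3 h1 h5
  rw [Equiv.Perm.inv_eq_iff_eq]
  refine h6.symm.trans ?_
  simp only [hu_def, h4]

/-! ### Smooth loops of Hamiltonian diffeomorphisms

Here `S¹ = ℝ / ℤ`, and a loop is given by a `1`-periodic map on `ℝ`. -/

section Loops

variable [CompleteSpace E] [IsManifold 𝓘(ℝ, E) ∞ M]

/-- The group (under pointwise composition) of smooth free loops in `Ham (M, Ω)`: smooth
`1`-periodic paths of diffeomorphisms with values in `Ham (M, Ω)`. -/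
def HamLoop (Ω : SymplecticForm E M) : Subgroup (ℝ → Equiv.Perm M) where
  carrier := {h | SmoothFamily E h ∧ Function.Periodic h 1 ∧ ∀ t, h t ∈ Ham Ω}
  mul_mem' := fun ha hb => ⟨ha.1.mul hb.1, ha.2.1.mul hb.2.1,
    fun t => (Ham Ω).mul_mem (ha.2.2 t) (hb.2.2 t)⟩
  one_mem' := ⟨SmoothFamily.const IsDiffeo.one, fun _ => rfl, fun _ => (Ham Ω).one_mem⟩
  inv_mem' := fun ha => ⟨ha.1.inv fun t => (ha.2.2 t).isDiffeo,
    fun t => congrArg (·⁻¹) (ha.2.1 t), fun t => (Ham Ω).inv_mem (ha.2.2 t)⟩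

/-- The group of smooth loops in `Ham (M, Ω)` based at the identity. -/
def BasedHamLoop (Ω : SymplecticForm E M) : Subgroup (ℝ → Equiv.Perm M) where
  carrier := {h | h ∈ HamLoop Ω ∧ h 0 = 1}
  mul_mem' := fun ha hb => ⟨mul_mem ha.1 hb.1, by simp [ha.2, hb.2]⟩
  one_mem' := ⟨one_mem _, rfl⟩
  inv_mem' := fun ha => ⟨inv_mem ha.1, by simp [ha.2]⟩

/-- `K` is a smooth homotopy `K (s, ·)`, from `s = 0` to `s = 1`, through free loops in
`Ham (M, Ω)`. (A smooth homotopy with parameter `s ∈ [0, 1]` can be made defined for all `s ∈ ℝ`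
by reparametrizing `s` with a smooth step function.) -/
structure IsLoopHomotopy (Ω : SymplecticForm E M) (K : ℝ × ℝ → Equiv.Perm M)
    (g₀ g₁ : ℝ → Equiv.Perm M) : Prop where
  smooth : SmoothFamily E K
  mem_ham : ∀ p, K p ∈ Ham Ω
  periodic : ∀ s t, K (s, t + 1) = K (s, t)
  left : ∀ t, K (0, t) = g₀ t
  right : ∀ t, K (1, t) = g₁ t

/-- Smooth homotopy of free loops in `Ham (M, Ω)`. -/
def FreelyHomotopic (Ω : SymplecticForm E M) (g₀ g₁ : ℝ → Equiv.Perm M) : Prop :=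
  ∃ K, IsLoopHomotopy Ω K g₀ g₁

/-- Smooth homotopy of based loops in `Ham (M, Ω)`, through loops based at the identity. -/
def BasedHomotopic (Ω : SymplecticForm E M) (g₀ g₁ : ℝ → Equiv.Perm M) : Prop :=
  ∃ K, IsLoopHomotopy Ω K g₀ g₁ ∧ ∀ s, K (s, 0) = 1

/-- Smooth based homotopy is a congruence on the group of based loops. -/
def basedHomotopyCon (Ω : SymplecticForm E M) : Con (BasedHamLoop Ω) where
  r g₀ g₁ := BasedHomotopic Ω g₀ g₁
  iseqv := by
    refine ⟨fun g => ?_, fun {g₀ g₁} h => ?_, fun {g₀ g₁ g₂} h h' => ?_⟩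
    · exact ⟨fun p => g.1 p.2, ⟨g.2.1.1.reparam contDiff_snd, fun p => g.2.1.2.2 p.2,
        fun s t => g.2.1.2.1 t, fun _ => rfl, fun _ => rfl⟩, fun _ => g.2.2⟩
    · obtain ⟨K, hK, hb⟩ := h
      refine ⟨fun p => K (1 - p.1, p.2), ⟨hK.smooth.reparam
        ((contDiff_const.sub contDiff_fst).prodMk contDiff_snd), fun p => hK.mem_ham _,
        fun s t => hK.periodic _ t, fun t => ?_, fun t => ?_⟩, fun s => hb _⟩
      · simpa using hK.right t
      · simpa using hK.left t
    · obtain ⟨K, hK, hb⟩ := h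
      obtain ⟨K', hK', hb'⟩ := h'
      have hi : SmoothFamily E (fun p : ℝ × ℝ => (g₁.1 p.2)⁻¹) :=
        (g₁⁻¹).2.1.1.reparam contDiff_snd
      refine ⟨K * (fun p => (g₁.1 p.2)⁻¹) * K', ⟨(hK.smooth.mul hi).mul hK'.smooth,
        fun p => mul_mem (mul_mem (hK.mem_ham p) (inv_mem (g₁.2.1.2.2 p.2))) (hK'.mem_ham p),
        fun s t => ?_, fun t => ?_, fun t => ?_⟩, fun s => ?_⟩
      · simp [hK.periodic, hK'.periodic, g₁.2.1.2.1 t]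
      · simp [hK.left, hK'.left]
      · simp [hK.right, hK'.right]
      · simp [hb, hb', g₁.2.2]
  mul' := by
    rintro a b c d ⟨K, hK, hb⟩ ⟨K', hK', hb'⟩
    refine ⟨K * K', ⟨hK.smooth.mul hK'.smooth, fun p => mul_mem (hK.mem_ham p) (hK'.mem_ham p),
      fun s t => ?_, fun t => ?_, fun t => ?_⟩, fun s => ?_⟩
    · simp [hK.periodic, hK'.periodic]
    · simp [hK.left, hK'.left]
    · simp [hK.right, hK'.right]
    · simp [hb, hb']

/-- The fundamental group `π₁ (Ham (M, Ω))`: smooth loops based at the identity up to smooth based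
homotopy. The group operation is induced by the pointwise composition of loops, which in the
fundamental group of a group coincides with concatenation. The group is abelian; it is written
multiplicatively here, so `γ ^ k` is the class `k γ`. -/
abbrev PiOneHam (Ω : SymplecticForm E M) : Type _ := (basedHomotopyCon Ω).Quotient

/-- The class in `π₁ (Ham (M, Ω))` of a based loop. -/
def PiOneHam.mk {Ω : SymplecticForm E M} (g : BasedHamLoop Ω) : PiOneHam Ω :=
  (g : (basedHomotopyCon Ω).Quotient)

/-- The free loop `h` represents the class `γ`: it is freely homotopic to a based loop
of class `γ`. -/
def Represents {Ω : SymplecticForm E M} (h : HamLoop Ω) (γ : PiOneHam Ω) : Prop :=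
  ∃ g : BasedHamLoop Ω, PiOneHam.mk g = γ ∧ FreelyHomotopic Ω h g

/-! ### Hofer length and Hofer norm -/

/-- The Hofer length `∫₀¹ (max F_t - min F_t) dt` of the path generated by the Hamiltonian `F`
on a closed manifold. -/
def hoferLength (F : ℝ → M → ℝ) : ℝ :=
  ∫ t in (0 : ℝ)..1, ((⨆ x, F t x) - ⨅ x, F t x)

/-- The Hofer norm `ν (γ)`: the infimum of the lengths of the loops representing `γ`. -/
def hoferNorm {Ω : SymplecticForm E M} (γ : PiOneHam Ω) : ℝ :=
  sInf {l : ℝ | ∃ (g : BasedHamLoop Ω) (F : ℝ → M → ℝ),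
    PiOneHam.mk g = γ ∧ GeneratesPath Ω F g ∧ l = hoferLength F}

/-! ### Strict ergodicity -/

/-- A self-map `T` of a topological space is strictly ergodic if it has exactly one invariant Borel
probability measure, and this measure is positive on nonempty open sets. -/
def StrictlyErgodic {X : Type*} [TopologicalSpace X] (T : X → X) : Prop :=
  letI : MeasurableSpace X := borel X
  ∃ m : Measure X, (IsProbabilityMeasure m ∧ MeasurePreserving T m m) ∧
    (∀ U : Set X, IsOpen U → U.Nonempty → 0 < m U) ∧
    ∀ m' : Measure X, IsProbabilityMeasure m' → MeasurePreserving T m' m' → m' = m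

/-- The skew product `T (y, t) = (h(t) y, t + α)` on `M × S¹`. -/
def skewProduct {Ω : SymplecticForm E M} (h : HamLoop Ω) (α : ℝ) :
    M × UnitAddCircle → M × UnitAddCircle :=
  fun q => (h.2.2.1.lift q.2 q.1, q.2 + (α : UnitAddCircle))

/-- A loop is strictly ergodic if its skew product with some irrational rotation of the circle is
strictly ergodic. -/
def IsStrictlyErgodicLoop {Ω : SymplecticForm E M} (h : HamLoop Ω) : Prop :=
  ∃ α : ℝ, Irrational α ∧ StrictlyErgodic (skewProduct h α)

end Loops

end

noncomputable section

/-! The flux forms `θ t = Ω (ḣ t, D (h t) ·)` of a smooth loop `h` in `Ham (M, Ω)` are exact: if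
`θ t = d (B t)`, then `h` is generated by the Hamiltonian `F t = - B t ∘ (h t)⁻¹`. The only input
is that every single `h t` is a Hamiltonian diffeomorphism, and it is used as follows. Join the
identity to `h t` by a Hamiltonian isotopy `f^t`. The space of paths is second countable, while `t`
ranges over an uncountable set, so there are `a ≠ b` arbitrarily close to a given time for which
`f^a` and `f^b` are uniformly close. Then `f^b` followed by `h` from `h b` to `h a` and `f^a`
backwards form a loop of symplectic maps which, after composition with the inverse of `f^b`, stays
close to the identity. The total flux of such a loop is exact, being obtained by integrating local
primitives of `Ω` along its trajectories. Since Hamiltonian isotopies contribute exact forms, the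
mean of `θ` over `[b, a]` is exact, and so is the limit of these means.

Consequently the loop `t ↦ h (t + (k - 1) α) ∘ ⋯ ∘ h t`, which represents `k γ` (let `α` tend to
`0`), is generated, up to composition with its inverse, by minus the Birkhoff sum of length `k` of
`B` over the skew product. By unique ergodicity the Birkhoff averages converge uniformly to a
constant, so the Hofer length of this loop is `o (k)`. -/

/-! ### Pullback of the symplectic form to a vector space -/

section TwoForms

variable {P : Type*} [NormedAddCommGroup P] [NormedSpace ℝ P]

/-- The inclusion of alternating forms of degree two into bilinear forms, `η ↦ η ![·, ·]`. -/
def altToBilin (P : Type*) [NormedAddCommGroup P] [NormedSpace ℝ P] :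
    (P [⋀^Fin 2]→L[ℝ] ℝ) →L[ℝ] P →L[ℝ] P →L[ℝ] ℝ :=
  (ContinuousLinearMap.compL ℝ P (P [⋀^Fin 1]→L[ℝ] ℝ) (P →L[ℝ] ℝ)
    ((ContinuousLinearMap.compL ℝ P (P [⋀^Fin 0]→L[ℝ] ℝ) ℝ
      (ContinuousAlternatingMap.apply ℝ P ℝ ![])).comp
        (ContinuousAlternatingMap.curryLeftLI (n := 0)).toContinuousLinearMap)).comp
    (ContinuousAlternatingMap.curryLeftLI (n := 1)).toContinuousLinearMap

theorem altToBilin_apply (η : P [⋀^Fin 2]→L[ℝ] ℝ) (v w : P) :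
    altToBilin P η v w = η ![v, w] := by
  simp [altToBilin]

theorem altToBilin_swap (η : P [⋀^Fin 2]→L[ℝ] ℝ) (v w : P) :
    altToBilin P η v w = - altToBilin P η w v := by
  have hswap : (![w, v] ∘ Equiv.swap (0 : Fin 2) 1) = ![v, w] := by
    funext i
    fin_cases i <;> simp
  have := η.toAlternatingMap.map_swap ![w, v] (i := 0) (j := 1) (by decide)
  rw [hswap] at this
  rw [altToBilin_apply, altToBilin_apply]
  exact this

theorem fderiv_altToBilin {η : P → P [⋀^Fin 2]→L[ℝ] ℝ} {p : P} (hη : DifferentiableAt ℝ η p)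
    (a v w : P) :
    fderiv ℝ (fun q => altToBilin P (η q)) p a v w = fderiv ℝ (fun q => η q ![v, w]) p a := by
  have hcomp : fderiv ℝ (fun q => altToBilin P (η q)) p = (altToBilin P).comp (fderiv ℝ η p) :=
    (HasFDerivAt.comp (g := fun ξ => altToBilin P ξ) p (by fun_prop) hη.hasFDerivAt).fderiv
  rw [hcomp, ContinuousLinearMap.comp_apply, altToBilin_apply,
    fderiv_continuousAlternatingMap_apply_const_apply hη]

theorem contDiff_altToBilin : ContDiff ℝ ∞ (fun η => altToBilin P η) := by
  fun_prop

theorem extDeriv_two_apply {η : P → P [⋀^Fin 2]→L[ℝ] ℝ} {p : P} (hη : DifferentiableAt ℝ η p)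
    (a v w : P) :
    extDeriv η p ![a, v, w] = fderiv ℝ (fun q => altToBilin P (η q)) p a v w -
      fderiv ℝ (fun q => altToBilin P (η q)) p v a w +
      fderiv ℝ (fun q => altToBilin P (η q)) p w a v := by
  have hremove₀ : (0 : Fin 3).removeNth ![a, v, w] = ![v, w] := by
    funext i; fin_cases i <;> rfl
  have hremove₁ : (1 : Fin 3).removeNth ![a, v, w] = ![a, w] := by
    funext i; fin_cases i <;> rfl
  have hremove₂ : (2 : Fin 3).removeNth ![a, v, w] = ![a, v] := by
    funext i; fin_cases i <;> rfl
  rw [extDeriv_apply hη, Fin.sum_univ_three, hremove₀, hremove₁, hremove₂]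
  simp [fderiv_altToBilin hη, sub_eq_add_neg]

/-- The exterior derivative of a `2`-form, encoded as a field of bilinear maps, vanishes at `p`. -/
def IsClosedTwoFormAt (σ : P → P →L[ℝ] P →L[ℝ] ℝ) (p : P) : Prop :=
  ∀ a v w, fderiv ℝ σ p a v w - fderiv ℝ σ p v a w + fderiv ℝ σ p w a v = 0

theorem fderiv_oneForm_apply {η : P → P →L[ℝ] ℝ} {p : P} (hη : DifferentiableAt ℝ η p) (v a : P) :
    fderiv ℝ (fun q => η q v) p a = fderiv ℝ η p a v := by
  rw [fderiv_clm_apply hη (differentiableAt_const v)]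
  simp

theorem fderiv_twoForm_apply {σ : P → P →L[ℝ] P →L[ℝ] ℝ} {p : P} (hσ : DifferentiableAt ℝ σ p)
    (v w a : P) : fderiv ℝ (fun q => σ q v w) p a = fderiv ℝ σ p a v w := by
  have hσv : DifferentiableAt ℝ (fun q => σ q v) p := hσ.clm_apply (differentiableAt_const v)
  rw [fderiv_oneForm_apply hσv, fderiv_clm_apply hσ (differentiableAt_const v)]
  simp

theorem contDiff_flip {Q : Type*} [NormedAddCommGroup Q] [NormedSpace ℝ Q] :
    ContDiff ℝ ∞ (fun B : P →L[ℝ] Q →L[ℝ] ℝ => B.flip) :=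
  IsBoundedLinearMap.contDiff ⟨⟨fun _ _ => rfl, fun _ _ => rfl⟩, 1, one_pos, fun B => by simp⟩

theorem contDiffAt_bilinearComp {E : Type*} [NormedAddCommGroup E] [NormedSpace ℝ E]
    {B : P → E →L[ℝ] E →L[ℝ] ℝ} {A : P → P →L[ℝ] E} {p : P} (hB : ContDiffAt ℝ ∞ B p)
    (hA : ContDiffAt ℝ ∞ A p) : ContDiffAt ℝ ∞ (fun q => (B q).bilinearComp (A q) (A q)) p :=
  contDiff_flip.contDiffAt.comp p
    ((contDiff_flip.contDiffAt.comp p (hB.clm_comp hA)).clm_comp hA)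

end TwoForms

section Pullback

variable {E : Type*} [NormedAddCommGroup E] [NormedSpace ℝ E]
  {M : Type*} [TopologicalSpace M] [ChartedSpace E M]
  {P : Type*} [NormedAddCommGroup P] [NormedSpace ℝ P]
  {Q : Type*} [NormedAddCommGroup Q] [NormedSpace ℝ Q]

theorem contDiffAt_extChartAt_comp [IsManifold 𝓘(ℝ, E) ∞ M] {u : P → M} {p : P}
    (hu : ContMDiffAt 𝓘(ℝ, P) 𝓘(ℝ, E) ∞ u p) {x₀ : M}
    (hx : u p ∈ (extChartAt 𝓘(ℝ, E) x₀).source) :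
    ContDiffAt ℝ ∞ (fun q => extChartAt 𝓘(ℝ, E) x₀ (u q)) p :=
  (ContMDiffAt.comp (I' := 𝓘(ℝ, E)) p
    (contMDiffAt_extChartAt' (by simpa only [extChartAt_source] using hx)) hu).contDiffAt

namespace SymplecticForm

/-- The symplectic form at a point as a bilinear map on the model space `E`, every tangent space
of `M` being a copy of `E`. -/
def bilin (Ω : SymplecticForm E M) (x : M) : E →L[ℝ] E →L[ℝ] ℝ :=
  altToBilin E (Ω.form x)

/-- The pullback of a symplectic form by a map from a vector space, as an alternating form. -/
def pullForm (Ω : SymplecticForm E M) (u : P → M) (p : P) : P [⋀^Fin 2]→L[ℝ] ℝ :=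
  (Ω.form (u p)).compContinuousLinearMap (mfderiv 𝓘(ℝ, P) 𝓘(ℝ, E) u p)

/-- The pullback of a symplectic form by a map from a vector space, as a bilinear map. -/
def pull (Ω : SymplecticForm E M) (u : P → M) (p : P) : P →L[ℝ] P →L[ℝ] ℝ :=
  altToBilin P (Ω.pullForm u p)

variable (Ω : SymplecticForm E M)

theorem bilin_apply (x : M) (v w : TangentSpace 𝓘(ℝ, E) x) :
    Ω.bilin x v w = Ω.form x ![v, w] :=
  altToBilin_apply (P := E) _ _ _

theorem pull_apply (u : P → M) (p v w : P) :
    Ω.pull u p v w = Ω.bilin (u p) (mfderiv 𝓘(ℝ, P) 𝓘(ℝ, E) u p v)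
      (mfderiv 𝓘(ℝ, P) 𝓘(ℝ, E) u p w) := by
  rw [bilin_apply]
  refine (altToBilin_apply _ _ _).trans (congrArg (Ω.form (u p)) ?_)
  funext i
  fin_cases i <;> rfl

theorem pull_swap (u : P → M) (p v w : P) : Ω.pull u p v w = - Ω.pull u p w v :=
  altToBilin_swap _ _ _

theorem pullForm_comp {u : P → M} {g : Q → P} {q : Q}
    (hu : MDifferentiableAt 𝓘(ℝ, P) 𝓘(ℝ, E) u (g q)) (hg : DifferentiableAt ℝ g q) :
    Ω.pullForm (fun r => u (g r)) q =
      (Ω.pullForm u (g q)).compContinuousLinearMap (fderiv ℝ g q) := by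
  have hchain := mfderiv_comp (I := 𝓘(ℝ, Q)) (I' := 𝓘(ℝ, P)) (I'' := 𝓘(ℝ, E)) q hu
    hg.mdifferentiableAt
  rw [mfderiv_eq_fderiv] at hchain
  ext v
  refine congrArg (Ω.form (u (g q))) (funext fun i => ?_)
  exact congrArg (fun L : Q →L[ℝ] E => L (v i)) hchain

theorem pullForm_congr {u u' : P → M} {p : P} (h : u =ᶠ[𝓝 p] u') :
    Ω.pullForm u p = Ω.pullForm u' p := by
  have hform : ∀ (x y : M) (A B : P →L[ℝ] E), x = y → A = B →
      (show E [⋀^Fin 2]→L[ℝ] ℝ from Ω.form x).compContinuousLinearMap A =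
        (show E [⋀^Fin 2]→L[ℝ] ℝ from Ω.form y).compContinuousLinearMap B := by
    rintro x y A B rfl rfl
    rfl
  exact hform _ _ _ _ h.self_of_nhds h.mfderiv_eq

theorem contDiffAt_chartForm (x₀ : M) {y : E} (hy : y ∈ (extChartAt 𝓘(ℝ, E) x₀).target) :
    ContDiffAt ℝ ∞ (chartForm Ω.form x₀) y :=
  (Ω.smooth x₀ y hy).contDiffAt ((isOpen_extChartAt_target x₀).mem_nhds hy)

variable [IsManifold 𝓘(ℝ, E) ∞ M] {u : P → M} {p : P}

theorem pullForm_eq_chartForm (hu : MDifferentiableAt 𝓘(ℝ, P) 𝓘(ℝ, E) u p) {x₀ : M}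
    (hx : u p ∈ (extChartAt 𝓘(ℝ, E) x₀).source) :
    Ω.pullForm u p = (chartForm Ω.form x₀ (extChartAt 𝓘(ℝ, E) x₀ (u p))).compContinuousLinearMap
      (fderiv ℝ (fun q => extChartAt 𝓘(ℝ, E) x₀ (u q)) p) := by
  set c := extChartAt 𝓘(ℝ, E) x₀
  have hcu : MDifferentiableAt 𝓘(ℝ, P) 𝓘(ℝ, E) (fun q => c (u q)) p :=
    MDifferentiableAt.comp (I' := 𝓘(ℝ, E)) p (mdifferentiableAt_extChartAt
      (by simpa only [c, extChartAt_source] using hx)) hu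
  have hleft : (fun q => c.symm (c (u q))) =ᶠ[𝓝 p] u := by
    filter_upwards [hu.continuousAt.eventually (extChartAt_source_mem_nhds' hx)] with q hq
    exact c.left_inv hq
  have hsymm : MDifferentiableAt 𝓘(ℝ, E) 𝓘(ℝ, E) c.symm (c (u p)) :=
    ((contMDiffOn_extChartAt_symm (n := ∞) x₀).contMDiffAt
      ((isOpen_extChartAt_target x₀).mem_nhds (c.map_source hx))).mdifferentiableAt (by simp)
  exact (Ω.pullForm_congr hleft).symm.trans (Ω.pullForm_comp hsymm hcu.differentiableAt)

theorem pullForm_eventuallyEq_chartForm (hu : ContMDiffAt 𝓘(ℝ, P) 𝓘(ℝ, E) ∞ u p) :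
    Ω.pullForm u =ᶠ[𝓝 p] fun q =>
      (chartForm Ω.form (u p) (extChartAt 𝓘(ℝ, E) (u p) (u q))).compContinuousLinearMap
        (fderiv ℝ (fun q => extChartAt 𝓘(ℝ, E) (u p) (u q)) q) := by
  have : IsManifold 𝓘(ℝ, E) 1 M := .of_le (n := ∞) (mod_cast le_top)
  filter_upwards [(contMDiffAt_iff_contMDiffAt_nhds (n := 1) (by simp)).1
      (hu.of_le (mod_cast le_top)),
    hu.continuousAt.eventually (extChartAt_source_mem_nhds (I := 𝓘(ℝ, E)) (u p))] with q hq hqs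
  exact Ω.pullForm_eq_chartForm (hq.mdifferentiableAt (by simp)) hqs

theorem contDiffAt_pull (hu : ContMDiffAt 𝓘(ℝ, P) 𝓘(ℝ, E) ∞ u p) :
    ContDiffAt ℝ ∞ (Ω.pull u) p := by
  set c := extChartAt 𝓘(ℝ, E) (u p)
  have hcu : ContDiffAt ℝ ∞ (fun q => c (u q)) p :=
    contDiffAt_extChartAt_comp hu (mem_extChartAt_source (u p))
  have hdcu : ContDiffAt ℝ ∞ (fderiv ℝ fun q => c (u q)) p := hcu.fderiv_right (by simp)
  have hbilin : ContDiffAt ℝ ∞ (fun q => altToBilin E (chartForm Ω.form (u p) (c (u q)))) p :=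
    ContDiffAt.comp (g := fun η => altToBilin E η) p contDiff_altToBilin.contDiffAt
      (ContDiffAt.comp (g := chartForm Ω.form (u p)) p
        (Ω.contDiffAt_chartForm (u p) (c.map_source (mem_extChartAt_source (u p)))) hcu)
  refine (contDiffAt_bilinearComp hbilin hdcu).congr_of_eventuallyEq ?_
  filter_upwards [Ω.pullForm_eventuallyEq_chartForm hu] with q hq
  ext v w
  rw [pull, hq, ContinuousLinearMap.bilinearComp_apply, altToBilin_apply, altToBilin_apply]
  refine congrArg (chartForm Ω.form (u p) (c (u q))) (funext fun i => ?_)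
  fin_cases i <;> rfl

theorem contDiffOn_pull {O : Set P} (hO : IsOpen O)
    (hu : ContMDiffOn 𝓘(ℝ, P) 𝓘(ℝ, E) ∞ u O) : ContDiffOn ℝ ∞ (Ω.pull u) O :=
  fun _ hp => (Ω.contDiffAt_pull ((hu _ hp).contMDiffAt (hO.mem_nhds hp))).contDiffWithinAt

theorem differentiableAt_pullForm (hu : ContMDiffAt 𝓘(ℝ, P) 𝓘(ℝ, E) ∞ u p) :
    DifferentiableAt ℝ (Ω.pullForm u) p := by
  have hmem : u p ∈ (extChartAt 𝓘(ℝ, E) (u p)).source := mem_extChartAt_source (u p)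
  have hcu := contDiffAt_extChartAt_comp hu hmem
  refine DifferentiableAt.congr_of_eventuallyEq ?_ (Ω.pullForm_eventuallyEq_chartForm hu)
  refine DifferentiableAt.continuousAlternatingMapCompContinuousLinearMap ?_
    ((hcu.fderiv_right (m := ∞) (by simp)).differentiableAt (by simp))
  exact ((Ω.contDiffAt_chartForm (u p) (PartialEquiv.map_source _ hmem)).differentiableAt
    (by simp)).comp p (hcu.differentiableAt (by simp))

theorem extDeriv_pullForm (hu : ContMDiffAt 𝓘(ℝ, P) 𝓘(ℝ, E) ∞ u p) :
    extDeriv (Ω.pullForm u) p = 0 := by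
  have hmem : u p ∈ (extChartAt 𝓘(ℝ, E) (u p)).source := mem_extChartAt_source (u p)
  have htarget := PartialEquiv.map_source _ hmem
  rw [(Ω.pullForm_eventuallyEq_chartForm hu).extDeriv_eq]
  refine (extDeriv_pullback (f := fun q => extChartAt 𝓘(ℝ, E) (u p) (u q)) (r := ∞)
    ((Ω.contDiffAt_chartForm (u p) htarget).differentiableAt (by simp))
    (contDiffAt_extChartAt_comp hu hmem)
    (by rw [minSmoothness_of_isRCLikeNormedField]; exact ENat.LEInfty.out)).trans ?_
  rw [Ω.closed (u p) _ htarget]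
  rfl

theorem isClosedTwoFormAt_pull (hu : ContMDiffAt 𝓘(ℝ, P) 𝓘(ℝ, E) ∞ u p) :
    IsClosedTwoFormAt (Ω.pull u) p := by
  intro a v w
  have := extDeriv_two_apply (Ω.differentiableAt_pullForm hu) a v w
  rw [Ω.extDeriv_pullForm hu] at this
  exact this.symm

end SymplecticForm

end Pullback

/-! ### Flux forms -/

section Flux

variable {E : Type*} [NormedAddCommGroup E] [NormedSpace ℝ E]
  {M : Type*} [TopologicalSpace M] [ChartedSpace E M]

/-- The derivative of `φ` at `x` as an endomorphism of the model space `E`, every tangent space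
of `M` being a copy of `E`. -/
def modelDeriv (E : Type*) [NormedAddCommGroup E] [NormedSpace ℝ E]
    {M : Type*} [TopologicalSpace M] [ChartedSpace E M] (φ : Equiv.Perm M) (x : M) : E →L[ℝ] E :=
  mfderiv 𝓘(ℝ, E) 𝓘(ℝ, E) φ x

/-- A bijection preserving the symplectic form. -/
def IsSymplectic (Ω : SymplecticForm E M) (φ : Equiv.Perm M) : Prop :=
  ∀ (x : M) (v w : E),
    Ω.bilin (φ x) (modelDeriv E φ x v) (modelDeriv E φ x w) = Ω.bilin x v w

/-- The function `A` is a potential of the `1`-form `θ`, that is `dA = θ`. A `1`-form on `M` is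
encoded as a function with values in the dual of `E`. -/
def IsPotential (A : M → ℝ) (θ : M → E →L[ℝ] ℝ) : Prop :=
  ∀ x, HasMFDerivAt 𝓘(ℝ, E) 𝓘(ℝ, ℝ) A x (θ x)

/-- The pullback of a `1`-form by a bijection. -/
def pullbackOneForm (φ : Equiv.Perm M) (θ : M → E →L[ℝ] ℝ) (x : M) : E →L[ℝ] ℝ :=
  (θ (φ x)).comp (modelDeriv E φ x)

/-- The velocity of the curve `s ↦ f s x` at time `t` as a vector of the model space `E`. -/
def modelVelocity (E : Type*) [NormedAddCommGroup E] [NormedSpace ℝ E]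
    {M : Type*} [TopologicalSpace M] [ChartedSpace E M] (f : ℝ → Equiv.Perm M) (t : ℝ) (x : M) :
    E :=
  velocity E f t x

/-- The flux form `v ↦ Ω (d/dt (f t x), D (f t) v)` of a family of bijections. Its potentials are
the functions `-F t ∘ f t`, where `F` is a Hamiltonian generating `f`. -/
def fluxForm (Ω : SymplecticForm E M) (f : ℝ → Equiv.Perm M) (t : ℝ) (x : M) : E →L[ℝ] ℝ :=
  (Ω.bilin (f t x) (modelVelocity E f t x)).comp (modelDeriv E (f t) x)

/-- The smooth function `B` is, at each time, a potential of the flux form of `f`. -/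
def IsFluxPotential (Ω : SymplecticForm E M) (f : ℝ → Equiv.Perm M) (B : ℝ → M → ℝ) : Prop :=
  ContMDiff (𝓘(ℝ, ℝ).prod 𝓘(ℝ, E)) 𝓘(ℝ, ℝ) ∞ (fun q : ℝ × M => B q.1 q.2) ∧
    ∀ t, IsPotential (B t) (fluxForm Ω f t)

variable {Ω : SymplecticForm E M} {f g : ℝ → Equiv.Perm M} {φ ψ : Equiv.Perm M}

theorem SmoothFamily.contMDiff_apply (hf : SmoothFamily E f) (t : ℝ) :
    ContMDiff 𝓘(ℝ, E) 𝓘(ℝ, E) ∞ (f t) :=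
  ContMDiff.comp (I' := 𝓘(ℝ, ℝ).prod 𝓘(ℝ, E)) (g := fun q : ℝ × M => f q.1 q.2) hf
    (contMDiff_const.prodMk contMDiff_id)

theorem hasMFDerivAt_modelDeriv (hφ : ContMDiff 𝓘(ℝ, E) 𝓘(ℝ, E) ∞ φ) (x : M) :
    HasMFDerivAt 𝓘(ℝ, E) 𝓘(ℝ, E) φ x (modelDeriv E φ x) :=
  (hφ.contMDiffAt.mdifferentiableAt (by simp)).hasMFDerivAt

theorem modelDeriv_mul (hφ : ContMDiff 𝓘(ℝ, E) 𝓘(ℝ, E) ∞ φ)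
    (hψ : ContMDiff 𝓘(ℝ, E) 𝓘(ℝ, E) ∞ ψ) (x : M) :
    modelDeriv E (φ * ψ) x = (modelDeriv E φ (ψ x)).comp (modelDeriv E ψ x) :=
  (HasMFDerivAt.comp x (hasMFDerivAt_modelDeriv hφ (ψ x))
    (hasMFDerivAt_modelDeriv hψ x)).mfderiv

theorem modelDeriv_one (x : M) : modelDeriv E (1 : Equiv.Perm M) x = ContinuousLinearMap.id ℝ E :=
  mfderiv_id (I := 𝓘(ℝ, E)) (x := x)

theorem IsDiffeo.modelDeriv_comp_inv (hφ : IsDiffeo E φ) (x : M) :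
    (modelDeriv E φ x).comp (modelDeriv E φ⁻¹ (φ x)) = ContinuousLinearMap.id ℝ E := by
  have hmul := modelDeriv_mul (ψ := φ⁻¹) hφ.1 hφ.2 (φ x)
  have hx : φ⁻¹ (φ x) = x := φ.symm_apply_apply x
  rw [mul_inv_cancel, modelDeriv_one, hx] at hmul
  exact hmul.symm

theorem IsSymplectic.one : IsSymplectic Ω 1 := fun x v w => by
  simp only [modelDeriv_one, ContinuousLinearMap.id_apply, Equiv.Perm.one_apply]

theorem SmoothFamily.mdifferentiableAt_path (hf : SmoothFamily E f) (t : ℝ) (x : M) :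
    MDifferentiableAt 𝓘(ℝ, ℝ) 𝓘(ℝ, E) (fun s => f s x) t :=
  (ContMDiff.comp (I' := 𝓘(ℝ, ℝ).prod 𝓘(ℝ, E)) hf
    (contMDiff_id.prodMk contMDiff_const)).mdifferentiableAt (by simp)

theorem modelVelocity_const (φ : Equiv.Perm M) (t : ℝ) (x : M) :
    modelVelocity E (fun _ => φ) t x = 0 :=
  congrArg (fun L : ℝ →L[ℝ] E => L 1) (mfderiv_const (I := 𝓘(ℝ, ℝ)) (c := φ x) (x := t))

theorem modelVelocity_mul (hf : SmoothFamily E f) (hg : SmoothFamily E g) (t : ℝ) (x : M) :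
    modelVelocity E (f * g) t x =
      modelVelocity E f t (g t x) + modelDeriv E (f t) (g t x) (modelVelocity E g t x) := by
  have hfq : MDifferentiableAt (𝓘(ℝ, ℝ).prod 𝓘(ℝ, E)) 𝓘(ℝ, E) (fun q : ℝ × M => f q.1 q.2)
      (t, g t x) := hf.mdifferentiableAt (by simp)
  have hcurve := (hasMFDerivAt_id (I := 𝓘(ℝ, ℝ)) t).prodMk
    (hg.mdifferentiableAt_path t x).hasMFDerivAt
  have hchain := (HasMFDerivAt.comp t hfq.hasMFDerivAt hcurve).mfderiv
  exact (congrArg (fun L : ℝ →L[ℝ] E => L 1) hchain).trans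
    (mfderiv_prod_eq_add_apply (I := 𝓘(ℝ, ℝ)) (I' := 𝓘(ℝ, E)) (I'' := 𝓘(ℝ, E)) hfq)

theorem modelVelocity_reparam (hf : SmoothFamily E f) {b : ℝ → ℝ} {t : ℝ}
    (hb : DifferentiableAt ℝ b t) (x : M) :
    modelVelocity E (fun s => f (b s)) t x = deriv b t • modelVelocity E f (b t) x := by
  have hchain := mfderiv_comp (I := 𝓘(ℝ, ℝ)) (I' := 𝓘(ℝ, ℝ)) (I'' := 𝓘(ℝ, E)) t
    (hf.mdifferentiableAt_path (b t) x) hb.mdifferentiableAt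
  rw [mfderiv_eq_fderiv] at hchain
  have hb_one : fderiv ℝ b t 1 = deriv b t • (1 : ℝ) := by simp
  exact (congrArg (fun L : ℝ →L[ℝ] E => L 1) hchain).trans
    ((congrArg _ hb_one).trans
      (map_smul (mfderiv 𝓘(ℝ, ℝ) 𝓘(ℝ, E) (fun s => f s x) (b t) : ℝ →L[ℝ] E) _ _))

theorem fluxForm_const (φ : Equiv.Perm M) (t : ℝ) : fluxForm Ω (fun _ => φ) t = 0 := by
  funext x
  rw [fluxForm, modelVelocity_const, map_zero, ContinuousLinearMap.zero_comp, Pi.zero_apply]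

theorem fluxForm_mul (hf : SmoothFamily E f) (hg : SmoothFamily E g) {t : ℝ}
    (hs : IsSymplectic Ω (f t)) :
    fluxForm Ω (f * g) t = pullbackOneForm (g t) (fluxForm Ω f t) + fluxForm Ω g t := by
  funext x
  ext v
  simp only [fluxForm, pullbackOneForm, modelVelocity_mul hf hg, Pi.mul_apply, Pi.add_apply,
    Equiv.Perm.mul_apply, modelDeriv_mul (hf.contMDiff_apply t) (hg.contMDiff_apply t), add_apply,
    ContinuousLinearMap.comp_apply, map_add]
  rw [hs]

theorem fluxForm_reparam (hf : SmoothFamily E f) {b : ℝ → ℝ} {t : ℝ}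
    (hb : DifferentiableAt ℝ b t) :
    fluxForm Ω (fun s => f (b s)) t = deriv b t • fluxForm Ω f (b t) := by
  funext x
  rw [fluxForm, modelVelocity_reparam hf hb, map_smul, ContinuousLinearMap.smul_comp]
  rfl

theorem fluxForm_inv [CompleteSpace E] [IsManifold 𝓘(ℝ, E) ∞ M] (hf : SmoothFamily E f)
    (hfd : ∀ t, IsDiffeo E (f t)) {t : ℝ} (hs : IsSymplectic Ω (f t)) :
    fluxForm Ω f⁻¹ t = - pullbackOneForm (f t)⁻¹ (fluxForm Ω f t) := by
  have hmul := fluxForm_mul hf (hf.inv hfd) hs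
  rw [mul_inv_cancel, show (1 : ℝ → Equiv.Perm M) = fun _ => 1 from rfl, fluxForm_const] at hmul
  exact (neg_eq_of_add_eq_zero_right hmul.symm).symm

theorem pullbackOneForm_inv_fluxForm {t : ℝ} (hfd : IsDiffeo E (f t)) (x : M) :
    pullbackOneForm (f t)⁻¹ (fluxForm Ω f t) (f t x) = Ω.bilin (f t x) (modelVelocity E f t x) := by
  have hx : (f t)⁻¹ (f t x) = x := (f t).symm_apply_apply x
  rw [pullbackOneForm, hx, fluxForm, ContinuousLinearMap.comp_assoc,
    hfd.modelDeriv_comp_inv, ContinuousLinearMap.comp_id]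

namespace IsPotential

variable {A A' : M → ℝ} {θ θ' : M → E →L[ℝ] ℝ}

theorem add (hA : IsPotential A θ) (hA' : IsPotential A' θ') :
    IsPotential (fun x => A x + A' x) (θ + θ') := fun x => (hA x).add (hA' x)

theorem neg (hA : IsPotential A θ) : IsPotential (fun x => - A x) (-θ) := fun x => (hA x).neg

theorem pullback (hA : IsPotential A θ) (hφ : ContMDiff 𝓘(ℝ, E) 𝓘(ℝ, E) ∞ φ) :
    IsPotential (fun x => A (φ x)) (pullbackOneForm φ θ) := fun x =>
  HasMFDerivAt.comp x (hA (φ x)) (hasMFDerivAt_modelDeriv hφ x)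

end IsPotential

theorem contMDiff_comp_family {B : ℝ → M → ℝ}
    (hB : ContMDiff (𝓘(ℝ, ℝ).prod 𝓘(ℝ, E)) 𝓘(ℝ, ℝ) ∞ (fun q : ℝ × M => B q.1 q.2))
    (hg : SmoothFamily E g) :
    ContMDiff (𝓘(ℝ, ℝ).prod 𝓘(ℝ, E)) 𝓘(ℝ, ℝ) ∞ (fun q : ℝ × M => B q.1 (g q.1 q.2)) :=
  ContMDiff.comp (I' := 𝓘(ℝ, ℝ).prod 𝓘(ℝ, E)) hB (contMDiff_fst.prodMk hg)

namespace IsFluxPotential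

variable {B C : ℝ → M → ℝ}

theorem const (φ : Equiv.Perm M) : IsFluxPotential Ω (fun _ => φ) (fun _ _ => 0) :=
  ⟨contMDiff_const, fun t x => by
    rw [fluxForm_const]
    exact hasMFDerivAt_const 0 x⟩

theorem mul (hB : IsFluxPotential Ω f B) (hC : IsFluxPotential Ω g C) (hf : SmoothFamily E f)
    (hg : SmoothFamily E g) (hs : ∀ t, IsSymplectic Ω (f t)) :
    IsFluxPotential Ω (f * g) (fun t x => B t (g t x) + C t x) := by
  refine ⟨(contMDiff_comp_family hB.1 hg).add hC.1, fun t => ?_⟩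
  rw [fluxForm_mul hf hg (hs t)]
  exact ((hB.2 t).pullback (hg.contMDiff_apply t)).add (hC.2 t)

theorem inv [CompleteSpace E] [IsManifold 𝓘(ℝ, E) ∞ M] (hB : IsFluxPotential Ω f B)
    (hf : SmoothFamily E f) (hfd : ∀ t, IsDiffeo E (f t)) (hs : ∀ t, IsSymplectic Ω (f t)) :
    IsFluxPotential Ω f⁻¹ (fun t x => - B t ((f t)⁻¹ x)) := by
  refine ⟨(contMDiff_comp_family hB.1 (hf.inv hfd)).neg, fun t => ?_⟩
  rw [fluxForm_inv hf hfd (hs t)]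
  exact ((hB.2 t).pullback (hfd t).2).neg

theorem generatesPath [CompleteSpace E] [IsManifold 𝓘(ℝ, E) ∞ M] (hB : IsFluxPotential Ω f B)
    (hf : SmoothFamily E f) (hfd : ∀ t, IsDiffeo E (f t)) :
    GeneratesPath Ω (fun t x => - B t ((f t)⁻¹ x)) f := by
  refine ⟨(contMDiff_comp_family hB.1 (hf.inv hfd)).neg, fun t x v => ?_⟩
  have hpotential : mfderiv 𝓘(ℝ, E) 𝓘(ℝ, ℝ) (fun y => - B t ((f t)⁻¹ y)) (f t x) =
      - pullbackOneForm (f t)⁻¹ (fluxForm Ω f t) (f t x) :=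
    (((hB.2 t).pullback (hfd t).2).neg (f t x)).mfderiv
  rw [← Ω.bilin_apply, hpotential, pullbackOneForm_inv_fluxForm (hfd t)]
  exact (neg_neg _).symm

end IsFluxPotential

theorem GeneratesPath.isFluxPotential {F : ℝ → M → ℝ} (h : GeneratesPath Ω F f)
    (hf : SmoothFamily E f) :
    IsFluxPotential Ω f (fun t x => - F t (f t x)) := by
  refine ⟨(contMDiff_comp_family h.1 hf).neg, fun t => ?_⟩
  have hF : IsPotential (F t) fun y => mfderiv 𝓘(ℝ, E) 𝓘(ℝ, ℝ) (F t) y := fun y =>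
    ((ContMDiff.comp (I' := 𝓘(ℝ, ℝ).prod 𝓘(ℝ, E)) h.1
      (contMDiff_const.prodMk contMDiff_id)).mdifferentiableAt (by simp)).hasMFDerivAt
  convert (hF.pullback (hf.contMDiff_apply t)).neg using 1
  funext x
  ext v
  exact (Ω.bilin_apply _ _ _).trans (h.2 t x (modelDeriv E (f t) x v))

end Flux

/-! ### Integrals depending on a parameter -/

section ParametricIntegral

/-- The partial derivative of `g` in its second variable. -/
def fderivSnd {Y F : Type*} [NormedAddCommGroup Y] [NormedSpace ℝ Y] [NormedAddCommGroup F]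
    [NormedSpace ℝ F] (g : ℝ × Y → F) (q : ℝ × Y) : Y →L[ℝ] F :=
  (fderiv ℝ g q).comp (ContinuousLinearMap.inr ℝ ℝ Y)

section Derivative

variable {Y F : Type*} [NormedAddCommGroup Y] [NormedSpace ℝ Y] [NormedAddCommGroup F]
  [NormedSpace ℝ F] {g : ℝ × Y → F} {U : Set (ℝ × Y)} {O : Set Y}

theorem hasFDerivAt_fderivSnd {s : ℝ} {y : Y} (hg : DifferentiableAt ℝ g (s, y)) :
    HasFDerivAt (fun y => g (s, y)) (fderivSnd g (s, y)) y :=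
  hg.hasFDerivAt.comp y (hasFDerivAt_prodMk_right s y)

theorem continuousOn_fderivSnd (hU : IsOpen U) (hg : ContDiffOn ℝ 1 g U) :
    ContinuousOn (fderivSnd g) U :=
  (hg.continuousOn_fderiv_of_isOpen hU le_rfl).clm_comp continuousOn_const

theorem eventually_norm_fderivSnd_lt (hU : IsOpen U) (hg : ContDiffOn ℝ 1 g U) {y₀ : Y}
    (hy : ∀ s ∈ Icc (0 : ℝ) 1, (s, y₀) ∈ U) :
    ∃ C, ∀ᶠ y in 𝓝 y₀, ∀ s ∈ Icc (0 : ℝ) 1, ‖fderivSnd g (s, y)‖ < C := by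
  have hcont : ∀ s ∈ Icc (0 : ℝ) 1, ContinuousAt (fderivSnd g) (s, y₀) := fun s hs =>
    (continuousOn_fderivSnd hU hg).continuousAt (hU.mem_nhds (hy s hs))
  obtain ⟨C, hC⟩ := isCompact_Icc.exists_bound_of_continuousOn
    ((continuousOn_fderivSnd hU hg).comp (f := fun s : ℝ => (s, y₀)) (by fun_prop) hy)
  refine ⟨C + 1, isCompact_Icc.eventually_forall_of_forall_eventually fun s hs => ?_⟩
  have hnorm : ContinuousAt (fun z : Y × ℝ => ‖fderivSnd g (z.2, z.1)‖) (y₀, s) :=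
    (ContinuousAt.comp (f := fun z : Y × ℝ => (z.2, z.1)) (x := (y₀, s)) (hcont s hs)
      (by fun_prop)).norm
  exact hnorm.eventually (gt_mem_nhds ((hC s hs).trans_lt (lt_add_one C)))

theorem hasFDerivAt_parametric_integral (hO : IsOpen O) (hU : IsOpen U)
    (hOU : Icc 0 1 ×ˢ O ⊆ U) (hg : ContDiffOn ℝ 1 g U) {y₀ : Y} (hy : y₀ ∈ O) :
    HasFDerivAt (fun y => ∫ s in (0 : ℝ)..1, g (s, y))
      (∫ s in (0 : ℝ)..1, fderivSnd g (s, y₀)) y₀ := by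
  have hunit : uIoc (0 : ℝ) 1 ⊆ Icc 0 1 := uIoc_subset_uIcc.trans (uIcc_of_le zero_le_one).subset
  have hslice : ∀ y ∈ O, MapsTo (fun s : ℝ => (s, y)) (Icc 0 1) U := fun y hyO s hs =>
    hOU ⟨hs, hyO⟩
  have hgs : ∀ y ∈ O, ContinuousOn (fun s => g (s, y)) (Icc 0 1) := fun y hyO =>
    hg.continuousOn.comp (by fun_prop) (hslice y hyO)
  have hderiv : ContinuousOn (fun s => fderivSnd g (s, y₀)) (Icc 0 1) :=
    (continuousOn_fderivSnd hU hg).comp (by fun_prop) (hslice y₀ hy)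
  obtain ⟨C, hC⟩ := eventually_norm_fderivSnd_lt hU hg (hslice y₀ hy)
  refine intervalIntegral.hasFDerivAt_integral_of_dominated_of_fderiv_le (𝕜 := ℝ)
    (F := fun y s => g (s, y)) (F' := fun y s => fderivSnd g (s, y)) (bound := fun _ => C)
    (inter_mem (hO.mem_nhds hy) hC) ?_
    (ContinuousOn.intervalIntegrable_of_Icc zero_le_one (hgs y₀ hy))
    ((hderiv.mono hunit).aestronglyMeasurable measurableSet_uIoc)
    (Eventually.of_forall fun s hs y hyC => (hyC.2 s (hunit hs)).le) intervalIntegrable_const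
    (Eventually.of_forall fun s hs y hyC => ?_)
  · filter_upwards [hO.mem_nhds hy] with y hyO
    exact ((hgs y hyO).mono hunit).aestronglyMeasurable measurableSet_uIoc
  · exact hasFDerivAt_fderivSnd ((hg.differentiableOn one_ne_zero).differentiableAt
      (hU.mem_nhds (hslice y hyC.1 (hunit hs))))

theorem fderiv_parametric_integral_apply [CompleteSpace F] (hO : IsOpen O) (hU : IsOpen U)
    (hOU : Icc 0 1 ×ˢ O ⊆ U) (hg : ContDiffOn ℝ 1 g U) {y₀ : Y} (hy : y₀ ∈ O) (v : Y) :
    fderiv ℝ (fun y => ∫ s in (0 : ℝ)..1, g (s, y)) y₀ v =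
      ∫ s in (0 : ℝ)..1, fderiv ℝ g (s, y₀) (0, v) := by
  rw [(hasFDerivAt_parametric_integral hO hU hOU hg hy).fderiv]
  exact ContinuousLinearMap.intervalIntegral_apply (ContinuousOn.intervalIntegrable_of_Icc
    zero_le_one ((continuousOn_fderivSnd hU hg).comp (by fun_prop) fun s hs => hOU ⟨hs, hy⟩)) v

end Derivative

universe u

variable {Y : Type u} [NormedAddCommGroup Y] [NormedSpace ℝ Y] {U : Set (ℝ × Y)} {O : Set Y}

theorem contDiffOn_parametric_integral_nat (hO : IsOpen O) (hU : IsOpen U)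
    (hOU : Icc 0 1 ×ˢ O ⊆ U) (n : ℕ) :
    ∀ {F : Type u} [NormedAddCommGroup F] [NormedSpace ℝ F] {g : ℝ × Y → F},
      ContDiffOn ℝ ∞ g U → ContDiffOn ℝ n (fun y => ∫ s in (0 : ℝ)..1, g (s, y)) O := by
  induction n with
  | zero =>
    intro F _ _ g hg
    exact contDiffOn_zero.2 fun y hy => (hasFDerivAt_parametric_integral hO hU hOU
      (hg.of_le ENat.LEInfty.out) hy).continuousAt.continuousWithinAt
  | succ n ih =>
    intro F _ _ g hg
    have hderiv := fun y hy => hasFDerivAt_parametric_integral hO hU hOU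
      (hg.of_le ENat.LEInfty.out) (y₀ := y) hy
    have hsmooth : ContDiffOn ℝ ∞ (fderivSnd g) U :=
      (hg.fderiv_of_isOpen hU (by simp)).clm_comp contDiffOn_const
    push_cast
    rw [contDiffOn_succ_iff_fderiv_of_isOpen hO]
    exact ⟨fun y hy => (hderiv y hy).differentiableAt.differentiableWithinAt, by simp,
      (ih hsmooth).congr fun y hy => (hderiv y hy).fderiv⟩

theorem contDiffOn_parametric_integral {F : Type u} [NormedAddCommGroup F] [NormedSpace ℝ F]
    (hO : IsOpen O) (hU : IsOpen U) (hOU : Icc 0 1 ×ˢ O ⊆ U) {g : ℝ × Y → F}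
    (hg : ContDiffOn ℝ ∞ g U) : ContDiffOn ℝ ∞ (fun y => ∫ s in (0 : ℝ)..1, g (s, y)) O :=
  contDiffOn_infty.2 fun n => contDiffOn_parametric_integral_nat hO hU hOU n hg

end ParametricIntegral

/-! ### Families of diffeomorphisms in coordinates -/

section ClosedOnCylinder

variable {E : Type*} [NormedAddCommGroup E] [NormedSpace ℝ E]
  {σ : ℝ × E → ℝ × E →L[ℝ] ℝ × E →L[ℝ] ℝ} {G : ℝ × E → ℝ}

-- Cartan's formula: the Lie derivative of `σ` along `∂/∂s` is the differential of its contraction.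
theorem fderiv_twoForm_time_eq_zero {q : ℝ × E} (hσ : DifferentiableAt ℝ σ q)
    (hclosed : IsClosedTwoFormAt σ q) (hG : ContDiffAt ℝ ∞ G q)
    (h : ∀ᶠ p in 𝓝 q, ∀ w, σ p (1, 0) (0, w) = fderiv ℝ G p (0, w)) (v w : E) :
    fderiv ℝ σ q (1, 0) (0, v) (0, w) = 0 := by
  have hGd : DifferentiableAt ℝ (fderiv ℝ G) q :=
    (hG.fderiv_right (m := 1) (by norm_cast)).differentiableAt one_ne_zero
  have hsymm : ∀ a b, fderiv ℝ (fderiv ℝ G) q a b = fderiv ℝ (fderiv ℝ G) q b a :=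
    hG.isSymmSndFDerivAt (by
      rw [minSmoothness_of_isRCLikeNormedField]
      exact ENat.LEInfty.out)
  have hcontraction : ∀ v w : E,
      fderiv ℝ σ q (0, v) (1, 0) (0, w) = fderiv ℝ (fderiv ℝ G) q (0, v) (0, w) := fun v w => by
    rw [← fderiv_twoForm_apply hσ, ← fderiv_oneForm_apply hGd]
    exact congrArg (fun L : ℝ × E →L[ℝ] ℝ => L (0, v))
      (EventuallyEq.fderiv_eq (h.mono fun p hp => hp w))
  have hdσ := hclosed (1, 0) (0, v) (0, w)
  rw [hcontraction, hcontraction, hsymm (0, v)] at hdσ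
  linarith

theorem twoForm_space_space_eq {y : E} (hσ : ∀ s, DifferentiableAt ℝ σ (s, y))
    (hclosed : ∀ s, IsClosedTwoFormAt σ (s, y)) (hG : ∀ s, ContDiffAt ℝ ∞ G (s, y))
    (h : ∀ s, ∀ᶠ p in 𝓝 (s, y), ∀ w, σ p (1, 0) (0, w) = fderiv ℝ G p (0, w)) (s r : ℝ) (v w : E) :
    σ (s, y) (0, v) (0, w) = σ (r, y) (0, v) (0, w) := by
  have hderiv : ∀ s, HasDerivAt (fun r => σ (r, y) (0, v) (0, w)) 0 s := fun s => by
    have hσvw : DifferentiableAt ℝ (fun q => σ q (0, v) (0, w)) (s, y) :=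
      ((hσ s).clm_apply (differentiableAt_const _)).clm_apply (differentiableAt_const _)
    have hderiv_time := (hσvw.hasFDerivAt.comp s (hasFDerivAt_prodMk_left s y)).hasDerivAt
    refine hderiv_time.congr_deriv ?_
    exact (fderiv_twoForm_apply (hσ s) (0, v) (0, w) (1, 0)).trans
      (fderiv_twoForm_time_eq_zero (hσ s) (hclosed s) (hG s) (h s) v w)
  exact is_const_of_deriv_eq_zero (fun s => (hderiv s).differentiableAt)
    (fun s => (hderiv s).deriv) s r

end ClosedOnCylinder

section Coordinates

variable {E : Type*} [NormedAddCommGroup E] [NormedSpace ℝ E]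
  {M : Type*} [TopologicalSpace M] [ChartedSpace E M]

/-- The derivative of the inverse of the chart at `x₀`. -/
def chartInvDeriv (E : Type*) [NormedAddCommGroup E] [NormedSpace ℝ E]
    {M : Type*} [TopologicalSpace M] [ChartedSpace E M] (x₀ : M) (y : E) : E →L[ℝ] E :=
  mfderiv 𝓘(ℝ, E) 𝓘(ℝ, E) (extChartAt 𝓘(ℝ, E) x₀).symm y

/-- A family of bijections, as a map from the product of the parameter space and the target
of the chart at `x₀`. -/
def chartFamily (E : Type*) [NormedAddCommGroup E] [NormedSpace ℝ E]
    {M : Type*} [TopologicalSpace M] [ChartedSpace E M] (f : ℝ → Equiv.Perm M) (x₀ : M)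
    (q : ℝ × E) : M :=
  f q.1 ((extChartAt 𝓘(ℝ, E) x₀).symm q.2)

/-- The pullback of the flux forms by the inverse of the chart at `x₀`. -/
def chartFlux (Ω : SymplecticForm E M) (f : ℝ → Equiv.Perm M) (x₀ : M) (q : ℝ × E) : E →L[ℝ] ℝ :=
  (fluxForm Ω f q.1 ((extChartAt 𝓘(ℝ, E) x₀).symm q.2)).comp (chartInvDeriv E x₀ q.2)

theorem isOpen_univ_prod_chart_target (x₀ : M) :
    IsOpen ((univ : Set ℝ) ×ˢ (extChartAt 𝓘(ℝ, E) x₀).target) :=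
  isOpen_univ.prod (isOpen_extChartAt_target x₀)

variable [IsManifold 𝓘(ℝ, E) ∞ M] {Ω : SymplecticForm E M} {f : ℝ → Equiv.Perm M} (x₀ : M) {y : E}

theorem hasMFDerivAt_chart_symm (hy : y ∈ (extChartAt 𝓘(ℝ, E) x₀).target) :
    HasMFDerivAt 𝓘(ℝ, E) 𝓘(ℝ, E) (extChartAt 𝓘(ℝ, E) x₀).symm y (chartInvDeriv E x₀ y) :=
  (((contMDiffOn_extChartAt_symm (n := ∞) x₀).contMDiffAt
    ((isOpen_extChartAt_target x₀).mem_nhds hy)).mdifferentiableAt (by simp)).hasMFDerivAt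

theorem mdifferentiableAt_chart {x : M} (hx : x ∈ (extChartAt 𝓘(ℝ, E) x₀).source) :
    MDifferentiableAt 𝓘(ℝ, E) 𝓘(ℝ, E) (extChartAt 𝓘(ℝ, E) x₀) x :=
  (contMDiffAt_extChartAt' (n := ∞) (by simpa using hx)).mdifferentiableAt (by simp)

theorem chartInvDeriv_comp_mfderiv_chart {x : M} (hx : x ∈ (extChartAt 𝓘(ℝ, E) x₀).source) :
    (chartInvDeriv E x₀ (extChartAt 𝓘(ℝ, E) x₀ x)).comp
      (mfderiv 𝓘(ℝ, E) 𝓘(ℝ, E) (extChartAt 𝓘(ℝ, E) x₀) x) = ContinuousLinearMap.id ℝ E := by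
  have hcomp := (HasMFDerivAt.comp x
    (hasMFDerivAt_chart_symm x₀ ((extChartAt 𝓘(ℝ, E) x₀).map_source hx))
    (mdifferentiableAt_chart x₀ hx).hasMFDerivAt).mfderiv
  have hid : (extChartAt 𝓘(ℝ, E) x₀).symm ∘ extChartAt 𝓘(ℝ, E) x₀ =ᶠ[𝓝 x] id := by
    filter_upwards [extChartAt_source_mem_nhds' hx] with z hz
    exact (extChartAt 𝓘(ℝ, E) x₀).left_inv hz
  exact (hcomp.symm.trans hid.mfderiv_eq).trans mfderiv_id

theorem chartInvDeriv_surjective {x : M} (hx : x ∈ (extChartAt 𝓘(ℝ, E) x₀).source) :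
    Function.Surjective (chartInvDeriv E x₀ (extChartAt 𝓘(ℝ, E) x₀ x)) := fun v =>
  ⟨_, congrArg (fun L : E →L[ℝ] E => L v) (chartInvDeriv_comp_mfderiv_chart x₀ hx)⟩

theorem hasFDerivAt_comp_chart_symm {G : M → ℝ} {L : E →L[ℝ] ℝ}
    (hy : y ∈ (extChartAt 𝓘(ℝ, E) x₀).target)
    (h : HasMFDerivAt 𝓘(ℝ, E) 𝓘(ℝ, ℝ) G ((extChartAt 𝓘(ℝ, E) x₀).symm y) L) :
    HasFDerivAt (fun z => G ((extChartAt 𝓘(ℝ, E) x₀).symm z)) (L.comp (chartInvDeriv E x₀ y)) y :=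
  hasMFDerivAt_iff_hasFDerivAt.1 (HasMFDerivAt.comp y h (hasMFDerivAt_chart_symm x₀ hy))

theorem hasMFDerivAt_of_hasFDerivAt_chart {G : M → ℝ} {x : M} {L : E →L[ℝ] ℝ}
    (hx : x ∈ (extChartAt 𝓘(ℝ, E) x₀).source)
    (h : HasFDerivAt (fun z => G ((extChartAt 𝓘(ℝ, E) x₀).symm z))
      (L.comp (chartInvDeriv E x₀ (extChartAt 𝓘(ℝ, E) x₀ x))) (extChartAt 𝓘(ℝ, E) x₀ x)) :
    HasMFDerivAt 𝓘(ℝ, E) 𝓘(ℝ, ℝ) G x L := by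
  have hcomp := HasMFDerivAt.comp x h.hasMFDerivAt (mdifferentiableAt_chart x₀ hx).hasMFDerivAt
  have hG : G =ᶠ[𝓝 x] (fun z => G ((extChartAt 𝓘(ℝ, E) x₀).symm z)) ∘ extChartAt 𝓘(ℝ, E) x₀ := by
    filter_upwards [extChartAt_source_mem_nhds' hx] with z hz
    simp only [Function.comp_apply, (extChartAt 𝓘(ℝ, E) x₀).left_inv hz]
  refine (hcomp.congr_of_eventuallyEq hG).congr_mfderiv ?_
  exact (ContinuousLinearMap.comp_assoc L _ _).trans
    ((congrArg L.comp (chartInvDeriv_comp_mfderiv_chart x₀ hx)).trans L.comp_id)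

theorem contMDiffOn_prod_chart_symm :
    ContMDiffOn 𝓘(ℝ, ℝ × E) (𝓘(ℝ, ℝ).prod 𝓘(ℝ, E)) ∞
      (fun q : ℝ × E => (q.1, (extChartAt 𝓘(ℝ, E) x₀).symm q.2))
      (univ ×ˢ (extChartAt 𝓘(ℝ, E) x₀).target) :=
  contDiff_fst.contMDiff.contMDiffOn.prodMk
    (ContMDiffOn.comp (I' := 𝓘(ℝ, E)) (contMDiffOn_extChartAt_symm x₀)
      contDiff_snd.contMDiff.contMDiffOn fun _ hq => hq.2)

theorem contDiffOn_chart_of_contMDiff {B : ℝ → M → ℝ}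
    (hB : ContMDiff (𝓘(ℝ, ℝ).prod 𝓘(ℝ, E)) 𝓘(ℝ, ℝ) ∞ (fun q : ℝ × M => B q.1 q.2)) :
    ContDiffOn ℝ ∞ (fun q : ℝ × E => B q.1 ((extChartAt 𝓘(ℝ, E) x₀).symm q.2))
      (univ ×ˢ (extChartAt 𝓘(ℝ, E) x₀).target) :=
  (ContMDiff.comp_contMDiffOn (I' := 𝓘(ℝ, ℝ).prod 𝓘(ℝ, E)) hB
    (contMDiffOn_prod_chart_symm x₀)).contDiffOn

namespace SmoothFamily

theorem contMDiffOn_chartFamily (hf : SmoothFamily E f) :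
    ContMDiffOn 𝓘(ℝ, ℝ × E) 𝓘(ℝ, E) ∞ (chartFamily E f x₀)
      (univ ×ˢ (extChartAt 𝓘(ℝ, E) x₀).target) :=
  ContMDiff.comp_contMDiffOn (I' := 𝓘(ℝ, ℝ).prod 𝓘(ℝ, E)) (g := fun q : ℝ × M => f q.1 q.2) hf
    (contMDiffOn_prod_chart_symm x₀)

theorem contMDiffAt_chartFamily (hf : SmoothFamily E f) (s : ℝ)
    (hy : y ∈ (extChartAt 𝓘(ℝ, E) x₀).target) :
    ContMDiffAt 𝓘(ℝ, ℝ × E) 𝓘(ℝ, E) ∞ (chartFamily E f x₀) (s, y) :=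
  (hf.contMDiffOn_chartFamily x₀).contMDiffAt
    ((isOpen_univ_prod_chart_target x₀).mem_nhds ⟨mem_univ s, hy⟩)

theorem mfderiv_chartFamily_time (hf : SmoothFamily E f) (s : ℝ)
    (hy : y ∈ (extChartAt 𝓘(ℝ, E) x₀).target) :
    (mfderiv 𝓘(ℝ, ℝ × E) 𝓘(ℝ, E) (chartFamily E f x₀) (s, y) : ℝ × E →L[ℝ] E) (1, 0) =
      modelVelocity E f s ((extChartAt 𝓘(ℝ, E) x₀).symm y) := by
  have hcurve : HasFDerivAt (fun r : ℝ => (r, y)) (ContinuousLinearMap.inl ℝ ℝ E) s :=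
    hasFDerivAt_prodMk_left s y
  have hchain := (HasMFDerivAt.comp s ((hf.contMDiffAt_chartFamily x₀ s hy).mdifferentiableAt
    (by simp)).hasMFDerivAt hcurve.hasMFDerivAt).mfderiv
  exact (congrArg (fun L : ℝ →L[ℝ] E => L 1) hchain).symm

theorem mfderiv_chartFamily_space (hf : SmoothFamily E f) (s : ℝ)
    (hy : y ∈ (extChartAt 𝓘(ℝ, E) x₀).target) (w : E) :
    (mfderiv 𝓘(ℝ, ℝ × E) 𝓘(ℝ, E) (chartFamily E f x₀) (s, y) : ℝ × E →L[ℝ] E) (0, w) =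
      modelDeriv E (f s) ((extChartAt 𝓘(ℝ, E) x₀).symm y) (chartInvDeriv E x₀ y w) := by
  have hslice : HasFDerivAt (fun z : E => (s, z)) (ContinuousLinearMap.inr ℝ ℝ E) y :=
    hasFDerivAt_prodMk_right s y
  have hchain := (HasMFDerivAt.comp y ((hf.contMDiffAt_chartFamily x₀ s hy).mdifferentiableAt
    (by simp)).hasMFDerivAt hslice.hasMFDerivAt).mfderiv
  have hdirect := (HasMFDerivAt.comp y (hasMFDerivAt_modelDeriv (hf.contMDiff_apply s) _)
    (hasMFDerivAt_chart_symm x₀ hy)).mfderiv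
  exact congrArg (fun L : E →L[ℝ] E => L w) (hchain.symm.trans hdirect)

theorem pull_chartFamily_time_space (hf : SmoothFamily E f) (s : ℝ)
    (hy : y ∈ (extChartAt 𝓘(ℝ, E) x₀).target) (w : E) :
    Ω.pull (chartFamily E f x₀) (s, y) (1, 0) (0, w) = chartFlux Ω f x₀ (s, y) w :=
  (Ω.pull_apply _ _ _ _).trans (congrArg₂ (fun a b : E => Ω.bilin (chartFamily E f x₀ (s, y)) a b)
    (hf.mfderiv_chartFamily_time x₀ s hy) (hf.mfderiv_chartFamily_space x₀ s hy w))

theorem pull_chartFamily_space_space (hf : SmoothFamily E f) (s : ℝ)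
    (hy : y ∈ (extChartAt 𝓘(ℝ, E) x₀).target) (v w : E) :
    Ω.pull (chartFamily E f x₀) (s, y) (0, v) (0, w) =
      Ω.bilin (f s ((extChartAt 𝓘(ℝ, E) x₀).symm y))
        (modelDeriv E (f s) ((extChartAt 𝓘(ℝ, E) x₀).symm y) (chartInvDeriv E x₀ y v))
        (modelDeriv E (f s) ((extChartAt 𝓘(ℝ, E) x₀).symm y) (chartInvDeriv E x₀ y w)) :=
  (Ω.pull_apply _ _ _ _).trans (congrArg₂ (fun a b : E => Ω.bilin (chartFamily E f x₀ (s, y)) a b)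
    (hf.mfderiv_chartFamily_space x₀ s hy v) (hf.mfderiv_chartFamily_space x₀ s hy w))

theorem contDiffOn_chartFlux (hf : SmoothFamily E f) :
    ContDiffOn ℝ ∞ (chartFlux Ω f x₀) (univ ×ˢ (extChartAt 𝓘(ℝ, E) x₀).target) := by
  have hpull : ContDiffOn ℝ ∞ (fun q => (Ω.pull (chartFamily E f x₀) q (1, 0)).comp
      (ContinuousLinearMap.inr ℝ ℝ E)) (univ ×ˢ (extChartAt 𝓘(ℝ, E) x₀).target) :=
    ((Ω.contDiffOn_pull (isOpen_univ_prod_chart_target x₀)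
      (hf.contMDiffOn_chartFamily x₀)).clm_apply contDiffOn_const).clm_comp contDiffOn_const
  refine hpull.congr fun q hq => ?_
  ext w
  exact (hf.pull_chartFamily_time_space x₀ q.1 hq.2 w).symm

end SmoothFamily

theorem IsFluxPotential.chartFlux_eq_fderiv {B : ℝ → M → ℝ} (hB : IsFluxPotential Ω f B) (s : ℝ)
    (hy : y ∈ (extChartAt 𝓘(ℝ, E) x₀).target) (w : E) :
    chartFlux Ω f x₀ (s, y) w =
      fderiv ℝ (fun q : ℝ × E => B q.1 ((extChartAt 𝓘(ℝ, E) x₀).symm q.2)) (s, y) (0, w) := by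
  have hG := ((contDiffOn_chart_of_contMDiff x₀ hB.1).contDiffAt (x := (s, y))
    ((isOpen_univ_prod_chart_target x₀).mem_nhds ⟨mem_univ s, hy⟩)).differentiableAt (by simp)
  have hslice := hG.hasFDerivAt.comp y (hasFDerivAt_prodMk_right s y)
  exact congrArg (fun L : E →L[ℝ] ℝ => L w)
    ((hasFDerivAt_comp_chart_symm x₀ hy (hB.2 s _)).unique hslice)

theorem IsFluxPotential.isSymplectic {B : ℝ → M → ℝ} (hB : IsFluxPotential Ω f B)
    (hf : SmoothFamily E f) (h0 : f 0 = 1) (t : ℝ) : IsSymplectic Ω (f t) := by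
  intro x v w
  have hx : x ∈ (extChartAt 𝓘(ℝ, E) x).source := mem_extChartAt_source x
  have hy := (extChartAt 𝓘(ℝ, E) x).map_source hx
  obtain ⟨v, rfl⟩ := chartInvDeriv_surjective x hx v
  obtain ⟨w, rfl⟩ := chartInvDeriv_surjective x hx w
  have hchart : ∀ s, ContMDiffAt 𝓘(ℝ, ℝ × E) 𝓘(ℝ, E) ∞ (chartFamily E f x)
      (s, extChartAt 𝓘(ℝ, E) x x) := fun s => hf.contMDiffAt_chartFamily x s hy
  have hmem : ∀ s, univ ×ˢ (extChartAt 𝓘(ℝ, E) x).target ∈ 𝓝 (s, extChartAt 𝓘(ℝ, E) x x) :=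
    fun s => (isOpen_univ_prod_chart_target x).mem_nhds ⟨mem_univ s, hy⟩
  have hconst := twoForm_space_space_eq
    (fun s => (Ω.contDiffAt_pull (hchart s)).differentiableAt (by simp))
    (fun s => Ω.isClosedTwoFormAt_pull (hchart s))
    (fun s => (contDiffOn_chart_of_contMDiff x hB.1).contDiffAt (hmem s))
    (fun s => by
      filter_upwards [hmem s] with q hq w
      exact (hf.pull_chartFamily_time_space x q.1 hq.2 w).trans
        (hB.chartFlux_eq_fderiv x q.1 hq.2 w)) t 0 v w
  rw [hf.pull_chartFamily_space_space x t hy, hf.pull_chartFamily_space_space x 0 hy, h0,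
    (extChartAt 𝓘(ℝ, E) x).left_inv hx] at hconst
  exact hconst.trans (IsSymplectic.one x _ _)

end Coordinates

/-! ### One-forms and two-forms on vector spaces -/

section OneForms

variable {P Q R : Type*} [NormedAddCommGroup P] [NormedSpace ℝ P] [NormedAddCommGroup Q]
  [NormedSpace ℝ Q] [NormedAddCommGroup R] [NormedSpace ℝ R]

/-- The exterior derivative of a `1`-form on a vector space. -/
def extDerivOne (η : P → P →L[ℝ] ℝ) (p v w : P) : ℝ :=
  fderiv ℝ η p v w - fderiv ℝ η p w v

/-- The pullback of a `1`-form on a vector space by a map. -/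
def pullOneForm (η : Q → Q →L[ℝ] ℝ) (g : P → Q) (p : P) : P →L[ℝ] ℝ :=
  (η (g p)).comp (fderiv ℝ g p)

/-- The integral of a `1`-form along a curve, over the time interval `[0, 1]`. -/
def lineIntegral (η : P → P →L[ℝ] ℝ) (l : ℝ → P) : ℝ :=
  ∫ s in (0 : ℝ)..1, pullOneForm η l s 1

variable {η η' : Q → Q →L[ℝ] ℝ} {g : P → Q} {p : P}

theorem pullOneForm_congr {g' : P → Q} (h : g =ᶠ[𝓝 p] g') :
    pullOneForm η g p = pullOneForm η g' p := by
  rw [pullOneForm, pullOneForm, h.fderiv_eq, h.self_of_nhds]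

theorem pullOneForm_comp {k : R → P} {r : R} (hg : DifferentiableAt ℝ g (k r))
    (hk : DifferentiableAt ℝ k r) :
    pullOneForm η (fun q => g (k q)) r = (pullOneForm η g (k r)).comp (fderiv ℝ k r) := by
  rw [pullOneForm, pullOneForm, ContinuousLinearMap.comp_assoc]
  exact congrArg (η (g (k r))).comp (fderiv_comp r hg hk)

theorem pullOneForm_slice_fst {g : ℝ × R → Q} {s : ℝ} {y : R} (hg : DifferentiableAt ℝ g (s, y)) :
    pullOneForm η (fun r => g (r, y)) s 1 = pullOneForm η g (s, y) (1, 0) := by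
  have hslice : HasFDerivAt (fun r : ℝ => (r, y)) (ContinuousLinearMap.inl ℝ ℝ R) s :=
    hasFDerivAt_prodMk_left s y
  have hcomp := pullOneForm_comp (η := η) (g := g) (k := fun r : ℝ => (r, y)) hg
    hslice.differentiableAt
  rw [hslice.fderiv] at hcomp
  exact congrArg (fun L : ℝ →L[ℝ] ℝ => L 1) hcomp

theorem pullOneForm_slice_snd {g : ℝ × R → Q} {s : ℝ} {y : R} (hg : DifferentiableAt ℝ g (s, y)) :
    pullOneForm η (fun z => g (s, z)) y =
      (pullOneForm η g (s, y)).comp (ContinuousLinearMap.inr ℝ ℝ R) := by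
  have hslice : HasFDerivAt (fun z : R => (s, z)) (ContinuousLinearMap.inr ℝ ℝ R) y :=
    hasFDerivAt_prodMk_right s y
  have hcomp := pullOneForm_comp (η := η) (g := g) (k := fun z : R => (s, z)) hg
    hslice.differentiableAt
  rwa [hslice.fderiv] at hcomp

theorem contDiffOn_pullOneForm {O : Set P} {O' : Set Q} (hO : IsOpen O)
    (hη : ContDiffOn ℝ ∞ η O') (hg : ContDiffOn ℝ ∞ g O) (hmaps : MapsTo g O O') :
    ContDiffOn ℝ ∞ (pullOneForm η g) O :=
  (hη.comp hg hmaps).clm_comp (hg.fderiv_of_isOpen hO (by simp))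

theorem extDerivOne_pullOneForm (hη : DifferentiableAt ℝ η (g p)) (hg : ContDiffAt ℝ 2 g p)
    (v w : P) :
    extDerivOne (pullOneForm η g) p v w =
      extDerivOne η (g p) (fderiv ℝ g p v) (fderiv ℝ g p w) := by
  have hg₁ : HasFDerivAt g (fderiv ℝ g p) p :=
    (hg.differentiableAt two_ne_zero).hasFDerivAt
  have hg₂ : HasFDerivAt (fderiv ℝ g) (fderiv ℝ (fderiv ℝ g) p) p :=
    ((hg.fderiv_right (m := 1) (by norm_cast)).differentiableAt one_ne_zero).hasFDerivAt
  have hpull : ∀ v w, fderiv ℝ (pullOneForm η g) p v w = η (g p) (fderiv ℝ (fderiv ℝ g) p v w) +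
      fderiv ℝ η (g p) (fderiv ℝ g p v) (fderiv ℝ g p w) := fun v w => by
    have hd : HasFDerivAt (pullOneForm η g) _ p :=
      (HasFDerivAt.comp (g := η) p hη.hasFDerivAt hg₁).clm_comp hg₂
    rw [hd.fderiv]
    simp
  have hsymm : fderiv ℝ (fderiv ℝ g) p v w = fderiv ℝ (fderiv ℝ g) p w v :=
    hg.isSymmSndFDerivAt (by rw [minSmoothness_of_isRCLikeNormedField]) v w
  rw [extDerivOne, hpull, hpull, hsymm, extDerivOne]
  ring

theorem hasDerivAt_comp_pullOneForm {φ : Q → ℝ} {l : ℝ → Q} {s : ℝ}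
    (hφ : HasFDerivAt φ (η (l s)) (l s)) (hl : DifferentiableAt ℝ l s) :
    HasDerivAt (fun r => φ (l r)) (pullOneForm η l s 1) s :=
  (hφ.comp s hl.hasFDerivAt).hasDerivAt

theorem continuousOn_pullOneForm_apply_one {l : ℝ → Q} {O : Set Q} (hη : ContinuousOn η O)
    (hl : ∀ s ∈ Icc (0 : ℝ) 1, ContDiffAt ℝ 1 l s) (hmaps : MapsTo l (Icc 0 1) O) :
    ContinuousOn (fun s => pullOneForm η l s 1) (Icc 0 1) :=
  have hl' : ContinuousOn (fderiv ℝ l) (Icc 0 1) := fun s hs =>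
    ((hl s hs).fderiv_right (m := 0) (by simp)).continuousAt.continuousWithinAt
  ((hη.comp (fun s hs => (hl s hs).continuousAt.continuousWithinAt) hmaps).clm_comp
    hl').clm_apply continuousOn_const

theorem lineIntegral_eq_of_extDerivOne_eq {O : Set Q} (hO : IsOpen O) (hconv : Convex ℝ O)
    (hη : DifferentiableOn ℝ η O) (hη' : DifferentiableOn ℝ η' O)
    (hd : ∀ q ∈ O, ∀ v w, extDerivOne η q v w = extDerivOne η' q v w) {l : ℝ → Q}
    (hl : ∀ s ∈ Icc (0 : ℝ) 1, ContDiffAt ℝ 1 l s) (hmaps : MapsTo l (Icc 0 1) O)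
    (h01 : l 0 = l 1) : lineIntegral η l = lineIntegral η' l := by
  obtain ⟨φ, hφ⟩ := hconv.exists_forall_hasFDerivAt_of_fderiv_symmetric hO (hη.sub hη')
    fun q hq v w => by
      rw [fderiv_sub (hη.differentiableAt (hO.mem_nhds hq))
        (hη'.differentiableAt (hO.mem_nhds hq))]
      have hdq := hd q hq v w
      simp only [extDerivOne] at hdq
      simp only [sub_apply]
      linarith
  have hint := (continuousOn_pullOneForm_apply_one hη.continuousOn hl
    hmaps).intervalIntegrable_of_Icc (μ := volume) zero_le_one
  have hint' := (continuousOn_pullOneForm_apply_one hη'.continuousOn hl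
    hmaps).intervalIntegrable_of_Icc (μ := volume) zero_le_one
  have hderiv : ∀ s ∈ uIcc (0 : ℝ) 1, HasDerivAt (fun s => φ (l s))
      (pullOneForm η l s 1 - pullOneForm η' l s 1) s := fun s hs => by
    rw [uIcc_of_le zero_le_one] at hs
    exact hasDerivAt_comp_pullOneForm (hφ (l s) (hmaps hs))
      ((hl s hs).differentiableAt one_ne_zero)
  rw [← sub_eq_zero, lineIntegral, lineIntegral, ← intervalIntegral.integral_sub hint hint',
    intervalIntegral.integral_eq_sub_of_hasDerivAt hderiv (hint.sub hint'), h01, sub_self]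

end OneForms

section Homotopy

variable {Y : Type*} [NormedAddCommGroup Y] [NormedSpace ℝ Y] {η : ℝ × Y → ℝ × Y →L[ℝ] ℝ}
  {U : Set (ℝ × Y)} {y : Y}

theorem integral_fderiv_time_eq_sub (hU : IsOpen U) (hη : ContDiffOn ℝ 1 η U)
    (hy : ∀ s ∈ Icc (0 : ℝ) 1, (s, y) ∈ U) :
    ∫ s in (0 : ℝ)..1, (fderiv ℝ η (s, y) (1, 0)).comp (ContinuousLinearMap.inr ℝ ℝ Y) =
      (η (1, y) - η (0, y)).comp (ContinuousLinearMap.inr ℝ ℝ Y) := by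
  have hderiv : ∀ s ∈ uIcc (0 : ℝ) 1,
      HasDerivAt (fun r => (η (r, y)).comp (ContinuousLinearMap.inr ℝ ℝ Y))
        ((fderiv ℝ η (s, y) (1, 0)).comp (ContinuousLinearMap.inr ℝ ℝ Y)) s := fun s hs => by
    rw [uIcc_of_le zero_le_one] at hs
    have hηs : HasFDerivAt η (fderiv ℝ η (s, y)) (s, y) :=
      ((hη.contDiffAt (hU.mem_nhds (hy s hs))).differentiableAt one_ne_zero).hasFDerivAt
    have hslice : HasDerivAt (fun r => η (r, y)) (fderiv ℝ η (s, y) (1, 0)) s :=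
      HasFDerivAt.comp_hasDerivAt (l := η) (f := fun r : ℝ => (r, y)) s hηs
        ((hasDerivAt_id s).prodMk (hasDerivAt_const s y))
    exact (ContinuousLinearMap.precomp ℝ
      (ContinuousLinearMap.inr ℝ ℝ Y)).hasFDerivAt.comp_hasDerivAt s hslice
  have hcont : ContinuousOn (fun s => (fderiv ℝ η (s, y) (1, 0)).comp
      (ContinuousLinearMap.inr ℝ ℝ Y)) (uIcc 0 1) := by
    rw [uIcc_of_le zero_le_one]
    exact ((((hη.continuousOn_fderiv_of_isOpen hU le_rfl).comp (f := fun s : ℝ => (s, y))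
      (by fun_prop) hy).clm_apply continuousOn_const).clm_comp continuousOn_const)
  rw [intervalIntegral.integral_eq_sub_of_hasDerivAt hderiv hcont.intervalIntegrable,
    ContinuousLinearMap.sub_comp]

theorem fderivSnd_contraction {s : ℝ} (hη : DifferentiableAt ℝ η (s, y)) {L : Y →L[ℝ] ℝ}
    (hL : ∀ w, extDerivOne η (s, y) (1, 0) (0, w) = L w) :
    fderivSnd (fun q => η q (1, 0)) (s, y) =
      (fderiv ℝ η (s, y) (1, 0)).comp (ContinuousLinearMap.inr ℝ ℝ Y) - L := by
  ext w
  have hw := hL w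
  rw [extDerivOne] at hw
  have hg : fderivSnd (fun q => η q (1, 0)) (s, y) w = fderiv ℝ η (s, y) (0, w) (1, 0) :=
    fderiv_oneForm_apply hη (1, 0) (0, w)
  rw [hg, sub_apply, ← hw]
  exact (sub_sub_cancel _ _).symm

-- Cartan's homotopy formula for a `1`-form.
theorem hasFDerivAt_integral_contraction {O : Set Y} (hO : IsOpen O) (hU : IsOpen U)
    (hOU : Icc 0 1 ×ˢ O ⊆ U) (hη : ContDiffOn ℝ 1 η U) (hy : y ∈ O) {θ : ℝ → Y →L[ℝ] ℝ}
    (hθ : ContinuousOn θ (Icc 0 1))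
    (hdη : ∀ s ∈ Icc (0 : ℝ) 1, ∀ w, extDerivOne η (s, y) (1, 0) (0, w) = θ s w) :
    HasFDerivAt (fun z => ∫ s in (0 : ℝ)..1, η (s, z) (1, 0))
      ((η (1, y) - η (0, y)).comp (ContinuousLinearMap.inr ℝ ℝ Y) - ∫ s in (0 : ℝ)..1, θ s) y := by
  have hslice : ∀ s ∈ Icc (0 : ℝ) 1, (s, y) ∈ U := fun s hs => hOU ⟨hs, hy⟩
  have hcont : ContinuousOn (fun s => (fderiv ℝ η (s, y) (1, 0)).comp
      (ContinuousLinearMap.inr ℝ ℝ Y)) (Icc 0 1) :=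
    (((hη.continuousOn_fderiv_of_isOpen hU le_rfl).comp (f := fun s : ℝ => (s, y))
      (by fun_prop) hslice).clm_apply continuousOn_const).clm_comp continuousOn_const
  have hsnd : ∀ s ∈ uIcc (0 : ℝ) 1, fderivSnd (fun q => η q (1, 0)) (s, y) =
      (fderiv ℝ η (s, y) (1, 0)).comp (ContinuousLinearMap.inr ℝ ℝ Y) - θ s := fun s hs => by
    rw [uIcc_of_le zero_le_one] at hs
    exact fderivSnd_contraction ((hη.contDiffAt
      (hU.mem_nhds (hslice s hs))).differentiableAt one_ne_zero) (hdη s hs)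
  have hderiv := hasFDerivAt_parametric_integral hO hU hOU
    (hη.clm_apply (contDiffOn_const (c := ((1 : ℝ), (0 : Y))))) hy
  rwa [intervalIntegral.integral_congr hsnd, intervalIntegral.integral_sub
    (hcont.intervalIntegrable_of_Icc zero_le_one) (hθ.intervalIntegrable_of_Icc zero_le_one),
    integral_fderiv_time_eq_sub hU hη hslice] at hderiv

end Homotopy

section Poincare

universe u

variable {E : Type u} [NormedAddCommGroup E] [NormedSpace ℝ E]
  {σ : E → E →L[ℝ] E →L[ℝ] ℝ} {O : Set E} {c : E}

/-- The contraction at time `s` of the pullback of the `2`-form `σ` by `(s, y) ↦ c + s • (y - c)`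
with the vector field `∂/∂s`. -/
def radialContraction (σ : E → E →L[ℝ] E →L[ℝ] ℝ) (c : E) (q : ℝ × E) : E →L[ℝ] ℝ :=
  q.1 • σ (c + q.1 • (q.2 - c)) (q.2 - c)

theorem isOpen_preimage_radial (hO : IsOpen O) :
    IsOpen ((fun q : ℝ × E => c + q.1 • (q.2 - c)) ⁻¹' O) :=
  hO.preimage (by fun_prop)

theorem Icc_prod_subset_preimage_radial (hconv : Convex ℝ O) (hc : c ∈ O) :
    Icc 0 1 ×ˢ O ⊆ (fun q : ℝ × E => c + q.1 • (q.2 - c)) ⁻¹' O :=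
  fun _ hq => hconv.add_smul_sub_mem hc hq.2 hq.1

theorem contDiffOn_radialContraction (hσ : ContDiffOn ℝ ∞ σ O) :
    ContDiffOn ℝ ∞ (radialContraction σ c) ((fun q : ℝ × E => c + q.1 • (q.2 - c)) ⁻¹' O) :=
  contDiffOn_fst.smul ((hσ.comp (g := σ) (f := fun q : ℝ × E => c + q.1 • (q.2 - c))
    (by fun_prop) fun _ hq => hq).clm_apply (by fun_prop))

theorem fderiv_radialContraction_apply {s : ℝ} {y : E}
    (hσ : DifferentiableAt ℝ σ (c + s • (y - c))) (v w : E) :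
    fderiv ℝ (radialContraction σ c) (s, y) (0, v) w =
      s ^ 2 * fderiv ℝ σ (c + s • (y - c)) v (y - c) w + s * σ (c + s • (y - c)) v w := by
  have hcone : HasFDerivAt (fun z => c + s • (z - c)) (s • ContinuousLinearMap.id ℝ E) y :=
    (((hasFDerivAt_id y).sub_const c).const_smul s).const_add c
  have hslice := ((HasFDerivAt.comp (g := σ) y hσ.hasFDerivAt hcone).clm_apply
    ((hasFDerivAt_id y).sub_const c)).const_smul s
  have hq : DifferentiableAt ℝ (radialContraction σ c) (s, y) := by
    have hcone' : DifferentiableAt ℝ (fun q : ℝ × E => c + q.1 • (q.2 - c)) (s, y) := by fun_prop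
    have hray : DifferentiableAt ℝ (fun q : ℝ × E => q.2 - c) (s, y) := by fun_prop
    exact differentiableAt_fst.smul
      ((DifferentiableAt.comp (g := σ) (s, y) hσ hcone').clm_apply hray)
  have happly := congrArg (fun L : E →L[ℝ] E →L[ℝ] ℝ => L v w)
    ((hq.hasFDerivAt.comp y (hasFDerivAt_prodMk_right s y)).unique hslice)
  simp only [ContinuousLinearMap.comp_apply, ContinuousLinearMap.inr_apply,
    ContinuousLinearMap.comp_id, ContinuousLinearMap.comp_smulₛₗ, Real.ringHom_apply,
    ContinuousLinearMap.flip_smul, smul_apply, smul_add, add_apply,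
    ContinuousLinearMap.flip_apply, smul_eq_mul, Function.comp_apply, id_eq] at happly
  rw [happly]
  simp only [map_sub, sub_apply]
  ring

theorem hasDerivAt_sq_mul_radial {s : ℝ} {y : E} (hσ : DifferentiableAt ℝ σ (c + s • (y - c)))
    (hclosed : IsClosedTwoFormAt σ (c + s • (y - c))) (hswap : ∀ z v w, σ z v w = -σ z w v)
    (v w : E) :
    HasDerivAt (fun s => s ^ 2 * σ (c + s • (y - c)) v w)
      (fderiv ℝ (radialContraction σ c) (s, y) (0, v) w -
        fderiv ℝ (radialContraction σ c) (s, y) (0, w) v) s := by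
  have hray : HasDerivAt (fun s => c + s • (y - c)) (y - c) s := by
    simpa using ((hasDerivAt_id s).smul_const (y - c)).const_add c
  have hσray := ((HasFDerivAt.comp_hasDerivAt (l := σ) s hσ.hasFDerivAt hray).clm_apply
    (hasDerivAt_const s v)).clm_apply (hasDerivAt_const s w)
  refine ((hasDerivAt_pow 2 s).mul hσray).congr_deriv ?_
  rw [fderiv_radialContraction_apply hσ, fderiv_radialContraction_apply hσ, hswap _ w v]
  have hd := hclosed (y - c) v w
  simp only [map_sub, sub_apply] at hd
  simp
  linear_combination (s ^ 2) * hd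

theorem exists_extDerivOne_eq (hO : IsOpen O) (hconv : Convex ℝ O) (hσ : ContDiffOn ℝ ∞ σ O)
    (hclosed : ∀ y ∈ O, IsClosedTwoFormAt σ y) (hswap : ∀ y v w, σ y v w = -σ y w v) :
    ∃ lam : E → E →L[ℝ] ℝ, ContDiffOn ℝ ∞ lam O ∧
      ∀ y ∈ O, ∀ v w, extDerivOne lam y v w = σ y v w := by
  rcases O.eq_empty_or_nonempty with rfl | ⟨c, hc⟩
  · exact ⟨0, contDiffOn_empty, fun _ hy => hy.elim⟩
  have hU := isOpen_preimage_radial (c := c) hO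
  have hOU := Icc_prod_subset_preimage_radial hconv hc
  have hg : ContDiffOn ℝ ∞ (radialContraction σ c) _ := contDiffOn_radialContraction hσ
  refine ⟨fun y => ∫ s in (0 : ℝ)..1, radialContraction σ c (s, y),
    contDiffOn_parametric_integral hO hU hOU hg, fun y hy v w => ?_⟩
  have hcont : ∀ v, ContinuousOn (fun s => fderiv ℝ (radialContraction σ c) (s, y) (0, v))
      (Icc 0 1) := fun v =>
    ((hg.continuousOn_fderiv_of_isOpen hU (by simp)).comp (f := fun s : ℝ => (s, y))
      (by fun_prop) fun s hs => hOU ⟨hs, hy⟩).clm_apply continuousOn_const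
  have hint : ∀ v w, IntervalIntegrable
      (fun s => fderiv ℝ (radialContraction σ c) (s, y) (0, v) w) volume 0 1 := fun v w =>
    ((hcont v).clm_apply continuousOn_const).intervalIntegrable_of_Icc zero_le_one
  have hfderiv : ∀ v w, fderiv ℝ (fun y => ∫ s in (0 : ℝ)..1, radialContraction σ c (s, y)) y v w =
      ∫ s in (0 : ℝ)..1, fderiv ℝ (radialContraction σ c) (s, y) (0, v) w := fun v w => by
    rw [fderiv_parametric_integral_apply hO hU hOU (hg.of_le ENat.LEInfty.out) hy,
      ContinuousLinearMap.intervalIntegral_apply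
        ((hcont v).intervalIntegrable_of_Icc zero_le_one)]
  have hderiv : ∀ s ∈ uIcc (0 : ℝ) 1, HasDerivAt (fun s => s ^ 2 * σ (c + s • (y - c)) v w)
      (fderiv ℝ (radialContraction σ c) (s, y) (0, v) w -
        fderiv ℝ (radialContraction σ c) (s, y) (0, w) v) s := fun s hs => by
    rw [uIcc_of_le zero_le_one] at hs
    have hmem : c + s • (y - c) ∈ O := hOU (⟨hs, hy⟩ : (s, y) ∈ Icc 0 1 ×ˢ O)
    exact hasDerivAt_sq_mul_radial ((hσ.contDiffAt (hO.mem_nhds hmem)).differentiableAt (by simp))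
      (hclosed _ hmem) hswap v w
  rw [extDerivOne, hfderiv, hfderiv, ← intervalIntegral.integral_sub (hint v w) (hint w v),
    intervalIntegral.integral_eq_sub_of_hasDerivAt hderiv ((hint v w).sub (hint w v))]
  simp

end Poincare

/-! ### Loops close to the identity -/

section ChartPrimitive

variable {E : Type*} [NormedAddCommGroup E] [NormedSpace ℝ E]
  {M : Type*} [TopologicalSpace M] [ChartedSpace E M]

/-- The preimage in `M` of the ball of radius `r` about `x₀` in the chart at `x₀`. -/
def chartBall (E : Type*) [NormedAddCommGroup E] [NormedSpace ℝ E]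
    {M : Type*} [TopologicalSpace M] [ChartedSpace E M] (x₀ : M) (r : ℝ) : Set M :=
  (extChartAt 𝓘(ℝ, E) x₀).source ∩
    extChartAt 𝓘(ℝ, E) x₀ ⁻¹' Metric.ball (extChartAt 𝓘(ℝ, E) x₀ x₀) r

theorem isOpen_chartBall (x₀ : M) (r : ℝ) : IsOpen (chartBall E x₀ r) :=
  isOpen_extChartAt_preimage' x₀ Metric.isOpen_ball

theorem mem_chartBall_self (x₀ : M) {r : ℝ} (hr : 0 < r) : x₀ ∈ chartBall E x₀ r :=
  ⟨mem_extChartAt_source x₀, Metric.mem_ball_self hr⟩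

theorem mapsTo_chart_symm_chartBall {x₀ : M} {r : ℝ}
    (h : Metric.ball (extChartAt 𝓘(ℝ, E) x₀ x₀) r ⊆ (extChartAt 𝓘(ℝ, E) x₀).target) :
    MapsTo (extChartAt 𝓘(ℝ, E) x₀).symm (Metric.ball (extChartAt 𝓘(ℝ, E) x₀ x₀) r)
      (chartBall E x₀ r) := fun y hy =>
  ⟨(extChartAt 𝓘(ℝ, E) x₀).map_target (h hy), by
    rwa [mem_preimage, (extChartAt 𝓘(ℝ, E) x₀).right_inv (h hy)]⟩

theorem exists_chartBall_subset (x₀ : M) {O : Set M} (hO : O ∈ 𝓝 x₀) :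
    ∃ r > 0, Metric.ball (extChartAt 𝓘(ℝ, E) x₀ x₀) r ⊆ (extChartAt 𝓘(ℝ, E) x₀).target ∧
      chartBall E x₀ r ⊆ O := by
  have hpre : (extChartAt 𝓘(ℝ, E) x₀).symm ⁻¹' O ∈ 𝓝 (extChartAt 𝓘(ℝ, E) x₀ x₀) :=
    (continuousAt_extChartAt_symm x₀).preimage_mem_nhds (by rwa [extChartAt_to_inv x₀])
  obtain ⟨r, hr, h⟩ := Metric.mem_nhds_iff.1 (inter_mem (extChartAt_target_mem_nhds x₀) hpre)
  refine ⟨r, hr, fun y hy => (h hy).1, fun x hx => ?_⟩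
  have hmem := (h hx.2).2
  rwa [mem_preimage, (extChartAt 𝓘(ℝ, E) x₀).left_inv hx.1] at hmem

/-- A `1`-form `lam` on the ball of radius `r` in the chart at `x₀` whose exterior derivative is
the symplectic form. -/
structure IsChartPrimitive (Ω : SymplecticForm E M) (x₀ : M) (r : ℝ) (lam : E → E →L[ℝ] ℝ) :
    Prop where
  smooth : ContDiffOn ℝ ∞ lam (Metric.ball (extChartAt 𝓘(ℝ, E) x₀ x₀) r)
  extDerivOne_eq : ∀ y ∈ Metric.ball (extChartAt 𝓘(ℝ, E) x₀ x₀) r, ∀ v w,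
    extDerivOne lam y v w = Ω.pull (extChartAt 𝓘(ℝ, E) x₀).symm y v w

/-- The integral along the path `l` of the `1`-form given in the chart at `x₀` by `lam`. -/
def chartPathIntegral (lam : E → E →L[ℝ] ℝ) (x₀ : M) (l : ℝ → M) : ℝ :=
  lineIntegral lam fun s => extChartAt 𝓘(ℝ, E) x₀ (l s)

variable [IsManifold 𝓘(ℝ, E) ∞ M] {Ω : SymplecticForm E M}
  {P : Type*} [NormedAddCommGroup P] [NormedSpace ℝ P]

theorem exists_isChartPrimitive (Ω : SymplecticForm E M) (x₀ : M) {r : ℝ}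
    (h : Metric.ball (extChartAt 𝓘(ℝ, E) x₀ x₀) r ⊆ (extChartAt 𝓘(ℝ, E) x₀).target) :
    ∃ lam, IsChartPrimitive Ω x₀ r lam := by
  have hsymm : ContMDiffOn 𝓘(ℝ, E) 𝓘(ℝ, E) ∞ (extChartAt 𝓘(ℝ, E) x₀).symm
    (Metric.ball (extChartAt 𝓘(ℝ, E) x₀ x₀) r) := (contMDiffOn_extChartAt_symm x₀).mono h
  obtain ⟨lam, hsmooth, hd⟩ := exists_extDerivOne_eq Metric.isOpen_ball (convex_ball _ r)
    (Ω.contDiffOn_pull Metric.isOpen_ball hsymm)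
    (fun y hy => Ω.isClosedTwoFormAt_pull
      ((hsymm y hy).contMDiffAt (Metric.isOpen_ball.mem_nhds hy)))
    (Ω.pull_swap _)
  exact ⟨lam, hsmooth, hd⟩

theorem SymplecticForm.pull_eq_pull_chart_symm {u : P → M} {p : P}
    (hu : MDifferentiableAt 𝓘(ℝ, P) 𝓘(ℝ, E) u p) {x₀ : M}
    (hx : u p ∈ (extChartAt 𝓘(ℝ, E) x₀).source) (v w : P) :
    Ω.pull u p v w = Ω.pull (extChartAt 𝓘(ℝ, E) x₀).symm (extChartAt 𝓘(ℝ, E) x₀ (u p))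
      (fderiv ℝ (fun q => extChartAt 𝓘(ℝ, E) x₀ (u q)) p v)
      (fderiv ℝ (fun q => extChartAt 𝓘(ℝ, E) x₀ (u q)) p w) := by
  rw [pull, pull, altToBilin_apply, altToBilin_apply, Ω.pullForm_eq_chartForm hu hx]
  refine congrArg (chartForm Ω.form x₀ (extChartAt 𝓘(ℝ, E) x₀ (u p))) (funext fun i => ?_)
  fin_cases i <;> rfl

namespace IsChartPrimitive

variable {x₀ : M} {r : ℝ} {lam : E → E →L[ℝ] ℝ}

theorem contDiffOn_pullOneForm (h : IsChartPrimitive Ω x₀ r lam) {u : P → M} {O : Set P}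
    (hO : IsOpen O) (hu : ContMDiffOn 𝓘(ℝ, P) 𝓘(ℝ, E) ∞ u O)
    (hmaps : MapsTo u O (chartBall E x₀ r)) :
    ContDiffOn ℝ ∞ (pullOneForm lam fun q => extChartAt 𝓘(ℝ, E) x₀ (u q)) O :=
  _root_.contDiffOn_pullOneForm hO h.smooth
    (fun p hp => (contDiffAt_extChartAt_comp ((hu p hp).contMDiffAt (hO.mem_nhds hp))
      (hmaps hp).1).contDiffWithinAt) fun _ hp => (hmaps hp).2

theorem extDerivOne_pullOneForm (h : IsChartPrimitive Ω x₀ r lam) {u : P → M} {p : P}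
    (hu : ContMDiffAt 𝓘(ℝ, P) 𝓘(ℝ, E) ∞ u p) (hp : u p ∈ chartBall E x₀ r) (v w : P) :
    extDerivOne (pullOneForm lam fun q => extChartAt 𝓘(ℝ, E) x₀ (u q)) p v w =
      Ω.pull u p v w := by
  have hlam := (h.smooth.contDiffAt (Metric.isOpen_ball.mem_nhds hp.2)).differentiableAt (by simp)
  rw [_root_.extDerivOne_pullOneForm (g := fun q => extChartAt 𝓘(ℝ, E) x₀ (u q)) hlam
    ((contDiffAt_extChartAt_comp hu hp.1).of_le ENat.LEInfty.out), h.extDerivOne_eq _ hp.2,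
    Ω.pull_eq_pull_chart_symm (hu.mdifferentiableAt (by simp)) hp.1]

theorem chartPathIntegral_eq_lineIntegral {b : M} {l : ℝ → M}
    (hl : ∀ s ∈ Icc (0 : ℝ) 1, ContMDiffAt 𝓘(ℝ, ℝ) 𝓘(ℝ, E) ∞ l s)
    (hsource : ∀ s ∈ Icc (0 : ℝ) 1, l s ∈ (extChartAt 𝓘(ℝ, E) x₀).source)
    (hb : ∀ s ∈ Icc (0 : ℝ) 1, l s ∈ (extChartAt 𝓘(ℝ, E) b).source) :
    chartPathIntegral lam x₀ l = lineIntegral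
      (pullOneForm lam fun q => extChartAt 𝓘(ℝ, E) x₀ ((extChartAt 𝓘(ℝ, E) b).symm q))
      (fun s => extChartAt 𝓘(ℝ, E) b (l s)) := by
  set c := extChartAt 𝓘(ℝ, E) b
  refine intervalIntegral.integral_congr fun s hs => ?_
  rw [uIcc_of_le zero_le_one] at hs
  have hchange : (fun r => extChartAt 𝓘(ℝ, E) x₀ (l r)) =ᶠ[𝓝 s]
      fun r => extChartAt 𝓘(ℝ, E) x₀ (c.symm (c (l r))) := by
    filter_upwards [(hl s hs).continuousAt.eventually
      (extChartAt_source_mem_nhds' (I := 𝓘(ℝ, E)) (hb s hs))] with z hz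
    rw [c.left_inv hz]
  have hsymm : ContMDiffAt 𝓘(ℝ, E) 𝓘(ℝ, E) ∞ c.symm (c (l s)) :=
    (contMDiffOn_extChartAt_symm b).contMDiffAt
      ((isOpen_extChartAt_target b).mem_nhds (c.map_source (hb s hs)))
  have htransition := contDiffAt_extChartAt_comp hsymm (x₀ := x₀)
    (by rw [c.left_inv (hb s hs)]; exact hsource s hs)
  have hpull := pullOneForm_comp (η := lam)
    (g := fun q => extChartAt 𝓘(ℝ, E) x₀ (c.symm q)) (k := fun r => c (l r))
    (htransition.differentiableAt (by simp))
    ((contDiffAt_extChartAt_comp (hl s hs) (hb s hs)).differentiableAt (by simp))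
  exact congrArg (fun L : ℝ →L[ℝ] ℝ => L 1) ((pullOneForm_congr hchange).trans hpull)

theorem chartPathIntegral_eq {a a' b : M} {r r' δ : ℝ} {lam lam' : E → E →L[ℝ] ℝ}
    (h : IsChartPrimitive Ω a r lam) (h' : IsChartPrimitive Ω a' r' lam')
    (hb : Metric.ball (extChartAt 𝓘(ℝ, E) b b) δ ⊆ (extChartAt 𝓘(ℝ, E) b).target)
    (hsub : chartBall E b δ ⊆ chartBall E a r) (hsub' : chartBall E b δ ⊆ chartBall E a' r')
    {l : ℝ → M} (hl : ∀ s ∈ Icc (0 : ℝ) 1, ContMDiffAt 𝓘(ℝ, ℝ) 𝓘(ℝ, E) ∞ l s) (h01 : l 0 = l 1)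
    (hlb : ∀ s ∈ Icc (0 : ℝ) 1, l s ∈ chartBall E b δ) :
    chartPathIntegral lam a l = chartPathIntegral lam' a' l := by
  have hball := Metric.isOpen_ball (x := extChartAt 𝓘(ℝ, E) b b) (ε := δ)
  have hsymm := (contMDiffOn_extChartAt_symm (I := 𝓘(ℝ, E)) (n := ∞) b).mono hb
  have hmaps := mapsTo_chart_symm_chartBall hb
  rw [chartPathIntegral_eq_lineIntegral hl (fun s hs => (hsub (hlb s hs)).1)
      fun s hs => (hlb s hs).1,
    chartPathIntegral_eq_lineIntegral hl (fun s hs => (hsub' (hlb s hs)).1)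
      fun s hs => (hlb s hs).1]
  refine lineIntegral_eq_of_extDerivOne_eq hball (convex_ball _ δ)
    ((h.contDiffOn_pullOneForm hball hsymm fun y hy => hsub (hmaps hy)).differentiableOn (by simp))
    ((h'.contDiffOn_pullOneForm hball hsymm
      fun y hy => hsub' (hmaps hy)).differentiableOn (by simp))
    (fun y hy v w => ?_)
    (fun s hs => (contDiffAt_extChartAt_comp (hl s hs) (hlb s hs).1).of_le ENat.LEInfty.out)
    (fun s hs => (hlb s hs).2) (congrArg _ h01)
  have hsymm_y := (hsymm y hy).contMDiffAt (hball.mem_nhds hy)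
  rw [h.extDerivOne_pullOneForm hsymm_y (hsub (hmaps hy)),
    h'.extDerivOne_pullOneForm hsymm_y (hsub' (hmaps hy))]

theorem hasFDerivAt_chartPathIntegral (h : IsChartPrimitive Ω x₀ r lam) {p : ℝ → Equiv.Perm M}
    (hp : SmoothFamily E p) (h01 : p 0 = p 1) (b : M) {O : Set E} (hO : IsOpen O)
    (hOt : O ⊆ (extChartAt 𝓘(ℝ, E) b).target)
    (hmaps : ∀ s ∈ Icc (0 : ℝ) 1, ∀ y ∈ O, p s ((extChartAt 𝓘(ℝ, E) b).symm y) ∈ chartBall E x₀ r)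
    {y : E} (hy : y ∈ O) :
    HasFDerivAt (fun z => chartPathIntegral lam x₀
      (fun s => p s ((extChartAt 𝓘(ℝ, E) b).symm z)))
      (-∫ s in (0 : ℝ)..1, chartFlux Ω p b (s, y)) y := by
  set u := chartFamily E p b
  set D := (univ : Set ℝ) ×ˢ (extChartAt 𝓘(ℝ, E) b).target
  have hD : IsOpen D := isOpen_univ_prod_chart_target b
  have huD : ContMDiffOn 𝓘(ℝ, ℝ × E) 𝓘(ℝ, E) ∞ u D := hp.contMDiffOn_chartFamily b
  set U := D ∩ u ⁻¹' chartBall E x₀ r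
  have hU : IsOpen U := huD.continuousOn.isOpen_inter_preimage hD (isOpen_chartBall x₀ r)
  have hu : ∀ q ∈ U, ContMDiffAt 𝓘(ℝ, ℝ × E) 𝓘(ℝ, E) ∞ u q := fun q hq =>
    (huD q hq.1).contMDiffAt (hD.mem_nhds hq.1)
  have hOU : Icc (0 : ℝ) 1 ×ˢ O ⊆ U := fun q hq =>
    ⟨⟨mem_univ _, hOt hq.2⟩, hmaps q.1 hq.1 q.2 hq.2⟩
  have hcu : ∀ q ∈ U, DifferentiableAt ℝ (fun q => extChartAt 𝓘(ℝ, E) x₀ (u q)) q := fun q hq =>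
    (contDiffAt_extChartAt_comp (hu q hq) hq.2.1).differentiableAt (by simp)
  set η : ℝ × E → ℝ × E →L[ℝ] ℝ := pullOneForm lam fun q => extChartAt 𝓘(ℝ, E) x₀ (u q)
  have hη : ContDiffOn ℝ ∞ η U :=
    h.contDiffOn_pullOneForm hU (huD.mono inter_subset_left) fun q hq => hq.2
  have htime : ∀ z ∈ O, chartPathIntegral lam x₀
      (fun s => p s ((extChartAt 𝓘(ℝ, E) b).symm z)) = ∫ s in (0 : ℝ)..1, η (s, z) (1, 0) :=
    fun z hz => intervalIntegral.integral_congr fun s hs => by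
      rw [uIcc_of_le zero_le_one] at hs
      exact pullOneForm_slice_fst (hcu (s, z) (hOU ⟨hs, hz⟩))
  have hspace : ∀ s ∈ Icc (0 : ℝ) 1, (η (s, y)).comp (ContinuousLinearMap.inr ℝ ℝ E) =
      pullOneForm lam (fun z => extChartAt 𝓘(ℝ, E) x₀ (p s ((extChartAt 𝓘(ℝ, E) b).symm z))) y :=
    fun s hs => (pullOneForm_slice_snd (hcu (s, y) (hOU ⟨hs, hy⟩))).symm
  have hflux : ContinuousOn (fun s => chartFlux Ω p b (s, y)) (Icc 0 1) :=
    (hp.contDiffOn_chartFlux b).continuousOn.comp (f := fun s : ℝ => (s, y)) (by fun_prop)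
      fun s _ => ⟨mem_univ s, hOt hy⟩
  have hderiv := hasFDerivAt_integral_contraction hO hU hOU (hη.of_le ENat.LEInfty.out) hy hflux
    fun s hs w => (h.extDerivOne_pullOneForm (hu _ (hOU ⟨hs, hy⟩)) (hOU ⟨hs, hy⟩).2 _ _).trans
      (hp.pull_chartFamily_time_space b s (hOt hy) w)
  rw [ContinuousLinearMap.sub_comp, hspace 0 (by simp), hspace 1 (by simp), h01, sub_self,
    zero_sub] at hderiv
  exact hderiv.congr_of_eventuallyEq (mem_of_superset (hO.mem_nhds hy) htime)

end IsChartPrimitive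

end ChartPrimitive

section SmallLoops

variable {E : Type*} [NormedAddCommGroup E] [NormedSpace ℝ E]
  {M : Type*} [TopologicalSpace M] [ChartedSpace E M]

theorem exists_chartBall_refinement [CompactSpace M] [T2Space M] {r : M → ℝ}
    (hr : ∀ x, 0 < r x) :
    ∃ (a b : M → M) (δ : M → ℝ) (V : Set (M × M)), IsOpen V ∧ (∀ x, (x, x) ∈ V) ∧
      (∀ z, Metric.ball (extChartAt 𝓘(ℝ, E) z z) (δ z) ⊆ (extChartAt 𝓘(ℝ, E) z).target) ∧
      (∀ x y, (x, y) ∈ V → y ∈ chartBall E (b x) (δ (b x))) ∧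
      ∀ x₀, ∀ᶠ x in 𝓝 x₀, chartBall E (b x) (δ (b x)) ⊆ chartBall E (a x₀) (r (a x₀)) := by
  let _ : UniformSpace M := uniformSpaceOfCompactR1
  obtain ⟨V₁, hV₁, hcover₁⟩ := lebesgue_number_lemma (K := (univ : Set M)) isCompact_univ
    (fun x₀ : M => isOpen_chartBall (E := E) x₀ (r x₀))
    (fun x _ => mem_iUnion.2 ⟨x, mem_chartBall_self x (hr x)⟩)
  choose a ha using fun x => hcover₁ x (mem_univ x)
  obtain ⟨V₂, hV₂, -, hV₂₁⟩ := comp_symm_mem_uniformity_sets hV₁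
  obtain ⟨V₃, hV₃, hsymm, hV₃₂⟩ := comp_symm_mem_uniformity_sets hV₂
  choose δ hδ hδt hδV using fun z : M =>
    exists_chartBall_subset (E := E) z (UniformSpace.ball_mem_nhds z hV₃)
  obtain ⟨V₄, hV₄, hcover₄⟩ := lebesgue_number_lemma (K := (univ : Set M)) isCompact_univ
    (fun z : M => isOpen_chartBall (E := E) z (δ z))
    (fun x _ => mem_iUnion.2 ⟨x, mem_chartBall_self x (hδ x)⟩)
  choose b hb using fun x => hcover₄ x (mem_univ x)
  have hclose : ∀ x, ∀ y ∈ chartBall E (b x) (δ (b x)), (x, y) ∈ V₂ := fun x y hy =>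
    hV₃₂ ⟨b x, hsymm.symm _ _ (hδV (b x) (hb x (UniformSpace.mem_ball_self x hV₄))),
      hδV (b x) hy⟩
  refine ⟨a, b, δ, interior V₄, isOpen_interior,
    fun x => refl_mem_uniformity (interior_mem_uniformity hV₄), hδt,
    fun x y hxy => hb x (show (x, y) ∈ V₄ from interior_subset hxy), fun x₀ => ?_⟩
  filter_upwards [UniformSpace.ball_mem_nhds x₀ hV₂] with x hx y hy
  exact ha x₀ (hV₂₁ ⟨x, hx, hclose x y hy⟩)

/-- The total flux of the path `p`, the integral of its flux forms over the time interval
`[0, 1]`, is an exact `1`-form. -/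
def HasExactFlux (Ω : SymplecticForm E M) (p : ℝ → Equiv.Perm M) : Prop :=
  ∃ A : M → ℝ, IsPotential A fun x => ∫ s in (0 : ℝ)..1, fluxForm Ω p s x

theorem intervalIntegral_clm_comp_const {θ : ℝ → E →L[ℝ] ℝ} (hθ : Continuous θ) (L : E →L[ℝ] E)
    (l u : ℝ) : ∫ s in l..u, (θ s).comp L = (∫ s in l..u, θ s).comp L :=
  (ContinuousLinearMap.precomp ℝ L).intervalIntegral_comp_comm (hθ.intervalIntegrable l u)

variable [IsManifold 𝓘(ℝ, E) ∞ M] {Ω : SymplecticForm E M} {p : ℝ → Equiv.Perm M}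

theorem SmoothFamily.continuous_chartFlux (hp : SmoothFamily E p) (x₀ : M) {y : E}
    (hy : y ∈ (extChartAt 𝓘(ℝ, E) x₀).target) : Continuous fun s => chartFlux Ω p x₀ (s, y) :=
  continuousOn_univ.1 <| (hp.contDiffOn_chartFlux x₀).continuousOn.comp
    (f := fun s : ℝ => (s, y)) (by fun_prop) fun s _ => ⟨mem_univ s, hy⟩

theorem SmoothFamily.continuous_fluxForm (hp : SmoothFamily E p) (x : M) :
    Continuous fun s => fluxForm Ω p s x := by
  set c := extChartAt 𝓘(ℝ, E) x
  let dc : E →L[ℝ] E := mfderiv 𝓘(ℝ, E) 𝓘(ℝ, E) c x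
  have hdc : (chartInvDeriv E x (c x)).comp dc = .id ℝ E :=
    chartInvDeriv_comp_mfderiv_chart x (mem_extChartAt_source x)
  have hchart : ∀ s, (chartFlux Ω p x (s, c x)).comp dc = fluxForm Ω p s x := fun s => by
    rw [chartFlux, ContinuousLinearMap.comp_assoc, hdc, ContinuousLinearMap.comp_id,
      extChartAt_to_inv x]
  exact ((hp.continuous_chartFlux x (mem_extChartAt_target x)).clm_comp
    continuous_const).congr hchart

theorem SmoothFamily.integral_chartFlux_comp (hp : SmoothFamily E p) {β : ℝ → ℝ}
    (hβ : Continuous β) (x₀ : M) (y : E) (l u : ℝ) :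
    ∫ s in l..u, chartFlux Ω p x₀ (β s, y) =
      (∫ s in l..u, fluxForm Ω p (β s) ((extChartAt 𝓘(ℝ, E) x₀).symm y)).comp
        (chartInvDeriv E x₀ y) := by
  simp only [chartFlux]
  exact intervalIntegral_clm_comp_const ((hp.continuous_fluxForm _).comp hβ) _ l u

-- A potential is given by minus the integral of a local primitive of the symplectic form along
-- the trajectories of the loop; it depends neither on the primitive nor on the chart.
theorem exists_nhds_diagonal_hasExactFlux [CompactSpace M] [T2Space M] (Ω : SymplecticForm E M) :
    ∃ V : Set (M × M), IsOpen V ∧ (∀ x, (x, x) ∈ V) ∧ ∀ p : ℝ → Equiv.Perm M, SmoothFamily E p →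
      p 0 = p 1 → (∀ s ∈ Icc (0 : ℝ) 1, ∀ x, (x, p s x) ∈ V) → HasExactFlux Ω p := by
  choose r hr hrt _ using fun x₀ : M => exists_chartBall_subset (E := E) x₀ (O := univ) univ_mem
  choose lam hlam using fun x₀ => exists_isChartPrimitive Ω x₀ (hrt x₀)
  obtain ⟨a, b, δ, V, hVo, hVd, hδt, hVb, hsub⟩ := exists_chartBall_refinement (E := E) hr
  refine ⟨V, hVo, hVd, fun p hp h01 hpV => ?_⟩
  have hpb : ∀ s ∈ Icc (0 : ℝ) 1, ∀ x, p s x ∈ chartBall E (b x) (δ (b x)) := fun s hs x =>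
    hVb x _ (hpV s hs x)
  have hpath : ∀ x, ContMDiff 𝓘(ℝ, ℝ) 𝓘(ℝ, E) ∞ (fun s => p s x) := fun x =>
    ContMDiff.comp (I' := 𝓘(ℝ, ℝ).prod 𝓘(ℝ, E)) hp (contMDiff_id.prodMk contMDiff_const)
  let A : M → ℝ := fun x => chartPathIntegral (lam (a x)) (a x) fun s => p s x
  have hlocal : ∀ x₀ x, chartBall E (b x) (δ (b x)) ⊆ chartBall E (a x₀) (r (a x₀)) →
      A x = chartPathIntegral (lam (a x₀)) (a x₀) fun s => p s x := fun x₀ x hx =>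
    IsChartPrimitive.chartPathIntegral_eq (hlam (a x)) (hlam (a x₀)) (hδt (b x))
      (hsub x).self_of_nhds hx (fun s _ => hpath x s) (by rw [h01]) fun s hs => hpb s hs x
  refine ⟨fun x => -A x, fun x₀ =>
    hasMFDerivAt_of_hasFDerivAt_chart x₀ (mem_extChartAt_source x₀) ?_⟩
  set c := extChartAt 𝓘(ℝ, E) x₀
  obtain ⟨ε, hε, hεt, hεsub⟩ := exists_chartBall_subset (E := E) x₀ (hsub x₀)
  have hcenter : c x₀ ∈ Metric.ball (c x₀) ε := Metric.mem_ball_self hε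
  have hball : ∀ y ∈ Metric.ball (c x₀) ε, chartBall E (b (c.symm y)) (δ (b (c.symm y))) ⊆
      chartBall E (a x₀) (r (a x₀)) := fun y hy => hεsub (mapsTo_chart_symm_chartBall hεt hy)
  have hderiv := (hlam (a x₀)).hasFDerivAt_chartPathIntegral hp h01 x₀ Metric.isOpen_ball hεt
    (fun s hs y hy => hball y hy (hpb s hs _)) hcenter
  have hA : (fun z => A (c.symm z)) =ᶠ[𝓝 (c x₀)] fun z =>
      chartPathIntegral (lam (a x₀)) (a x₀) fun s => p s (c.symm z) :=
    mem_of_superset (Metric.isOpen_ball.mem_nhds hcenter) fun z hz => hlocal x₀ _ (hball z hz)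
  have hnegA := (hderiv.congr_of_eventuallyEq hA).neg
  rwa [neg_neg, hp.integral_chartFlux_comp (β := fun s => s) continuous_id,
    extChartAt_to_inv x₀] at hnegA

end SmallLoops

/-! ### Exactness of the flux forms of a Hamiltonian path -/

section Averages

theorem exists_accumulation_of_secondCountable {Y : Type*} [TopologicalSpace Y]
    [SecondCountableTopology Y] (g : ℝ → Y) {l u : ℝ} (hlu : l < u) :
    ∃ a ∈ Ioo l u, ∀ N ∈ 𝓝 (a, g a), ∃ b ∈ Ioo l u, b ≠ a ∧ (b, g b) ∈ N := by
  by_contra! hisolated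
  let graph : Ioo l u → ℝ × Y := fun t => (t, g t)
  let τ : TopologicalSpace (Ioo l u) := .induced graph inferInstance
  have hsecond : @SecondCountableTopology (Ioo l u) τ :=
    TopologicalSpace.secondCountableTopology_induced _ _ graph
  have hdiscrete : @DiscreteTopology (Ioo l u) τ := by
    refine (@discreteTopology_iff_nhds_ne _ τ).2 fun a => ?_
    obtain ⟨N, hN, hNa⟩ := hisolated a a.2
    have hpre : graph ⁻¹' N ∈ @nhds _ τ a := by
      rw [@nhds_induced _ _ _ graph a]
      exact preimage_mem_comap hN
    refine Filter.empty_mem_iff_bot.1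
      (mem_inf_iff.2 ⟨graph ⁻¹' N, hpre, {a}ᶜ, mem_principal_self _, ?_⟩)
    refine (eq_empty_iff_forall_notMem.2 ?_).symm
    rintro b ⟨hbN, hba⟩
    exact hNa b b.2 (fun h => hba (Subtype.ext h)) hbN
  have hcountable : Countable (Ioo l u) := @countable_of_Lindelof_of_discrete _ τ _ _
  have hnull : volume (Ioo l u) = 0 := (countable_coe_iff.1 hcountable).measure_zero volume
  rw [Real.volume_Ioo, ENNReal.ofReal_eq_zero] at hnull
  linarith

variable {E : Type*} [NormedAddCommGroup E] [NormedSpace ℝ E]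
  {M : Type*} [TopologicalSpace M] [ChartedSpace E M]

theorem IsPotential.sub {A B : M → ℝ} {θ η : M → E →L[ℝ] ℝ} (hA : IsPotential A θ)
    (hB : IsPotential B η) : IsPotential (fun x => A x - B x) (θ - η) := fun x => (hA x).sub (hB x)

theorem IsPotential.const_mul {A : M → ℝ} {θ : M → E →L[ℝ] ℝ} (hA : IsPotential A θ) (k : ℝ) :
    IsPotential (fun x => k * A x) (k • θ) := fun x => (hA x).const_smul k

theorem SmoothFamily.continuous {P : Type*} [NormedAddCommGroup P] [NormedSpace ℝ P]
    {f : P → Equiv.Perm M} (hf : SmoothFamily E f) : Continuous (fun q : P × M => f q.1 q.2) :=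
  ContMDiff.continuous hf

variable [IsManifold 𝓘(ℝ, E) ∞ M] {Ω : SymplecticForm E M}

theorem IsHamDiffeo.isSymplectic {φ : Equiv.Perm M} (h : IsHamDiffeo Ω φ) : IsSymplectic Ω φ := by
  obtain ⟨f, F, hf, -, h0, rfl, hF⟩ := h
  exact (hF.isFluxPotential hf).isSymplectic hf h0 1

theorem IsPotential.integral {B : ℝ → M → ℝ} {θ : ℝ → M → E →L[ℝ] ℝ}
    (hB : ContMDiff (𝓘(ℝ, ℝ).prod 𝓘(ℝ, E)) 𝓘(ℝ, ℝ) ∞ (fun q : ℝ × M => B q.1 q.2))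
    (hθ : ∀ s, IsPotential (B s) (θ s)) (hc : ∀ x, Continuous fun s => θ s x) :
    IsPotential (fun x => ∫ s in (0 : ℝ)..1, B s x) (fun x => ∫ s in (0 : ℝ)..1, θ s x) := by
  intro x
  set c := extChartAt 𝓘(ℝ, E) x
  have hx : c x ∈ c.target := mem_extChartAt_target x
  have hU : IsOpen ((univ : Set ℝ) ×ˢ c.target) := isOpen_univ_prod_chart_target x
  have hBc := contDiffOn_chart_of_contMDiff x hB
  have hslice : ∀ s, fderivSnd (fun q : ℝ × E => B q.1 (c.symm q.2)) (s, c x) =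
      (θ s x).comp (chartInvDeriv E x (c x)) := fun s => by
    have hpotential := hasFDerivAt_comp_chart_symm x hx (hθ s (c.symm (c x)))
    rw [extChartAt_to_inv x] at hpotential
    exact (hasFDerivAt_fderivSnd ((hBc.contDiffAt (hU.mem_nhds ⟨mem_univ s, hx⟩)).differentiableAt
      (by simp))).unique hpotential
  have hderiv := hasFDerivAt_parametric_integral (isOpen_extChartAt_target x) hU
    (prod_mono_left (subset_univ _)) (hBc.of_le ENat.LEInfty.out) hx
  rw [funext hslice, intervalIntegral_clm_comp_const (hc x)] at hderiv
  exact hasMFDerivAt_of_hasFDerivAt_chart x (mem_extChartAt_source x) hderiv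

namespace HasExactFlux

variable {k g h : ℝ → Equiv.Perm M}

theorem of_mul {C : ℝ → M → ℝ} (hkg : HasExactFlux Ω (k * g)) (hC : IsFluxPotential Ω k C)
    (hk : SmoothFamily E k) (hg : SmoothFamily E g) (hks : ∀ s, IsSymplectic Ω (k s)) :
    HasExactFlux Ω g := by
  obtain ⟨A, hA⟩ := hkg
  have hdiff : ∀ s,
      fluxForm Ω (k * g) s - fluxForm Ω g s = pullbackOneForm (g s) (fluxForm Ω k s) :=
    fun s => sub_eq_of_eq_add (fluxForm_mul hk hg (hks s))
  have hpot : ∀ s, IsPotential (fun x => C s (g s x)) (fluxForm Ω (k * g) s - fluxForm Ω g s) :=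
    fun s => hdiff s ▸ (hC.2 s).pullback (hg.contMDiff_apply s)
  have hint := IsPotential.integral (contMDiff_comp_family hC.1 hg) hpot fun x =>
    ((hk.mul hg).continuous_fluxForm x).sub (hg.continuous_fluxForm x)
  refine ⟨_, (congrArg (IsPotential _) (funext fun x => ?_)).mp (hA.sub hint)⟩
  simp only [Pi.sub_apply]
  rw [intervalIntegral.integral_sub (((hk.mul hg).continuous_fluxForm x).intervalIntegrable _ _)
    ((hg.continuous_fluxForm x).intervalIntegrable _ _), sub_sub_cancel]

omit [IsManifold 𝓘(ℝ, E) ∞ M] in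
theorem exists_isPotential_average {a b : ℝ} (hab : a ≠ b) (hh : SmoothFamily E h)
    (hflux : HasExactFlux Ω fun s => h (b + s * (a - b))) :
    ∃ A : M → ℝ, IsPotential A fun x => ∫ s in (0 : ℝ)..1, fluxForm Ω h (b + s * (a - b)) x := by
  obtain ⟨A, hA⟩ := hflux
  have hderiv : ∀ s, HasDerivAt (fun s => b + s * (a - b)) (a - b) s := fun s => by
    simpa using ((hasDerivAt_id s).mul_const (a - b)).const_add b
  refine ⟨_, (congrArg (IsPotential _) (funext fun x => ?_)).mp (hA.const_mul (a - b)⁻¹)⟩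
  simp only [fun s => fluxForm_reparam (Ω := Ω) hh (hderiv s).differentiableAt,
    fun s => (hderiv s).deriv, Pi.smul_apply, intervalIntegral.integral_smul]
  exact inv_smul_smul₀ (sub_ne_zero.2 hab) _

end HasExactFlux

variable [CompleteSpace E] [CompactSpace M] [T2Space M] {h : ℝ → Equiv.Perm M}

theorem exists_close_isotopies [SecondCountableTopology M] (hh : SmoothFamily E h)
    (hhd : ∀ t, IsDiffeo E (h t)) {f : ℝ → ℝ → Equiv.Perm M} (hf : ∀ t, SmoothFamily E (f t))
    (hfd : ∀ t s, IsDiffeo E (f t s)) {V : Set (M × M)} (hVo : IsOpen V) (hVd : ∀ x, (x, x) ∈ V)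
    {l u : ℝ} (hlu : l < u) :
    ∃ a ∈ Ioo l u, ∃ b ∈ Ioo l u, b ≠ a ∧ ∀ s ∈ Icc (0 : ℝ) 1, ∀ x,
      (x, (f a s)⁻¹ (f b s ((h b)⁻¹ (h (b + s * (a - b)) x)))) ∈ V := by
  let g : ℝ → C(unitInterval × M, M) := fun t =>
    ⟨fun q => f t q.1 q.2, (hf t).continuous.comp
      ((continuous_subtype_val.comp continuous_fst).prodMk continuous_snd)⟩
  obtain ⟨a, ha, hacc⟩ := exists_accumulation_of_secondCountable g hlu
  let loop : (ℝ × C(unitInterval × M, M)) × (unitInterval × M) → M := fun w =>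
    (f a w.2.1)⁻¹ (w.1.2 (w.2.1, (h w.1.1)⁻¹ (h (w.1.1 + w.2.1 * (a - w.1.1)) w.2.2)))
  have hloop : Continuous loop := by
    have hpath : Continuous fun w : (ℝ × C(unitInterval × M, M)) × (unitInterval × M) =>
        h (w.1.1 + w.2.1 * (a - w.1.1)) w.2.2 :=
      hh.continuous.comp (f := fun w : (ℝ × C(unitInterval × M, M)) × (unitInterval × M) =>
        (w.1.1 + w.2.1 * (a - w.1.1), w.2.2)) (by fun_prop)
    have hbased := (hh.inv hhd).continuous.comp ((continuous_fst.comp continuous_fst).prodMk hpath)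
    exact ((hf a).inv (hfd a)).continuous.comp
      ((continuous_subtype_val.comp (continuous_fst.comp continuous_snd)).prodMk
        ((continuous_snd.comp continuous_fst).eval
          ((continuous_fst.comp continuous_snd).prodMk hbased)))
  have hloop_self : ∀ q, loop ((a, g a), q) = q.2 := fun q => by simp [loop, g]
  have hclose : ∀ᶠ z in 𝓝 (a, g a), ∀ q ∈ (univ : Set (unitInterval × M)), (q.2, loop (z, q)) ∈ V :=
    isCompact_univ.eventually_forall_of_forall_eventually fun q _ =>
      ((continuous_snd.comp continuous_snd).prodMk hloop).continuousAt.eventually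
        (hVo.mem_nhds (by simpa only [Function.comp_apply, hloop_self] using hVd q.2))
  obtain ⟨b, hb, hba, hbV⟩ := hacc _ hclose
  exact ⟨a, ha, b, hb, hba, fun s hs x => hbV (⟨s, hs⟩, x) (mem_univ _)⟩

-- Isotopies from the identity to `h t`, for `t` in an interval, cannot all be far apart. Two of
-- them that are close and the segment of `h` between their endpoints bound a small loop.
theorem exists_isPotential_average [SecondCountableTopology M]
    (hh : SmoothFamily E h) (hham : ∀ t, IsHamDiffeo Ω (h t)) {l u : ℝ} (hlu : l < u) :
    ∃ a ∈ Ioo l u, ∃ b ∈ Ioo l u, ∃ A : M → ℝ,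
      IsPotential A fun x => ∫ s in (0 : ℝ)..1, fluxForm Ω h (b + s * (a - b)) x := by
  obtain ⟨V, hVo, hVd, hV⟩ := exists_nhds_diagonal_hasExactFlux Ω
  have hhd := fun t => (hham t).isDiffeo
  choose f F hf hfd hf0 hf1 hF using id hham
  obtain ⟨a, ha, b, hb, hba, hclose⟩ := exists_close_isotopies hh hhd hf hfd hVo hVd hlu
  have hfs := fun t => ((hF t).isFluxPotential (hf t)).isSymplectic (hf t) (hf0 t)
  have hinv := (hf a).inv (hfd a)
  have hinvB := ((hF a).isFluxPotential (hf a)).inv (hf a) (hfd a) (hfs a)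
  have hbi := (hham b).inv
  have hconst : SmoothFamily E fun _ : ℝ => (h b)⁻¹ := .const hbi.isDiffeo
  have hseg : SmoothFamily E fun s => h (b + s * (a - b)) := hh.reparam (by fun_prop)
  have hexact : HasExactFlux Ω
      ((f a)⁻¹ * (f b * ((fun _ => (h b)⁻¹) * fun s => h (b + s * (a - b))))) :=
    hV _ (hinv.mul ((hf b).mul (hconst.mul hseg))) (by simp [hf0, hf1]) hclose
  refine ⟨a, ha, b, hb, HasExactFlux.exists_isPotential_average hba.symm hh ?_⟩
  exact ((hexact.of_mul hinvB hinv ((hf b).mul (hconst.mul hseg))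
      (hinvB.isSymplectic hinv (by simp [hf0]))).of_mul ((hF b).isFluxPotential (hf b)) (hf b)
    (hconst.mul hseg) (hfs b)).of_mul (.const _) hconst hseg fun _ => hbi.isSymplectic

end Averages

section Limits

theorem eq_univ_of_locally_invariant {X : Type*} [TopologicalSpace X] [PreconnectedSpace X]
    {S : Set X} (hS : S.Nonempty) (h : ∀ x₀, ∃ U ∈ 𝓝 x₀, ∀ x ∈ U, ∀ y ∈ U, x ∈ S → y ∈ S) :
    S = univ := by
  choose U hU hUS using h
  refine IsClopen.eq_univ ⟨isClosed_iff_frequently.2 fun x hx => ?_,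
    isOpen_iff_mem_nhds.2 fun x hx => ?_⟩ hS
  · obtain ⟨y, hyS, hyU⟩ := (hx.and_eventually (hU x)).exists
    exact hUS x y hyU x (mem_of_mem_nhds (hU x)) hyS
  · exact mem_of_superset (hU x) fun y hy => hUS x x (mem_of_mem_nhds (hU x)) y hy hx

theorem tendstoUniformlyOn_segment_average {Y F : Type*} [TopologicalSpace Y]
    [NormedAddCommGroup F] [NormedSpace ℝ F] [CompleteSpace F] {G : ℝ × Y → F} {K : Set Y}
    (hK : IsCompact K) (hG : ∀ s, ∀ y ∈ K, ContinuousAt G (s, y)) {a b : ℕ → ℝ} {t₀ : ℝ}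
    (ha : Tendsto a atTop (𝓝 t₀)) (hb : Tendsto b atTop (𝓝 t₀)) :
    TendstoUniformlyOn (fun n y => ∫ s in (0 : ℝ)..1, G (b n + s * (a n - b n), y))
      (fun y => G (t₀, y)) atTop K := by
  refine Metric.tendstoUniformlyOn_iff.2 fun ε hε => ?_
  have hclose : ∀ᶠ z : ℝ × ℝ in 𝓝 (t₀, t₀), ∀ q ∈ Icc (0 : ℝ) 1 ×ˢ K,
      dist (G (z.2 + q.1 * (z.1 - z.2), q.2)) (G (t₀, q.2)) < ε / 2 := by
    refine (isCompact_Icc.prod hK).eventually_forall_of_forall_eventually fun q hq => ?_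
    have hsegment : ContinuousAt (fun w : (ℝ × ℝ) × ℝ × Y =>
        G (w.1.2 + w.2.1 * (w.1.1 - w.1.2), w.2.2)) ((t₀, t₀), q) :=
      ContinuousAt.comp (g := G) (f := fun w : (ℝ × ℝ) × ℝ × Y =>
        (w.1.2 + w.2.1 * (w.1.1 - w.1.2), w.2.2)) (hG _ _ hq.2) (by fun_prop)
    have hcenter : ContinuousAt (fun w : (ℝ × ℝ) × ℝ × Y => G (t₀, w.2.2)) ((t₀, t₀), q) :=
      ContinuousAt.comp (g := G) (f := fun w : (ℝ × ℝ) × ℝ × Y => (t₀, w.2.2)) (hG _ _ hq.2)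
        (by fun_prop)
    refine (hsegment.dist hcenter).eventually_lt continuousAt_const ?_
    simpa using hε
  filter_upwards [(ha.prodMk_nhds hb).eventually hclose] with n hn y hy
  have hcont : Continuous fun s => G (b n + s * (a n - b n), y) :=
    continuous_iff_continuousAt.2 fun s => ContinuousAt.comp (g := G)
      (f := fun s => (b n + s * (a n - b n), y)) (hG _ y hy) (by fun_prop)
  have hdiff : (∫ s in (0 : ℝ)..1, G (b n + s * (a n - b n), y)) - G (t₀, y) =
      ∫ s in (0 : ℝ)..1, (G (b n + s * (a n - b n), y) - G (t₀, y)) := by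
    rw [intervalIntegral.integral_sub (hcont.intervalIntegrable _ _) intervalIntegrable_const,
      intervalIntegral.integral_const, sub_zero, one_smul]
  rw [dist_comm, dist_eq_norm, hdiff]
  refine (intervalIntegral.norm_integral_le_of_norm_le_const (C := ε / 2) fun s hs => ?_).trans_lt
    (by simpa using hε)
  rw [uIoc_of_le zero_le_one] at hs
  exact dist_eq_norm (G (b n + s * (a n - b n), y)) _ ▸ (hn (s, y) ⟨Ioc_subset_Icc_self hs, hy⟩).le

variable {E : Type*} [NormedAddCommGroup E] [NormedSpace ℝ E]
  {M : Type*} [TopologicalSpace M] [ChartedSpace E M] [IsManifold 𝓘(ℝ, E) ∞ M]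
  {Ω : SymplecticForm E M}

theorem IsPotential.exists_of_tendsto [ConnectedSpace M] {C : ℕ → M → ℝ}
    {θ : ℕ → M → E →L[ℝ] ℝ} {η : M → E →L[ℝ] ℝ} (hC : ∀ n, IsPotential (C n) (θ n))
    (hlim : ∀ x₀ : M, ∃ r > 0,
      Metric.ball (extChartAt 𝓘(ℝ, E) x₀ x₀) r ⊆ (extChartAt 𝓘(ℝ, E) x₀).target ∧
      TendstoUniformlyOn
        (fun n y => (θ n ((extChartAt 𝓘(ℝ, E) x₀).symm y)).comp (chartInvDeriv E x₀ y))
        (fun y => (η ((extChartAt 𝓘(ℝ, E) x₀).symm y)).comp (chartInvDeriv E x₀ y)) atTop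
        (Metric.ball (extChartAt 𝓘(ℝ, E) x₀ x₀) r)) : ∃ B, IsPotential B η := by
  obtain ⟨x₁⟩ := (inferInstance : Nonempty M)
  let D : ℕ → M → ℝ := fun n x => C n x - C n x₁
  choose r hr hrt hunif using hlim
  have hD : ∀ n (x₀ : M), ∀ y ∈ Metric.ball (extChartAt 𝓘(ℝ, E) x₀ x₀) (r x₀),
      HasFDerivAt (fun z => D n ((extChartAt 𝓘(ℝ, E) x₀).symm z))
        ((θ n ((extChartAt 𝓘(ℝ, E) x₀).symm y)).comp (chartInvDeriv E x₀ y)) y :=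
    fun n x₀ y hy => (hasFDerivAt_comp_chart_symm x₀ (hrt x₀ hy) (hC n _)).sub_const _
  have hcauchy : {x | Cauchy (map (fun n => D n x) atTop)} = univ := by
    refine eq_univ_of_locally_invariant ⟨x₁, ?_⟩ fun x₀ => ⟨chartBall E x₀ (r x₀),
      (isOpen_chartBall x₀ _).mem_nhds (mem_chartBall_self x₀ (hr x₀)), fun x hx y hy hxS => ?_⟩
    · simpa only [D, mem_ofPred_eq, sub_self] using (tendsto_const_nhds (x := (0 : ℝ))).cauchy_map
    · simpa only [mem_ofPred_eq, (extChartAt 𝓘(ℝ, E) x₀).left_inv hy.1] using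
        cauchy_map_of_uniformCauchySeqOn_fderiv Metric.isOpen_ball (convex_ball _ _).isPreconnected
          (hunif x₀).uniformCauchySeqOn (fun n => hD n x₀) hx.2 hy.2
          (by simpa only [mem_ofPred_eq, (extChartAt 𝓘(ℝ, E) x₀).left_inv hx.1] using hxS)
  choose B hB using fun x => cauchy_map_iff_exists_tendsto.1 (hcauchy.ge (mem_univ x))
  refine ⟨B, fun x => hasMFDerivAt_of_hasFDerivAt_chart x (mem_extChartAt_source x) ?_⟩
  have hderiv := hasFDerivAt_of_tendstoUniformlyOn Metric.isOpen_ball (hunif x)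
    (fun n => hD n x) (fun y _ => hB ((extChartAt 𝓘(ℝ, E) x).symm y))
    (Metric.mem_ball_self (hr x))
  rwa [extChartAt_to_inv x] at hderiv

theorem exists_isPotential_fluxForm [FiniteDimensional ℝ E] [CompactSpace M] [T2Space M]
    [ConnectedSpace M] {h : ℝ → Equiv.Perm M} (hh : SmoothFamily E h)
    (hham : ∀ t, IsHamDiffeo Ω (h t)) (t₀ : ℝ) : ∃ B, IsPotential B (fluxForm Ω h t₀) := by
  have : SecondCountableTopology M := ChartedSpace.secondCountable_of_sigmaCompact E M
  have : CompleteSpace E := FiniteDimensional.complete ℝ E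
  have : ProperSpace E := FiniteDimensional.proper ℝ E
  have hpos : ∀ n : ℕ, (0 : ℝ) < 1 / (n + 1) := fun n => Nat.one_div_pos_of_nat
  choose a ha b hb C hC using fun n : ℕ =>
    exists_isPotential_average (Ω := Ω) hh hham (l := t₀ - 1 / (n + 1)) (u := t₀ + 1 / (n + 1))
      (by linarith [hpos n])
  have hshrink : ∀ τ : ℕ → ℝ, (∀ n : ℕ, τ n ∈ Ioo (t₀ - 1 / (n + 1)) (t₀ + 1 / (n + 1))) →
      Tendsto τ atTop (𝓝 t₀) := fun τ hτ => tendsto_iff_dist_tendsto_zero.2 <|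
    squeeze_zero (fun _ => dist_nonneg) (fun n => (Real.ball_eq_Ioo t₀ _ ▸ hτ n :
      τ n ∈ Metric.ball t₀ (1 / (n + 1))).le) tendsto_one_div_add_atTop_nhds_zero_nat
  refine IsPotential.exists_of_tendsto hC fun x₀ => ?_
  set c := extChartAt 𝓘(ℝ, E) x₀
  obtain ⟨r, hr, hrt⟩ := Metric.nhds_basis_closedBall.mem_iff.1 (extChartAt_target_mem_nhds
    (I := 𝓘(ℝ, E)) x₀)
  have hlim := tendstoUniformlyOn_segment_average (G := chartFlux Ω h x₀)
    (isCompact_closedBall (c x₀) r) (fun s y hy => (hh.contDiffOn_chartFlux x₀).continuousOn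
      |>.continuousAt ((isOpen_univ_prod_chart_target x₀).mem_nhds ⟨mem_univ s, hrt hy⟩))
    (hshrink a ha) (hshrink b hb)
  refine ⟨r, hr, Metric.ball_subset_closedBall.trans hrt, ?_⟩
  exact (hlim.mono Metric.ball_subset_closedBall).congr <| .of_forall fun n y _ =>
    hh.integral_chartFlux_comp (β := fun s => b n + s * (a n - b n)) (by fun_prop) x₀ y 0 1

end Limits

section Generation

variable {E : Type*} [NormedAddCommGroup E] [NormedSpace ℝ E]
  {M : Type*} [TopologicalSpace M] [ChartedSpace E M] [IsManifold 𝓘(ℝ, E) ∞ M]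
  {Ω : SymplecticForm E M} {h : ℝ → Equiv.Perm M} {B : ℝ → M → ℝ}

theorem potential_sub_eq_integral_chartFlux (hh : SmoothFamily E h)
    (hB : ∀ t, IsPotential (B t) (fluxForm Ω h t)) (x₀ : M) {r : ℝ}
    (hr : Metric.ball (extChartAt 𝓘(ℝ, E) x₀ x₀) r ⊆ (extChartAt 𝓘(ℝ, E) x₀).target) (t : ℝ)
    {y z : E} (hy : y ∈ Metric.ball (extChartAt 𝓘(ℝ, E) x₀ x₀) r)
    (hz : z ∈ Metric.ball (extChartAt 𝓘(ℝ, E) x₀ x₀) r) :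
    B t ((extChartAt 𝓘(ℝ, E) x₀).symm z) - B t ((extChartAt 𝓘(ℝ, E) x₀).symm y) =
      (∫ s in (0 : ℝ)..1, chartFlux Ω h x₀ (t, y + s • (z - y))) (z - y) := by
  set c := extChartAt 𝓘(ℝ, E) x₀
  have hsegment : ∀ s ∈ Icc (0 : ℝ) 1, y + s • (z - y) ∈ c.target := fun s hs =>
    hr ((convex_ball _ _).add_smul_sub_mem hy hz hs)
  have hcont : ContinuousOn (fun s : ℝ => chartFlux Ω h x₀ (t, y + s • (z - y))) (Icc 0 1) :=
    (hh.contDiffOn_chartFlux x₀).continuousOn.comp (f := fun s : ℝ => (t, y + s • (z - y)))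
      (by fun_prop) fun s hs => ⟨mem_univ t, hsegment s hs⟩
  have hderiv : ∀ s ∈ uIcc (0 : ℝ) 1, HasDerivAt (fun s : ℝ => B t (c.symm (y + s • (z - y))))
      (chartFlux Ω h x₀ (t, y + s • (z - y)) (z - y)) s := fun s hs => by
    rw [uIcc_of_le zero_le_one] at hs
    have hline : HasDerivAt (fun s : ℝ => y + s • (z - y)) (z - y) s := by
      simpa using ((hasDerivAt_id s).smul_const (z - y)).const_add y
    exact (hasFDerivAt_comp_chart_symm x₀ (hsegment s hs) (hB t _)).comp_hasDerivAt s hline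
  rw [ContinuousLinearMap.intervalIntegral_apply (hcont.intervalIntegrable_of_Icc zero_le_one),
    intervalIntegral.integral_eq_sub_of_hasDerivAt hderiv
      ((hcont.clm_apply continuousOn_const).intervalIntegrable_of_Icc zero_le_one)]
  simp only [one_smul, zero_smul, add_sub_cancel, add_zero]

theorem contDiffOn_potential_sub (hh : SmoothFamily E h)
    (hB : ∀ t, IsPotential (B t) (fluxForm Ω h t)) (x₀ : M) {r : ℝ}
    (hr : Metric.ball (extChartAt 𝓘(ℝ, E) x₀ x₀) r ⊆ (extChartAt 𝓘(ℝ, E) x₀).target) {y : E}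
    (hy : y ∈ Metric.ball (extChartAt 𝓘(ℝ, E) x₀ x₀) r) :
    ContDiffOn ℝ ∞ (fun q : ℝ × E => B q.1 ((extChartAt 𝓘(ℝ, E) x₀).symm q.2) -
      B q.1 ((extChartAt 𝓘(ℝ, E) x₀).symm y))
      (univ ×ˢ Metric.ball (extChartAt 𝓘(ℝ, E) x₀ x₀) r) := by
  set c := extChartAt 𝓘(ℝ, E) x₀
  let segment : ℝ × (ℝ × E) → ℝ × E := fun w => (w.2.1, y + w.1 • (w.2.2 - y))
  have hsegment : ContDiff ℝ ∞ segment := by fun_prop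
  have hint := contDiffOn_parametric_integral (isOpen_univ.prod Metric.isOpen_ball)
    ((isOpen_univ_prod_chart_target x₀).preimage hsegment.continuous)
    (fun w hw => ⟨mem_univ _, hr ((convex_ball _ _).add_smul_sub_mem hy hw.2.2 hw.1)⟩)
    ((hh.contDiffOn_chartFlux (Ω := Ω) x₀).comp hsegment.contDiffOn fun w hw => hw)
  exact (hint.clm_apply (contDiff_snd.sub contDiff_const).contDiffOn).congr fun q hq =>
    potential_sub_eq_integral_chartFlux hh hB x₀ hr q.1 hy hq.2

theorem contDiff_potential_apply [ConnectedSpace M] (hh : SmoothFamily E h)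
    (hB : ∀ t, IsPotential (B t) (fluxForm Ω h t)) {x₁ : M} (hx₁ : ContDiff ℝ ∞ fun t => B t x₁)
    (x : M) : ContDiff ℝ ∞ fun t => B t x := by
  suffices hS : {x | ContDiff ℝ ∞ fun t => B t x} = univ from hS.ge (mem_univ x)
  refine eq_univ_of_locally_invariant ⟨x₁, hx₁⟩ fun x₀ => ?_
  obtain ⟨r, hr, hrt, -⟩ := exists_chartBall_subset (E := E) x₀ (O := univ) univ_mem
  refine ⟨chartBall E x₀ r, (isOpen_chartBall x₀ _).mem_nhds (mem_chartBall_self x₀ hr),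
    fun x hx y hy hxS => ?_⟩
  have hdiff := (contDiffOn_potential_sub hh hB x₀ hrt hx.2).comp_contDiff
    (f := fun t : ℝ => (t, extChartAt 𝓘(ℝ, E) x₀ y)) (by fun_prop) fun t => ⟨mem_univ t, hy.2⟩
  simpa only [mem_ofPred_eq, Function.comp_def, (extChartAt 𝓘(ℝ, E) x₀).left_inv hx.1,
    (extChartAt 𝓘(ℝ, E) x₀).left_inv hy.1, sub_add_cancel] using
    hdiff.add (show ContDiff ℝ ∞ fun t => B t x from hxS)

theorem contMDiff_of_isPotential [ConnectedSpace M] (hh : SmoothFamily E h)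
    (hB : ∀ t, IsPotential (B t) (fluxForm Ω h t)) {x₁ : M} (hx₁ : ContDiff ℝ ∞ fun t => B t x₁) :
    ContMDiff (𝓘(ℝ, ℝ).prod 𝓘(ℝ, E)) 𝓘(ℝ, ℝ) ∞ (fun q : ℝ × M => B q.1 q.2) := by
  rintro ⟨t₀, x⟩
  set c := extChartAt 𝓘(ℝ, E) x
  obtain ⟨r, hr, hrt, -⟩ := exists_chartBall_subset (E := E) x (O := univ) univ_mem
  have hsub := (contDiffOn_potential_sub hh hB x hrt (Metric.mem_ball_self hr)).contDiffAt
    (x := (t₀, c x)) ((isOpen_univ.prod Metric.isOpen_ball).mem_nhds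
      ⟨mem_univ _, Metric.mem_ball_self hr⟩)
  have hlocal : ContDiffAt ℝ ∞ (fun q : ℝ × E => B q.1 (c.symm q.2) - B q.1 (c.symm (c x)) +
      B q.1 x) (t₀, c x) :=
    hsub.add ((contDiff_potential_apply hh hB hx₁ x).comp contDiff_fst).contDiffAt
  have hcoord : ContMDiffAt (𝓘(ℝ, ℝ).prod 𝓘(ℝ, E)) 𝓘(ℝ, ℝ × E) ∞ (fun q : ℝ × M => (q.1, c q.2))
      (t₀, x) := contMDiffAt_fst.prodMk_space
    (ContMDiffAt.comp (I' := 𝓘(ℝ, E)) (t₀, x) contMDiffAt_extChartAt contMDiffAt_snd)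
  refine (ContMDiffAt.comp (I' := 𝓘(ℝ, ℝ × E)) (t₀, x) (f := fun q : ℝ × M => (q.1, c q.2))
    hlocal.contMDiffAt hcoord).congr_of_eventuallyEq ?_
  filter_upwards [continuousAt_snd.eventually (extChartAt_source_mem_nhds (I := 𝓘(ℝ, E)) x)]
    with q hq
  simp only [Function.comp_apply, c, (extChartAt 𝓘(ℝ, E) x).left_inv hq, extChartAt_to_inv x,
    sub_add_cancel]

omit [IsManifold 𝓘(ℝ, E) ∞ M] in
theorem periodic_fluxForm (hh : SmoothFamily E h) (hper : Function.Periodic h 1) :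
    Function.Periodic (fluxForm Ω h) 1 := fun t => by
  have hshift := fluxForm_reparam (Ω := Ω) hh (b := fun s => s + 1) (t := t) (by fun_prop)
  rw [show (fun s => h (s + 1)) = h from funext hper, deriv_add_const, deriv_id'', one_smul]
    at hshift
  exact hshift.symm

theorem exists_isFluxPotential [FiniteDimensional ℝ E] [CompactSpace M] [T2Space M]
    [ConnectedSpace M] (hh : SmoothFamily E h) (hper : Function.Periodic h 1)
    (hham : ∀ t, IsHamDiffeo Ω (h t)) :
    ∃ B, IsFluxPotential Ω h B ∧ Function.Periodic B 1 := by
  obtain ⟨x₁⟩ := (inferInstance : Nonempty M)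
  choose A hA using exists_isPotential_fluxForm (Ω := Ω) hh hham
  let B : ℝ → M → ℝ := fun t x => A (Int.fract t) x - A (Int.fract t) x₁
  have hB : ∀ t, IsPotential (B t) (fluxForm Ω h t) := fun t => by
    have hfract : fluxForm Ω h (Int.fract t) = fluxForm Ω h t := by
      simpa only [zsmul_one, Int.self_sub_floor] using
        (periodic_fluxForm hh hper).sub_zsmul_eq (x := t) ⌊t⌋
    have hconst : IsPotential (fun _ : M => A (Int.fract t) x₁) (0 : M → E →L[ℝ] ℝ) :=
      fun x => hasMFDerivAt_const _ x
    simpa only [hfract, sub_zero] using (hA (Int.fract t)).sub hconst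
  have hBx₁ : ∀ t, B t x₁ = 0 := fun t => sub_self _
  exact ⟨B, ⟨contMDiff_of_isPotential hh hB (x₁ := x₁) (by simpa only [hBx₁] using contDiff_const),
    hB⟩, fun t => by simp only [B, Int.fract_add_one]⟩

end Generation

/-! ### Uniquely ergodic maps -/

section UniqueErgodicity

open scoped BoundedContinuousFunction

variable {X : Type*} [TopologicalSpace X] {T : X → X}

/-- The map `T` has exactly one invariant Borel probability measure. Unlike in `StrictlyErgodic`,
this measure may vanish on nonempty open sets. -/
def UniquelyErgodic (T : X → X) : Prop :=
  letI : MeasurableSpace X := borel X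
  ∃! m : Measure X, IsProbabilityMeasure m ∧ MeasurePreserving T m m

theorem StrictlyErgodic.uniquelyErgodic (h : StrictlyErgodic T) : UniquelyErgodic T := by
  obtain ⟨m, hm, -, huniq⟩ := h
  exact ⟨m, hm, fun m' hm' => huniq m' hm'.1 hm'.2⟩

theorem norm_birkhoffAverage_comp_sub_le (T : C(X, X)) (f : X →ᵇ ℝ) (k : ℕ) (x : X) :
    ‖birkhoffAverage ℝ T (f.compContinuous T) k x - birkhoffAverage ℝ T f k x‖ ≤
      2 * ‖f‖ / k := by
  have hshift : birkhoffAverage ℝ T (f.compContinuous T) k x = birkhoffAverage ℝ T f k (T x) := by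
    simp only [birkhoffAverage, birkhoffSum, BoundedContinuousFunction.compContinuous_apply,
      ← Function.iterate_succ_apply', Function.iterate_succ_apply]
  rw [hshift, ← dist_eq_norm, dist_birkhoffAverage_apply_birkhoffAverage]
  gcongr
  exact f.dist_le_two_norm _ _

variable [MeasurableSpace X] [BorelSpace X]

omit [TopologicalSpace X] [BorelSpace X] in
theorem isProbabilityMeasure_orbit_average (T : X → X) (k : ℕ) (x : X) :
    IsProbabilityMeasure (((k + 1 : ℕ) : ENNReal)⁻¹ •
      ∑ j ∈ Finset.range (k + 1), Measure.dirac (T^[j] x)) := by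
  constructor
  simp only [Measure.smul_apply, Measure.finsetSum_apply, measure_univ, Finset.sum_const,
    Finset.card_range, nsmul_eq_mul, mul_one, smul_eq_mul]
  exact ENNReal.inv_mul_cancel (by simp) (ENNReal.natCast_ne_top _)

/-- The uniform distribution on the orbit segment `x, T x, …, T^k x`. It has `k + 1` points, hence
is a probability measure for every `k`. -/
def empiricalMeasure (T : X → X) (k : ℕ) (x : X) : ProbabilityMeasure X :=
  ⟨_, isProbabilityMeasure_orbit_average T k x⟩

theorem integral_empiricalMeasure (T : X → X) (k : ℕ) (x : X) (f : X →ᵇ ℝ) :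
    ∫ z, f z ∂(empiricalMeasure T k x : Measure X) = birkhoffAverage ℝ T f (k + 1) x := by
  rw [empiricalMeasure, ProbabilityMeasure.coe_mk, integral_smul_measure,
    integral_finsetSum_measure fun j _ => f.integrable _]
  simp only [integral_dirac' _ _ f.continuous.stronglyMeasurable, birkhoffAverage, birkhoffSum,
    ENNReal.toReal_inv, ENNReal.toReal_natCast]

theorem exists_tendsto_birkhoffAverage [CompactSpace X] [T2Space X] (T : X → X)
    (u : Ultrafilter (ℕ × X)) (hu : Tendsto Prod.fst (u : Filter (ℕ × X)) atTop) :
    ∃ q : ProbabilityMeasure X, ∀ f : X →ᵇ ℝ,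
      Tendsto (fun p : ℕ × X => birkhoffAverage ℝ T f p.1 p.2) u
        (𝓝 (∫ z, f z ∂(q : Measure X))) := by
  let ν : ℕ × X → ProbabilityMeasure X := fun p => empiricalMeasure T (p.1 - 1) p.2
  obtain ⟨q, -, hq⟩ := isCompact_univ.ultrafilter_le_nhds (u.map ν) (by simp)
  have hν : Tendsto ν u (𝓝 q) := hq
  refine ⟨q, fun f => (ProbabilityMeasure.tendsto_iff_forall_integral_tendsto.1 hν f).congr' ?_⟩
  filter_upwards [hu.eventually_ge_atTop 1] with p hp
  rw [integral_empiricalMeasure, Nat.sub_add_cancel hp]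

theorem measurePreserving_of_tendsto_birkhoffAverage [HasOuterApproxClosed X] {T : X → X}
    (hT : Continuous T) {l : Filter (ℕ × X)} [l.NeBot] (hl : Tendsto Prod.fst l atTop)
    {q : ProbabilityMeasure X}
    (hq : ∀ f : X →ᵇ ℝ,
      Tendsto (fun p : ℕ × X => birkhoffAverage ℝ T f p.1 p.2) l (𝓝 (∫ z, f z ∂(q : Measure X)))) :
    MeasurePreserving T (q : Measure X) q := by
  have hinv : ∀ f : X →ᵇ ℝ, ∫ z, f (T z) ∂(q : Measure X) = ∫ z, f z ∂(q : Measure X) := by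
    intro f
    have hdecay : Tendsto (fun p : ℕ × X => 2 * ‖f‖ / (p.1 : ℝ)) l (𝓝 0) :=
      (tendsto_const_div_atTop_nhds_zero_nat _).comp hl
    exact sub_eq_zero.1 <| tendsto_nhds_unique ((hq (f.compContinuous ⟨T, hT⟩)).sub (hq f)) <|
      squeeze_zero_norm (fun p => norm_birkhoffAverage_comp_sub_le ⟨T, hT⟩ f p.1 p.2) hdecay
  have : IsProbabilityMeasure ((q : Measure X).map T) :=
    Measure.isProbabilityMeasure_map hT.measurable.aemeasurable
  refine ⟨hT.measurable, ext_of_forall_integral_eq_of_IsFiniteMeasure fun f => ?_⟩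
  rw [integral_map hT.measurable.aemeasurable f.continuous.aestronglyMeasurable]
  exact hinv f

omit [MeasurableSpace X] [BorelSpace X] in
theorem UniquelyErgodic.exists_tendstoUniformly_birkhoffAverage [CompactSpace X]
    [TopologicalSpace.MetrizableSpace X] {T : X → X} (h : UniquelyErgodic T) (hT : Continuous T)
    {f : X → ℝ} (hf : Continuous f) :
    ∃ c, TendstoUniformly (fun k => birkhoffAverage ℝ T f k) (fun _ => c) atTop := by
  let _ : MeasurableSpace X := borel X
  have : BorelSpace X := ⟨rfl⟩
  obtain ⟨m, -, huniq⟩ := h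
  refine ⟨∫ z, f z ∂m, tendstoUniformly_iff_tendsto.2 <|
    (tendsto_iff_ultrafilter _ _ _).2 fun u hu => ?_⟩
  have hfst : Tendsto Prod.fst (u : Filter (ℕ × X)) atTop := tendsto_fst.mono_left hu
  obtain ⟨q, hq⟩ := exists_tendsto_birkhoffAverage T u hfst
  have hqm : (q : Measure X) = m :=
    huniq q ⟨inferInstance, measurePreserving_of_tendsto_birkhoffAverage hT hfst hq⟩
  exact Uniform.tendsto_nhds_right.1 (hqm ▸ hq (BoundedContinuousFunction.mkOfCompact ⟨f, hf⟩))

end UniqueErgodicity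

/-! ### Loops along the orbits of the skew product -/

section Periodic

theorem isQuotientMap_prodMap_coe (X : Type*) [TopologicalSpace X] :
    IsQuotientMap (Prod.map id ((↑) : ℝ → UnitAddCircle) : X × ℝ → X × UnitAddCircle) :=
  (IsOpenQuotientMap.id.prodMap QuotientAddGroup.isOpenQuotientMap_mk).isQuotientMap

theorem continuous_lift_periodic {X Y : Type*} [TopologicalSpace X] [TopologicalSpace Y]
    {B : ℝ → X → Y} (hB : Continuous fun q : ℝ × X => B q.1 q.2) (hper : Function.Periodic B 1) :
    Continuous fun q : X × UnitAddCircle => hper.lift q.2 q.1 :=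
  (isQuotientMap_prodMap_coe X).continuous_iff.2 (hB.comp continuous_swap)

end Periodic

section Iterates

variable {E : Type*} [NormedAddCommGroup E] [NormedSpace ℝ E] [CompleteSpace E]
  {M : Type*} [TopologicalSpace M] [ChartedSpace E M] [IsManifold 𝓘(ℝ, E) ∞ M]
  {Ω : SymplecticForm E M}

/-- The loop `t ↦ h (t + c)`. -/
def HamLoop.shift (h : HamLoop Ω) (c : ℝ) : HamLoop Ω :=
  ⟨fun t => h.1 (t + c), h.2.1.reparam (contDiff_id.add contDiff_const),
    Function.Periodic.add_const h.2.2.1 c, fun t => h.2.2.2 (t + c)⟩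

/-- The loop `t ↦ h t * (h 0)⁻¹`, which is `h` moved to the identity. -/
def HamLoop.toBased (h : HamLoop Ω) : BasedHamLoop Ω :=
  ⟨h.1 * fun _ => (h.1 0)⁻¹, mul_mem h.2 ⟨.const (IsHamDiffeo.isDiffeo (h.2.2.2 0)).inv,
    fun _ => rfl, fun _ => inv_mem (h.2.2.2 0)⟩, mul_inv_cancel _⟩

/-- The loop `t ↦ h (t + (k - 1) α) * ⋯ * h (t + α) * h t`, which follows the orbits of length `k`
of the skew product of `h` and the rotation by `α`. -/
def rotatedProd (h : HamLoop Ω) (α : ℝ) : ℕ → HamLoop Ω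
  | 0 => 1
  | k + 1 => HamLoop.shift h (k * α) * rotatedProd h α k

theorem Represents.one : Represents (1 : HamLoop Ω) (1 : PiOneHam Ω) :=
  ⟨1, rfl, 1, .const .one, fun _ => one_mem _, fun _ _ => rfl, fun _ => rfl, fun _ => rfl⟩

theorem Represents.mul {h h' : HamLoop Ω} {γ γ' : PiOneHam Ω} (hγ : Represents h γ)
    (hγ' : Represents h' γ') : Represents (h * h') (γ * γ') := by
  obtain ⟨g, rfl, K, hK⟩ := hγ
  obtain ⟨g', rfl, K', hK'⟩ := hγ'
  exact ⟨g * g', rfl, K * K', hK.smooth.mul hK'.smooth,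
    fun p => mul_mem (hK.mem_ham p) (hK'.mem_ham p),
    fun s t => congrArg₂ (· * ·) (hK.periodic s t) (hK'.periodic s t),
    fun t => congrArg₂ (· * ·) (hK.left t) (hK'.left t),
    fun t => congrArg₂ (· * ·) (hK.right t) (hK'.right t)⟩

theorem Represents.shift {h : HamLoop Ω} {γ : PiOneHam Ω} (hγ : Represents h γ) (c : ℝ) :
    Represents (HamLoop.shift h c) γ := by
  obtain ⟨g, hg, K, hK⟩ := hγ
  refine ⟨g, hg, fun p => K (p.1, p.2 + (1 - p.1) * c), ?_, fun p => hK.mem_ham _,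
    fun s t => ?_, fun t => ?_, fun t => ?_⟩
  · exact hK.smooth.reparam (b := fun p : ℝ × ℝ => (p.1, p.2 + (1 - p.1) * c)) (by fun_prop)
  · rw [add_right_comm, hK.periodic]
  · simpa only [HamLoop.shift, sub_zero, one_mul] using hK.left (t + c)
  · simpa only [sub_self, zero_mul, add_zero] using hK.right t

theorem Represents.rotatedProd {h : HamLoop Ω} {γ : PiOneHam Ω} (hγ : Represents h γ) (α : ℝ) :
    ∀ k, Represents (rotatedProd h α k) (γ ^ k)
  | 0 => pow_zero γ ▸ .one
  | k + 1 => pow_succ' γ k ▸ (hγ.shift (k * α)).mul (hγ.rotatedProd α k)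

theorem Represents.mk_toBased {h : HamLoop Ω} {γ : PiOneHam Ω} (hγ : Represents h γ) :
    PiOneHam.mk (HamLoop.toBased h) = γ := by
  obtain ⟨g, rfl, K, hK⟩ := hγ
  have hbase : SmoothFamily E fun p : ℝ × ℝ => (K (p.1, 0))⁻¹ :=
    (hK.smooth.inv fun p => IsHamDiffeo.isDiffeo (hK.mem_ham p)).reparam
      (b := fun p : ℝ × ℝ => (p.1, (0 : ℝ))) (by fun_prop)
  refine (Con.eq (basedHomotopyCon Ω)).2 ⟨K * fun p => (K (p.1, 0))⁻¹,
    ⟨hK.smooth.mul hbase, fun p => mul_mem (hK.mem_ham p) (inv_mem (hK.mem_ham _)),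
      fun s t => ?_, fun t => ?_, fun t => ?_⟩, fun s => mul_inv_cancel _⟩
  · simp only [Pi.mul_apply, hK.periodic]
  · simp only [Pi.mul_apply, hK.left]
    rfl
  · simp only [Pi.mul_apply, hK.right, g.2.2, inv_one, mul_one]

theorem skewProduct_coe (h : HamLoop Ω) (α : ℝ) (x : M) (t : ℝ) :
    skewProduct h α (x, (t : UnitAddCircle)) = (h.1 t x, ((t + α : ℝ) : UnitAddCircle)) := rfl

theorem iterate_skewProduct (h : HamLoop Ω) (α : ℝ) (k : ℕ) (x : M) (t : ℝ) :
    (skewProduct h α)^[k] (x, (t : UnitAddCircle)) =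
      ((rotatedProd h α k).1 t x, ((t + k * α : ℝ) : UnitAddCircle)) := by
  induction k with
  | zero => simp only [Function.iterate_zero, id, Nat.cast_zero, zero_mul, add_zero]; rfl
  | succ k ih =>
    rw [Function.iterate_succ_apply', ih, skewProduct_coe, add_assoc, Nat.cast_succ, add_one_mul]
    rfl

theorem continuous_skewProduct (h : HamLoop Ω) (α : ℝ) : Continuous (skewProduct h α) :=
  (isQuotientMap_prodMap_coe M).continuous_iff.2 <|
    (h.2.1.continuous.comp continuous_swap).prodMk <|
      (AddCircle.continuous_mk' 1).comp (continuous_snd.add continuous_const)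

namespace IsFluxPotential

theorem shift {h : HamLoop Ω} {B : ℝ → M → ℝ} (hB : IsFluxPotential Ω h.1 B) (c : ℝ) :
    IsFluxPotential Ω (HamLoop.shift h c).1 (fun t => B (t + c)) := by
  refine ⟨ContMDiff.comp (I' := 𝓘(ℝ, ℝ).prod 𝓘(ℝ, E)) (g := fun q : ℝ × M => B q.1 q.2) hB.1
    (((contDiff_id.add contDiff_const).contMDiff.comp contMDiff_fst).prodMk contMDiff_snd),
    fun t => ?_⟩
  have hshift : fluxForm Ω (HamLoop.shift h c).1 t = fluxForm Ω h.1 (t + c) :=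
    (fluxForm_reparam h.2.1 (b := fun s => s + c) (by fun_prop)).trans
      (by rw [deriv_add_const, deriv_id'', one_smul])
  exact hshift ▸ hB.2 (t + c)

theorem rotatedProd {h : HamLoop Ω} {B : ℝ → M → ℝ} (hB : IsFluxPotential Ω h.1 B)
    (hper : Function.Periodic B 1) (α : ℝ) (k : ℕ) :
    IsFluxPotential Ω (rotatedProd h α k).1 (fun t x =>
      birkhoffSum (skewProduct h α) (fun q => hper.lift q.2 q.1) k (x, (t : UnitAddCircle))) := by
  induction k with
  | zero => exact IsFluxPotential.const 1
  | succ k ih =>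
    simp only [birkhoffSum_succ, iterate_skewProduct, add_comm (birkhoffSum _ _ _ _)]
    exact (hB.shift (k * α)).mul ih (HamLoop.shift h (k * α)).2.1 (_root_.rotatedProd h α k).2.1
      fun t => IsHamDiffeo.isSymplectic (h.2.2.2 _)

end IsFluxPotential

end Iterates

/-! ### Bounds for the Hofer norm -/

section Norm

variable {E : Type*} [NormedAddCommGroup E] [NormedSpace ℝ E]
  {M : Type*} [TopologicalSpace M] [ChartedSpace E M] {Ω : SymplecticForm E M}

theorem GeneratesPath.isCompact_range [CompactSpace M] {F : ℝ → M → ℝ} {f : ℝ → Equiv.Perm M}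
    (h : GeneratesPath Ω F f) (t : ℝ) : IsCompact (range (F t)) :=
  _root_.isCompact_range (h.1.continuous.comp (Continuous.prodMk_right t))

theorem hoferLength_nonneg [CompactSpace M] [Nonempty M] {F : ℝ → M → ℝ} {f : ℝ → Equiv.Perm M}
    (h : GeneratesPath Ω F f) : 0 ≤ hoferLength F :=
  intervalIntegral.integral_nonneg zero_le_one fun t _ => sub_nonneg.2 <|
    ciInf_le_ciSup (h.isCompact_range t).bddBelow (h.isCompact_range t).bddAbove

omit [TopologicalSpace M] [ChartedSpace E M] in
theorem hoferLength_le [Nonempty M] {F : ℝ → M → ℝ} {c ε : ℝ} (h : ∀ t x, |F t x - c| ≤ ε) :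
    hoferLength F ≤ 2 * ε := by
  have hosc : ∀ t, ‖(⨆ x, F t x) - ⨅ x, F t x‖ ≤ 2 * ε := fun t => by
    have hupper : ∀ x, F t x ≤ c + ε := fun x => by linarith [(abs_le.1 (h t x)).2]
    have hlower : ∀ x, c - ε ≤ F t x := fun x => by linarith [(abs_le.1 (h t x)).1]
    have horder : ⨅ x, F t x ≤ ⨆ x, F t x :=
      ciInf_le_ciSup ⟨_, forall_mem_range.2 hlower⟩ ⟨_, forall_mem_range.2 hupper⟩
    rw [Real.norm_of_nonneg (sub_nonneg.2 horder)]
    linarith [ciSup_le hupper, le_ciInf hlower]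
  simpa only [sub_zero, abs_one, mul_one] using (le_abs_self (hoferLength F)).trans
    (intervalIntegral.norm_integral_le_of_norm_le_const fun t _ => hosc t)

variable [CompleteSpace E] [IsManifold 𝓘(ℝ, E) ∞ M] [CompactSpace M] [Nonempty M]

theorem hoferNorm_nonneg (γ : PiOneHam Ω) : 0 ≤ hoferNorm γ := by
  refine Real.sInf_nonneg ?_
  rintro l ⟨g, F, -, hF, rfl⟩
  exact hoferLength_nonneg hF

theorem hoferNorm_le {γ : PiOneHam Ω} {g : BasedHamLoop Ω} {F : ℝ → M → ℝ}
    (hg : PiOneHam.mk g = γ) (hF : GeneratesPath Ω F g) : hoferNorm γ ≤ hoferLength F := by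
  refine csInf_le ⟨0, ?_⟩ ⟨g, F, hg, hF, rfl⟩
  rintro l ⟨g, F, -, hF, rfl⟩
  exact hoferLength_nonneg hF

theorem hoferNorm_le_of_isFluxPotential {γ : PiOneHam Ω} {h : HamLoop Ω} (hγ : Represents h γ)
    {B : ℝ → M → ℝ} (hB : IsFluxPotential Ω h.1 B) {c ε : ℝ} (hc : ∀ t x, |B t x - c| ≤ ε) :
    hoferNorm γ ≤ 2 * ε := by
  have hgen := hB.generatesPath h.2.1 fun t => IsHamDiffeo.isDiffeo (h.2.2.2 t)
  refine (hoferNorm_le hγ.mk_toBased (hgen.mul_right (h.1 0)⁻¹)).trans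
    (hoferLength_le (c := -c) fun t x => ?_)
  rw [neg_sub_neg, abs_sub_comm]
  exact hc t _

theorem hoferNorm_pow_le {γ : PiOneHam Ω} {h : HamLoop Ω} (hγ : Represents h γ) {B : ℝ → M → ℝ}
    (hB : IsFluxPotential Ω h.1 B) (hper : Function.Periodic B 1) {α c ε : ℝ} {k : ℕ}
    (hc : ∀ q, |birkhoffAverage ℝ (skewProduct h α) (fun q => hper.lift q.2 q.1) k q - c| ≤ ε) :
    hoferNorm (γ ^ k) ≤ 2 * (k * ε) := by
  refine hoferNorm_le_of_isFluxPotential (c := k * c) (hγ.rotatedProd α k)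
    (hB.rotatedProd hper α k) fun t x => ?_
  rcases eq_or_ne k 0 with rfl | hk
  · simp only [birkhoffSum_zero, Nat.cast_zero, zero_mul, sub_zero, abs_zero, le_refl]
  · have hsum : birkhoffSum (skewProduct h α) (fun q => hper.lift q.2 q.1) k (x, ↑t) =
        k * birkhoffAverage ℝ (skewProduct h α) (fun q => hper.lift q.2 q.1) k (x, ↑t) := by
      rw [birkhoffAverage, smul_eq_mul, mul_inv_cancel_left₀ (Nat.cast_ne_zero.2 hk)]
    rw [hsum, ← mul_sub, abs_mul, Nat.abs_cast]
    exact mul_le_mul_of_nonneg_left (hc _) k.cast_nonneg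

end Norm

theorem mainTheorem11_general {E : Type*} [NormedAddCommGroup E] [NormedSpace ℝ E]
    [FiniteDimensional ℝ E] {M : Type*} [TopologicalSpace M] [ChartedSpace E M]
    [IsManifold 𝓘(ℝ, E) ∞ M] [T2Space M] [CompactSpace M] [ConnectedSpace M]
    {Ω : SymplecticForm E M} {γ : PiOneHam Ω} {h : HamLoop Ω} (hγ : Represents h γ) {α : ℝ}
    (hα : UniquelyErgodic (skewProduct h α)) :
    Tendsto (fun k : ℕ => hoferNorm (γ ^ k) / (k : ℝ)) atTop (𝓝 0) := by
  have : SecondCountableTopology M := ChartedSpace.secondCountable_of_sigmaCompact E M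
  obtain ⟨B, hB, hper⟩ := exists_isFluxPotential h.2.1 h.2.2.1 h.2.2.2
  obtain ⟨c, hc⟩ := hα.exists_tendstoUniformly_birkhoffAverage (continuous_skewProduct h α)
    (continuous_lift_periodic hB.1.continuous hper)
  refine Metric.tendsto_nhds.2 fun ε hε => ?_
  filter_upwards [Metric.tendstoUniformly_iff.1 hc (ε / 3) (by positivity), eventually_gt_atTop 0]
    with k hclose hk
  have hnorm : hoferNorm (γ ^ k) ≤ 2 * (k * (ε / 3)) :=
    hoferNorm_pow_le hγ hB hper fun q => (dist_comm c _ ▸ hclose q).le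
  have hkpos : (0 : ℝ) < k := Nat.cast_pos.2 hk
  rw [dist_zero_right, Real.norm_of_nonneg (div_nonneg (hoferNorm_nonneg _) hkpos.le),
    div_lt_iff₀ hkpos]
  linarith [mul_pos hkpos hε]

end

theorem mainTheorem11 (n : ℕ) {M : Type*} [TopologicalSpace M]
    [ChartedSpace (EuclideanSpace ℝ (Fin (2 * n))) M] [IsManifold (𝓡 (2 * n)) ∞ M]
    [T2Space M] [CompactSpace M] [ConnectedSpace M]
    (Ω : SymplecticForm (EuclideanSpace ℝ (Fin (2 * n))) M)
    (γ : PiOneHam Ω) (h : HamLoop Ω) (hγ : Represents h γ) (hh : IsStrictlyErgodicLoop h) :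
    Tendsto (fun k : ℕ => hoferNorm (γ ^ k) / (k : ℝ)) atTop (𝓝 0) :=
  let ⟨_, _, hα⟩ := hh
  mainTheorem11_general hγ hα.uniquelyErgodic
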